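/- **Set-up.** Let $(W,S)$ be a Coxeter system with $S$ finite, $\ell$ its length function, $\Gamma$ a totally ordered abelian group, and $\varphi:W\to\Gamma$ a weight function, i.e. $\varphi(ww')=\varphi(w)+\varphi(w')$ whenever $\ell(ww')=\ell(w)+\ell(w')$. Put $A=\mathbb Z[\Gamma]=\bigoplus_{\gamma}\mathbb Z e^\gamma$, let $\deg$ be the degree in $A$ ($\deg 0=-\infty$), and let $\mathcal H$ be the Hecke algebra: the $A$-algebra, free with basis $(T_w)_{w\in W}$, such that $T_wT_{w'}=T_{ww'}$ if $\ell(ww')=\ell(w)+\ell(w')$ and $(T_s-e^{\varphi(s)})(T_s+e^{-\varphi(s)})=0$ for $s\in S$. Let $\overline{\phantom{h}}$ be the ring involution of $\mathcal H$ with $\overline{e^\gamma}=e^{-\gamma}$, $\overline{T_w}=T_{w^{-1}}^{-1}$; let $C_w$ be the unique element of $\mathcal H$ with $\overline{C_w}=C_w$ and $C_w-T_w\in\bigoplus_{\gamma<0,\,x\in W}\mathbb Z e^\gamma T_x$; let $\tau:\mathcal H\to A$ be the $A$-linear form with $\tau(T_w)=\delta_{w,1}$; and write $C_xC_y=\sum_z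 h_{x,y,z}C_z$ with $h_{x,y,z}\in A$. Put $\Delta(w)=-\deg\tau(C_w)$ and let $n_w$ be the coefficient of $e^{-\Delta(w)}$ in $\tau(C_w)$ (if $\tau(C_w)=0$, then $\Delta(w)=+\infty$ and $n_w=0$). The datum is *bounded* if the degrees $\deg\tau(T_xT_yT_z)$ ($x,y,z\in W$) have a common upper bound in $\Gamma$. Put $\mathbf a(z)=\max_{x,y\in W}\deg h_{x,y,z}$, let $\gamma_{x,y,z^{-1}}\in\mathbb Z$ be the coefficient of $e^{\mathbf a(z)}$ in $h_{x,y,z}$ (should the maximum not be attained in $\Gamma$, $\mathbf a(z)=+\infty$ and $\gamma_{x,y,z^{-1}}=0$), and let $\mathcal D=\{z\in W\mid \mathbf a(z)=\Delta(z)\}$. Let $\leqslant_{\mathcal L}$ be the reflexive and transitive closure of the relation "$C_w$ occurs with non-zero coefficient in $C_sC_{w'}$ for some $s\in S$" between $w$ and $w'$, define $\leqslant_{\mathcal R}$ in the same way with $C_{w'}C_s$, and $\leqslant_{\mathcal{LR}}$ with either of the two; $\sim_{\mathcal L},\sim_{\mathcal R},\sim_{\mathcal{LR}}$ are the associated equivalence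 relations, and the left cells are the classes of $\sim_{\mathcal L}$. *Lusztig's conjectures* for $(W,S,\Gamma,\varphi)$ are the following statements (for all $x,x',y,z,z',w\in W$): - $(P_1)$ $\mathbf a(z)\le\Delta(z)$. - $(P_2)$ If $d\in\mathcal D$ and $\gamma_{x,y,d}\ne0$, then $x=y^{-1}$. - $(P_3)$ There is a unique $d\in\mathcal D$ with $\gamma_{y^{-1},y,d}\neq0$. - $(P_4)$ If $z'\leqslant_{\mathcal{LR}}z$, then $\mathbf a(z)\le\mathbf a(z')$. - $(P_5)$ If $d\in\mathcal D$ and $\gamma_{y^{-1},y,d}\ne0$, then $\gamma_{y^{-1},y,d}=n_d=\pm1$. - $(P_6)$ If $d\in\mathcal D$, then $d^2=1$. - $(P_7)$ $\gamma_{x,y,z}=\gamma_{y,z,x}$. - $(P_8)$ If $\gamma_{x,y,z}\ne0$, then $x\sim_{\mathcal L}y^{-1}$, $y\sim_{\mathcal L}z^{-1}$ and $z\sim_{\mathcal L}x^{-1}$. - $(P_9)$, $(P_{10})$, $(P_{11})$ For $?=\mathcal L$, $\mathcal R$, $\mathcal{LR}$ respectively: if $z'\leqslant_{?}z$ and $\mathbf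 a(z')=\mathbf a(z)$, then $z'\sim_{?}z$. - $(P_{12})$ If $I\subseteq S$ and $z\in W_I=\langle I\rangle$, then $\max_{x,y\in W_I}\deg h_{x,y,z}=\mathbf a(z)$. - $(P_{13})$ Every left cell $\mathcal C$ contains a unique $d\in\mathcal D$, and $\gamma_{y^{-1},y,d}\neq0$ for every $y\in\mathcal C$. - $(P_{14})$ $z\sim_{\mathcal{LR}}z^{-1}$. - $(P_{15})$ If $\mathbf a(y)=\mathbf a(w)$, then $\sum_{y'}h_{w,x',y'}\otimes h_{x,y',y}=\sum_{y'}h_{y',x',y}\otimes h_{x,w,y'}$ in $A\otimes_{\mathbb Z}A$. Let $J$ be the free abelian group with basis $(t_w)_{w\in W}$ and multiplication $t_xt_y=\sum_{z\in W}\gamma_{x,y,z^{-1}}t_z$. Let $G$ be a finite group acting on $W$ by automorphisms which stabilize $S$ and $\varphi$. Let $W^G$ be the fixed point subgroup, $\varphi_G=\varphi|_{W^G}$, and let $S_G$ be the set of the longest elements $s_\omega$ of the subgroups $W_\omega=\langle\omega\rangle$, where $\omega$ runs over the $G$-orbits in $S$ such that $W_\omega$ is finite. The above notions are defined in the same way for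 $(W^G,S_G,\Gamma,\varphi_G)$; in particular this gives $J_G$, with basis $(t^G_w)_{w\in W^G}$. The group $G$ acts on $J$ by ring automorphisms through $\sigma(t_w)=t_{\sigma(w)}$. For a ring $M$ on which $G$ acts by automorphisms, the Brauer quotient is $\mathrm{Br}_G(M)=M^G/\sum_{H<G}\mathrm{Tr}_H^G(M^H)$, where $H$ runs over the proper subgroups of $G$ and $\mathrm{Tr}_H^G(m)=\sum_{\sigma\in[G/H]}\sigma(m)$, and $\mathrm{br}_G:M^G\to\mathrm{Br}_G(M)$ is the canonical map. **Theorem.** Let $p$ be a prime number and assume that $G$ is a non-trivial finite $p$-group. Assume that $(W,S,\Gamma,\varphi)$ and $(W^G,S_G,\Gamma,\varphi_G)$ are bounded and that Lusztig's conjectures $(P_1),\dots,(P_{15})$ hold for both of them. Then there is a ring isomorphism $$\mathbb F_p\otimes_{\mathbb Z}J_G\;\simeq\;\mathrm{Br}_G(J),$$ namely one that sends $1\otimes t_w^{G}$ to $\mathrm{br}_G(t_w)$ for all $w\in W^G$. -/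

import Mathlib

open scoped TensorProduct

set_option linter.unusedSectionVars false

namespace UnequalHecke

noncomputable section

/-! ### Definite descriptions and maxima -/

open Classical in
/-- The unique object satisfying `P` (and the default value `d` if there is no such object, or more
than one). -/
def theUnique {α : Type*} (d : α) (P : α → Prop) : α :=
  if h : ∃! x, P x then h.choose else d

theorem theUnique_equiv {α β : Type*} (e : α ≃ β) {P : α → Prop} {Q : β → Prop}
    (hPQ : ∀ x, P x ↔ Q (e x)) {d : α} {d' : β} (hd : e d = d') :
    theUnique d' Q = e (theUnique d P) := by
  have hQ : (∃! y, Q y) ↔ ∃! x, P x := by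
    constructor
    · rintro ⟨y, hy, hu⟩
      refine ⟨e.symm y, (hPQ _).2 (by simpa using hy), fun x hx => ?_⟩
      rw [Equiv.eq_symm_apply]
      exact hu _ ((hPQ x).1 hx)
    · rintro ⟨x, hx, hu⟩
      refine ⟨e x, (hPQ x).1 hx, fun y hy => ?_⟩
      rw [← Equiv.symm_apply_eq]
      exact hu _ ((hPQ _).2 (by simpa using hy))
  unfold theUnique
  by_cases h : ∃! x, P x
  · have h' := hQ.2 h
    rw [dif_pos h, dif_pos h']
    exact h'.unique h'.choose_spec.1 ((hPQ _).1 h.choose_spec.1)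
  · rw [dif_neg h, dif_neg (fun h' => h (hQ.1 h')), hd]

open Classical in
/-- The maximum of a set of degrees, if it exists and is not `-∞`; otherwise `+∞`. -/
def maxDegree {Γ : Type*} [LinearOrder Γ] (X : Set (WithBot Γ)) : WithTop Γ :=
  if h : ∃ g : Γ, IsGreatest X (g : WithBot Γ) then ((h.choose : Γ) : WithTop Γ) else ⊤

/-! ### The group algebra `A = ℤ[Γ]` -/

/-- The group algebra `ℤ[Γ]`. -/
abbrev GrpAlg (Γ : Type*) : Type _ := AddMonoidAlgebra ℤ Γ

/-- The element `e^γ` of `ℤ[Γ]`. -/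
def expo {Γ : Type*} (γ : Γ) : GrpAlg Γ := AddMonoidAlgebra.single γ 1

/-- The degree of an element of `ℤ[Γ]`, with `deg 0 = -∞`. -/
def deg {Γ : Type*} [LinearOrder Γ] (a : GrpAlg Γ) : WithBot Γ := a.coeff.support.max

/-! ### Lengths and weight functions -/

section Defs

variable {W : Type*} [Group W] (S : Set W)

/-- The length of `w` with respect to `S`: the least `n` such that `w` is a product of `n` elements
of `S` (in a Coxeter group the elements of `S` are their own inverses). -/
def len (w : W) : ℕ :=
  sInf {n | ∃ l : List W, l.length = n ∧ (∀ s ∈ l, s ∈ S) ∧ l.prod = w}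

variable {Γ : Type*} [AddCommGroup Γ] [LinearOrder Γ] (φ : W → Γ)

/-- Weight functions: `φ(ww') = φ(w) + φ(w')` whenever `ℓ(ww') = ℓ(w) + ℓ(w')`. -/
def IsWeight : Prop :=
  ∀ w w' : W, len S (w * w') = len S w + len S w' → φ (w * w') = φ w + φ w'

/-! ### The Hecke algebra -/

/-- The defining relations of the Hecke algebra, on generators indexed by `W`. -/
inductive HeckeRel : FreeAlgebra (GrpAlg Γ) W → FreeAlgebra (GrpAlg Γ) W → Prop
  | one : HeckeRel (FreeAlgebra.ι (GrpAlg Γ) 1) 1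
  | mul (w w' : W) (h : len S (w * w') = len S w + len S w') :
      HeckeRel (FreeAlgebra.ι (GrpAlg Γ) w * FreeAlgebra.ι (GrpAlg Γ) w')
        (FreeAlgebra.ι (GrpAlg Γ) (w * w'))
  | quad (s : W) (hs : s ∈ S) :
      HeckeRel
        ((FreeAlgebra.ι (GrpAlg Γ) s - algebraMap (GrpAlg Γ) _ (expo (φ s))) *
          (FreeAlgebra.ι (GrpAlg Γ) s + algebraMap (GrpAlg Γ) _ (expo (-φ s)))) 0

/-- The Hecke algebra of `(W, S, Γ, φ)`, an algebra over `ℤ[Γ]`. -/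
def Hecke : Type _ := RingQuot (HeckeRel S φ)

instance : Ring (Hecke S φ) := inferInstanceAs (Ring (RingQuot (HeckeRel S φ)))

instance : Algebra (GrpAlg Γ) (Hecke S φ) :=
  inferInstanceAs (Algebra (GrpAlg Γ) (RingQuot (HeckeRel S φ)))

/-- The standard basis element `T_w`. -/
def T (w : W) : Hecke S φ :=
  RingQuot.mkAlgHom (GrpAlg Γ) (HeckeRel S φ) (FreeAlgebra.ι (GrpAlg Γ) w)

/-- The property characterizing the bar involution: it is a ring homomorphism with
`e^γ ↦ e^{-γ}` and `T_w ↦ (T_{w⁻¹})⁻¹`. -/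
def IsBar (f : Hecke S φ →+* Hecke S φ) : Prop :=
  (∀ γ : Γ, f (algebraMap (GrpAlg Γ) _ (expo γ)) = algebraMap (GrpAlg Γ) _ (expo (-γ))) ∧
  ∀ w : W, f (T S φ w) * T S φ w⁻¹ = 1 ∧ T S φ w⁻¹ * f (T S φ w) = 1

/-- The bar involution. -/
def bar : Hecke S φ →+* Hecke S φ := theUnique (RingHom.id _) (IsBar S φ)

/-- `H_{<0}`: the additive subgroup spanned by the `e^γ T_w` with `γ < 0`. -/
def heckeNeg : AddSubgroup (Hecke S φ) :=
  AddSubgroup.closure {h | ∃ γ : Γ, γ < 0 ∧ ∃ w : W, h = expo γ • T S φ w}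

/-- The Kazhdan-Lusztig element `C_w`: the unique bar-invariant element congruent to `T_w` modulo
`H_{<0}`. -/
def C (w : W) : Hecke S φ :=
  theUnique 0 fun c => bar S φ c = c ∧ c - T S φ w ∈ heckeNeg S φ

open Classical in
/-- The `A`-linear form `τ` with `τ(T_w) = 1` if `w = 1` and `0` otherwise. -/
def tau : Hecke S φ →ₗ[GrpAlg Γ] GrpAlg Γ :=
  theUnique 0 fun f => ∀ w : W, f (T S φ w) = if w = 1 then 1 else 0

/-- The structure constants: `h_{x,y,z} = hcoef S φ x y z`, determined by
`C_x C_y = ∑_z h_{x,y,z} C_z`. -/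
def hcoef (x y : W) : W →₀ GrpAlg Γ :=
  theUnique 0 fun f => C S φ x * C S φ y = f.sum fun z a => a • C S φ z

/-- Boundedness: the degrees of the `τ(T_x T_y T_z)` have a common upper bound in `Γ`. -/
def IsBounded : Prop :=
  ∃ γ₀ : Γ, ∀ x y z : W,
    deg (tau S φ (T S φ x * T S φ y * T S φ z)) ≤ (γ₀ : WithBot Γ)

/-! ### The functions `Δ`, `n`, `a` and the integers `γ_{x,y,z}` -/

/-- `Δ(w) = -deg τ(C_w)` (equal to `+∞` if `τ(C_w) = 0`). -/
def Delta (w : W) : WithTop Γ :=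
  WithBot.recBotCoe (C := fun _ => WithTop Γ) ⊤ (fun g => ((-g : Γ) : WithTop Γ))
    (deg (tau S φ (C S φ w)))

/-- `n_w`: the coefficient of `e^{-Δ(w)}` in `τ(C_w)`. -/
def ncoef (w : W) : ℤ :=
  WithBot.recBotCoe (C := fun _ => ℤ) 0 (fun g => (tau S φ (C S φ w)).coeff g)
    (deg (tau S φ (C S φ w)))

/-- `max_{x, y ∈ U} deg h_{x,y,z}` (equal to `+∞` if this maximum does not exist). -/
def aOn (U : Set W) (z : W) : WithTop Γ :=
  maxDegree {d | ∃ x ∈ U, ∃ y ∈ U, d = deg (hcoef S φ x y z)}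

/-- Lusztig's function `a`. -/
def aFun (z : W) : WithTop Γ := aOn S φ Set.univ z

/-- The integer `γ_{x,y,z}`: the coefficient of `e^{a(z⁻¹)}` in `h_{x,y,z⁻¹}`
(equal to `0` if `a(z⁻¹) = +∞`). -/
def gam (x y z : W) : ℤ :=
  WithTop.recTopCoe (C := fun _ => ℤ) 0 (fun g => (hcoef S φ x y z⁻¹).coeff g)
    (aFun S φ z⁻¹)

/-- The set `𝒟 = {z | a(z) = Δ(z)}`. -/
def DSet : Set W := {z | aFun S φ z = Delta S φ z}

/-! ### Cells -/

/-- `w ←_L w'`: for some `s ∈ S`, `C_w` occurs in `C_s C_{w'}`. -/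
def arrowL (w w' : W) : Prop := ∃ s ∈ S, hcoef S φ s w' w ≠ 0

/-- `w ←_R w'`: for some `s ∈ S`, `C_w` occurs in `C_{w'} C_s`. -/
def arrowR (w w' : W) : Prop := ∃ s ∈ S, hcoef S φ w' s w ≠ 0

/-- The preorder `≤_L`. -/
def leL : W → W → Prop := Relation.ReflTransGen (arrowL S φ)

/-- The preorder `≤_R`. -/
def leR : W → W → Prop := Relation.ReflTransGen (arrowR S φ)

/-- The preorder `≤_{LR}`. -/
def leLR : W → W → Prop := Relation.ReflTransGen fun w w' => arrowL S φ w w' ∨ arrowR S φ w w'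

/-- The equivalence relation `∼_L`, whose classes are the left cells. -/
def simL (x y : W) : Prop := leL S φ x y ∧ leL S φ y x

/-- The equivalence relation `∼_R`. -/
def simR (x y : W) : Prop := leR S φ x y ∧ leR S φ y x

/-- The equivalence relation `∼_{LR}`. -/
def simLR (x y : W) : Prop := leLR S φ x y ∧ leLR S φ y x

/-! ### Lusztig's conjectures -/

/-- Lusztig's conjectures `P₁`, …, `P₁₅` for `(W, S, Γ, φ)`. -/
structure LusztigConjectures : Prop where
  P1 : ∀ z : W, aFun S φ z ≤ Delta S φ z
  P2 : ∀ d ∈ DSet S φ, ∀ x y : W, gam S φ x y d ≠ 0 → x = y⁻¹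
  P3 : ∀ y : W, ∃! d : W, d ∈ DSet S φ ∧ gam S φ y⁻¹ y d ≠ 0
  P4 : ∀ z' z : W, leLR S φ z' z → aFun S φ z ≤ aFun S φ z'
  P5 : ∀ d ∈ DSet S φ, ∀ y : W, gam S φ y⁻¹ y d ≠ 0 →
    gam S φ y⁻¹ y d = ncoef S φ d ∧ (ncoef S φ d = 1 ∨ ncoef S φ d = -1)
  P6 : ∀ d ∈ DSet S φ, d ^ 2 = 1
  P7 : ∀ x y z : W, gam S φ x y z = gam S φ y z x
  P8 : ∀ x y z : W, gam S φ x y z ≠ 0 →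
    simL S φ x y⁻¹ ∧ simL S φ y z⁻¹ ∧ simL S φ z x⁻¹
  P9 : ∀ z' z : W, leL S φ z' z → aFun S φ z' = aFun S φ z → simL S φ z' z
  P10 : ∀ z' z : W, leR S φ z' z → aFun S φ z' = aFun S φ z → simR S φ z' z
  P11 : ∀ z' z : W, leLR S φ z' z → aFun S φ z' = aFun S φ z → simLR S φ z' z
  P12 : ∀ I ⊆ S, ∀ z ∈ Subgroup.closure I,
    aOn S φ (Subgroup.closure I : Set W) z = aFun S φ z
  P13 : ∀ x : W, (∃! d : W, d ∈ DSet S φ ∧ simL S φ d x) ∧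
    ∀ d ∈ DSet S φ, simL S φ d x → gam S φ x⁻¹ x d ≠ 0
  P14 : ∀ z : W, simLR S φ z z⁻¹
  P15 : ∀ x x' y w : W, aFun S φ y = aFun S φ w →
    ((hcoef S φ w x').sum fun y' a => a ⊗ₜ[ℤ] hcoef S φ x y' y) =
      (hcoef S φ x w).sum fun y' b => hcoef S φ y' x' y ⊗ₜ[ℤ] b

/-! ### The asymptotic ring -/

/-- The product `t_x t_y = ∑_z γ_{x,y,z⁻¹} t_z`. -/
def tmul (x y : W) : W →₀ ℤ :=
  Finsupp.onFinset (hcoef S φ x y).support (fun z => gam S φ x y z⁻¹) <| by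
    intro z hz
    rw [Finsupp.mem_support_iff]
    intro h0
    apply hz
    unfold gam
    rw [inv_inv, h0]
    induction aFun S φ z using WithTop.recTopCoe <;> simp

/-- Lusztig's asymptotic ring `J`: the free abelian group with basis `(t_w)_{w ∈ W}`. -/
def AsympRing {W Γ : Type*} (_S : Set W) (_φ : W → Γ) : Type _ := W →₀ ℤ

instance : AddCommGroup (AsympRing S φ) := inferInstanceAs (AddCommGroup (W →₀ ℤ))

/-- The basis element `t_w` of `J`. -/
def t (w : W) : AsympRing S φ := (Finsupp.single w 1 : W →₀ ℤ)

/-- The multiplication of `J`, as a bilinear map. -/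
def asympMul : (W →₀ ℤ) →ₗ[ℤ] (W →₀ ℤ) →ₗ[ℤ] (W →₀ ℤ) :=
  Finsupp.lift _ ℤ W fun x => Finsupp.lift _ ℤ W fun y => tmul S φ x y

instance : Mul (AsympRing S φ) := ⟨fun f g => asympMul S φ f g⟩

instance : NonUnitalNonAssocRing (AsympRing S φ) where
  left_distrib f g h := map_add (asympMul S φ f) g h
  right_distrib f g h := LinearMap.map_add₂ (asympMul S φ) f g h
  zero_mul f := LinearMap.map_zero₂ (asympMul S φ) f
  mul_zero f := map_zero (asympMul S φ f)

theorem t_mul_t (x y : W) : t S φ x * t S φ y = (tmul S φ x y : W →₀ ℤ) := by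
  change asympMul S φ (Finsupp.single x 1) (Finsupp.single y 1) = _
  simp [asympMul]

end Defs

/-! ### Functoriality under automorphisms of `(W, S, φ)` -/

section Automorphisms

variable {W : Type*} [Group W] {S : Set W} {Γ : Type*} [AddCommGroup Γ] [LinearOrder Γ] {φ : W → Γ}

/-- `σ` stabilizes `S` and `φ`. -/
structure Preserves (S : Set W) (φ : W → Γ) (σ : W ≃* W) : Prop where
  mem_iff : ∀ w, σ w ∈ S ↔ w ∈ S
  weight : ∀ w, φ (σ w) = φ w

theorem Preserves.symm {σ : W ≃* W} (h : Preserves S φ σ) : Preserves S φ σ.symm :=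
  ⟨fun w => by rw [← h.mem_iff, MulEquiv.apply_symm_apply],
    fun w => by rw [← h.weight, MulEquiv.apply_symm_apply]⟩

theorem Preserves.len_le {σ : W ≃* W} (h : Preserves S φ σ) (w : W) {n : ℕ}
    (hn : ∃ l : List W, l.length = n ∧ (∀ s ∈ l, s ∈ S) ∧ l.prod = w) :
    ∃ l : List W, l.length = n ∧ (∀ s ∈ l, s ∈ S) ∧ l.prod = σ w := by
  obtain ⟨l, h1, h2, h3⟩ := hn
  refine ⟨l.map σ, by simpa using h1, ?_, ?_⟩
  · intro s hs
    obtain ⟨u, hu, rfl⟩ := List.mem_map.1 hs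
    exact (h.mem_iff u).2 (h2 u hu)
  · rw [← h3, map_list_prod]

theorem Preserves.len_eq {σ : W ≃* W} (h : Preserves S φ σ) (w : W) : len S (σ w) = len S w := by
  unfold len
  congr 1
  ext n
  refine ⟨fun hn => ?_, fun hn => h.len_le w hn⟩
  have := h.symm.len_le (σ w) hn
  rwa [MulEquiv.symm_apply_apply] at this

/-- The algebra endomorphism of the Hecke algebra with `T_w ↦ T_{σ(w)}`. -/
def Preserves.map {σ : W ≃* W} (h : Preserves S φ σ) : Hecke S φ →ₐ[GrpAlg Γ] Hecke S φ :=
  RingQuot.liftAlgHom (GrpAlg Γ) (s := HeckeRel S φ)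
    ⟨FreeAlgebra.lift (GrpAlg Γ) fun w => T S φ (σ w), by
      intro x y hxy
      induction hxy with
      | one =>
        rw [FreeAlgebra.lift_ι_apply, map_one, map_one]
        have := RingQuot.mkAlgHom_rel (GrpAlg Γ) (HeckeRel.one (S := S) (φ := φ))
        rwa [map_one] at this
      | mul w w' hw =>
        rw [map_mul, FreeAlgebra.lift_ι_apply, FreeAlgebra.lift_ι_apply, FreeAlgebra.lift_ι_apply,
          map_mul]
        have := RingQuot.mkAlgHom_rel (GrpAlg Γ) (HeckeRel.mul (S := S) (φ := φ) (σ w) (σ w')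
          (by rw [← map_mul, h.len_eq, h.len_eq, h.len_eq, hw]))
        rwa [map_mul] at this
      | quad s hs =>
        have := RingQuot.mkAlgHom_rel (GrpAlg Γ)
          (HeckeRel.quad (S := S) (φ := φ) (σ s) ((h.mem_iff s).2 hs))
        rw [h.weight, map_mul, map_sub, map_add, AlgHom.commutes, AlgHom.commutes, map_zero] at this
        rw [map_mul, map_sub, map_add, AlgHom.commutes, AlgHom.commutes, map_zero,
          FreeAlgebra.lift_ι_apply]
        exact this⟩

@[simp]
theorem Preserves.map_T {σ : W ≃* W} (h : Preserves S φ σ) (w : W) :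
    h.map (T S φ w) = T S φ (σ w) := by
  refine (RingQuot.liftAlgHom_mkAlgHom_apply (GrpAlg Γ) _ _ _).trans ?_
  exact FreeAlgebra.lift_ι_apply _ _

theorem Hecke.algHom_ext {f g : Hecke S φ →ₐ[GrpAlg Γ] Hecke S φ}
    (hfg : ∀ w, f (T S φ w) = g (T S φ w)) : f = g := by
  apply RingQuot.ringQuot_ext'
  apply FreeAlgebra.hom_ext
  funext w
  exact hfg w

/-- The algebra automorphism of the Hecke algebra with `T_w ↦ T_{σ(w)}`. -/
def Preserves.equiv {σ : W ≃* W} (h : Preserves S φ σ) : Hecke S φ ≃ₐ[GrpAlg Γ] Hecke S φ :=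
  AlgEquiv.ofAlgHom h.map h.symm.map
    (Hecke.algHom_ext fun w => by simp)
    (Hecke.algHom_ext fun w => by simp)

@[simp]
theorem Preserves.equiv_T {σ : W ≃* W} (h : Preserves S φ σ) (w : W) :
    h.equiv (T S φ w) = T S φ (σ w) := h.map_T w

@[simp]
theorem Preserves.equiv_symm_T {σ : W ≃* W} (h : Preserves S φ σ) (w : W) :
    h.equiv.symm (T S φ w) = T S φ (σ.symm w) := h.symm.map_T w

/-- Conjugation of ring endomorphisms of the Hecke algebra by `σ`. -/
def Preserves.conj {σ : W ≃* W} (h : Preserves S φ σ) :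
    (Hecke S φ →+* Hecke S φ) ≃ (Hecke S φ →+* Hecke S φ) where
  toFun f := (h.equiv : Hecke S φ →+* Hecke S φ).comp
    (f.comp (h.equiv.symm : Hecke S φ →+* Hecke S φ))
  invFun f := (h.equiv.symm : Hecke S φ →+* Hecke S φ).comp
    (f.comp (h.equiv : Hecke S φ →+* Hecke S φ))
  left_inv f := by ext x; simp
  right_inv f := by ext x; simp

theorem Preserves.conj_apply {σ : W ≃* W} (h : Preserves S φ σ) (f : Hecke S φ →+* Hecke S φ)
    (x : Hecke S φ) : h.conj f x = h.equiv (f (h.equiv.symm x)) := rfl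

theorem Preserves.isBar {σ : W ≃* W} (h : Preserves S φ σ) (f : Hecke S φ →+* Hecke S φ) :
    IsBar S φ f ↔ IsBar S φ (h.conj f) := by
  unfold IsBar
  simp only [h.conj_apply, AlgEquiv.commutes, h.equiv_symm_T]
  refine and_congr (forall_congr' fun γ => ?_) ?_
  · conv_rhs => rw [← AlgEquiv.commutes h.equiv (expo (-γ)), h.equiv.injective.eq_iff]
  · have key : ∀ w : W, T S φ w⁻¹ = h.equiv (T S φ (σ.symm w)⁻¹) := by
      intro w
      rw [h.equiv_T, map_inv, MulEquiv.apply_symm_apply]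
    constructor
    · intro hf w
      obtain ⟨h1, h2⟩ := hf (σ.symm w)
      rw [key w, ← map_mul, ← map_mul, h1, h2, map_one]
      exact ⟨rfl, rfl⟩
    · intro hf w
      obtain ⟨h1, h2⟩ := hf (σ w)
      rw [key (σ w), ← map_mul, MulEquiv.symm_apply_apply] at h1 h2
      exact ⟨h.equiv.injective (h1.trans (map_one _).symm),
        h.equiv.injective (h2.trans (map_one _).symm)⟩

theorem Preserves.bar_equiv {σ : W ≃* W} (h : Preserves S φ σ) (x : Hecke S φ) :
    bar S φ (h.equiv x) = h.equiv (bar S φ x) := by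
  have : bar S φ = h.conj (bar S φ) := by
    conv_lhs => unfold bar
    refine theUnique_equiv h.conj h.isBar ?_
    ext x
    simp [h.conj_apply]
  conv_lhs => rw [this, h.conj_apply, AlgEquiv.symm_apply_apply]

theorem Preserves.equiv_mem_heckeNeg {σ : W ≃* W} (h : Preserves S φ σ) {x : Hecke S φ}
    (hx : x ∈ heckeNeg S φ) : h.equiv x ∈ heckeNeg S φ := by
  induction hx using AddSubgroup.closure_induction with
  | mem x hx =>
    obtain ⟨γ, hγ, w, rfl⟩ := hx
    exact AddSubgroup.subset_closure ⟨γ, hγ, σ w, by rw [map_smul, h.equiv_T]⟩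
  | zero => rw [map_zero]; exact zero_mem _
  | add x y _ _ hx hy => rw [map_add]; exact add_mem hx hy
  | neg x _ hx => rw [map_neg]; exact neg_mem hx

theorem Preserves.C_eq {σ : W ≃* W} (h : Preserves S φ σ) (w : W) :
    C S φ (σ w) = h.equiv (C S φ w) := by
  refine theUnique_equiv h.equiv.toEquiv (fun c => ?_) (map_zero h.equiv)
  change _ ↔ bar S φ (h.equiv c) = h.equiv c ∧ h.equiv c - T S φ (σ w) ∈ heckeNeg S φ
  rw [h.bar_equiv, h.equiv.injective.eq_iff, ← h.equiv_T, ← map_sub]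
  refine and_congr Iff.rfl ⟨h.equiv_mem_heckeNeg, fun hc => ?_⟩
  have := h.symm.equiv_mem_heckeNeg hc
  have e : ∀ x, h.symm.equiv (h.equiv x) = x := fun x => h.equiv.symm_apply_apply x
  rwa [e] at this

theorem Preserves.hcoef_eq {σ : W ≃* W} (h : Preserves S φ σ) (x y z : W) :
    hcoef S φ (σ x) (σ y) (σ z) = hcoef S φ x y z := by
  have : hcoef S φ (σ x) (σ y) = Finsupp.domCongr σ.toEquiv (hcoef S φ x y) := by
    refine theUnique_equiv (Finsupp.domCongr (M := GrpAlg Γ) σ.toEquiv).toEquiv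
      (fun f => ?_) (map_zero (Finsupp.domCongr (M := GrpAlg Γ) σ.toEquiv))
    change _ ↔ C S φ (σ x) * C S φ (σ y) =
      (Finsupp.equivMapDomain σ.toEquiv f).sum fun z a => a • C S φ z
    rw [Finsupp.sum_equivMapDomain, h.C_eq, h.C_eq, ← map_mul]
    have : (f.sum fun z a => a • C S φ (σ.toEquiv z)) =
        h.equiv (f.sum fun z a => a • C S φ z) := by
      rw [map_finsuppSum]
      refine Finsupp.sum_congr fun z _ => ?_
      rw [map_smul, ← h.C_eq]
      rfl
    rw [this, h.equiv.injective.eq_iff]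
  rw [this]
  change Finsupp.equivMapDomain σ.toEquiv (hcoef S φ x y) (σ z) = _
  rw [Finsupp.equivMapDomain_apply]
  congr 1
  exact σ.symm_apply_apply z

theorem Preserves.aFun_eq {σ : W ≃* W} (h : Preserves S φ σ) (z : W) :
    aFun S φ (σ z) = aFun S φ z := by
  unfold aFun aOn
  congr 1
  ext d
  constructor
  · rintro ⟨x, -, y, -, rfl⟩
    refine ⟨σ.symm x, trivial, σ.symm y, trivial, ?_⟩
    rw [← h.hcoef_eq (σ.symm x), MulEquiv.apply_symm_apply, MulEquiv.apply_symm_apply]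
  · rintro ⟨x, -, y, -, rfl⟩
    exact ⟨σ x, trivial, σ y, trivial, by rw [h.hcoef_eq]⟩

theorem Preserves.gam_eq {σ : W ≃* W} (h : Preserves S φ σ) (x y z : W) :
    gam S φ (σ x) (σ y) (σ z) = gam S φ x y z := by
  unfold gam
  rw [← map_inv, h.aFun_eq, h.hcoef_eq]

end Automorphisms

/-! ### The Brauer quotient -/

section Brauer

variable {G : Type*} [Group G]

/-- `Tr_H^G(m) = ∑_{σ ∈ [G/H]} σ(m)`. -/
def relTrace {M : Type*} [AddCommGroup M] [DistribMulAction G M] (H : Subgroup G) (m : M) : M :=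
  ∑ᶠ q : G ⧸ H, q.out • m

variable (G) in
/-- `Tr(M) = ∑_{H < G} Tr_H^G(M^H)`. -/
def traceSum (M : Type*) [AddCommGroup M] [DistribMulAction G M] : AddSubgroup M :=
  AddSubgroup.closure
    {x | ∃ H : Subgroup G, H < ⊤ ∧ ∃ m : M, (∀ g ∈ H, g • m = m) ∧ x = relTrace H m}

variable {M : Type*} [NonUnitalNonAssocRing M] [DistribMulAction G M]

/-- The fixed subring `M^G` of a ring on which `G` acts by ring automorphisms. -/
def fixedRing (hmul : ∀ (g : G) (a b : M), g • (a * b) = (g • a) * (g • b)) :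
    NonUnitalSubring M where
  carrier := {m | ∀ g : G, g • m = m}
  add_mem' ha hb g := by rw [smul_add, ha g, hb g]
  zero_mem' g := smul_zero g
  neg_mem' ha g := by rw [smul_neg, ha g]
  mul_mem' ha hb g := by rw [hmul, ha g, hb g]

theorem mul_mem_traceSum [Finite G]
    (hmul : ∀ (g : G) (a b : M), g • (a * b) = (g • a) * (g • b)) {x y : M}
    (hx : ∀ g : G, g • x = x) (hy : y ∈ traceSum G M) : x * y ∈ traceSum G M := by
  induction hy using AddSubgroup.closure_induction with
  | mem y hy =>
    obtain ⟨H, hH, m, hm, rfl⟩ := hy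
    refine AddSubgroup.subset_closure ⟨H, hH, x * m, fun g hg => by rw [hmul, hx, hm g hg], ?_⟩
    unfold relTrace
    rw [← AddMonoidHom.coe_mulLeft, AddMonoidHom.map_finsum _ (Set.toFinite _)]
    exact finsum_congr fun q => by simp [hmul, hx]
  | zero => rw [mul_zero]; exact zero_mem _
  | add a b _ _ ha hb => rw [mul_add]; exact add_mem ha hb
  | neg a _ ha => rw [mul_neg]; exact neg_mem ha

theorem mem_traceSum_mul [Finite G]
    (hmul : ∀ (g : G) (a b : M), g • (a * b) = (g • a) * (g • b)) {x y : M}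
    (hx : ∀ g : G, g • x = x) (hy : y ∈ traceSum G M) : y * x ∈ traceSum G M := by
  induction hy using AddSubgroup.closure_induction with
  | mem y hy =>
    obtain ⟨H, hH, m, hm, rfl⟩ := hy
    refine AddSubgroup.subset_closure ⟨H, hH, m * x, fun g hg => by rw [hmul, hx, hm g hg], ?_⟩
    unfold relTrace
    change AddMonoidHom.mulRight x _ = _
    rw [AddMonoidHom.map_finsum _ (Set.toFinite _)]
    exact finsum_congr fun q => by simp [hmul, hx]
  | zero => rw [zero_mul]; exact zero_mem _
  | add a b _ _ ha hb => rw [add_mul]; exact add_mem ha hb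
  | neg a _ ha => rw [neg_mul]; exact neg_mem ha

/-- `Tr(M)`, as a two-sided ideal of `M^G`. -/
def traceIdeal [Finite G] (hmul : ∀ (g : G) (a b : M), g • (a * b) = (g • a) * (g • b)) :
    TwoSidedIdeal (fixedRing hmul) :=
  TwoSidedIdeal.mk' {x | (x : M) ∈ traceSum G M}
    (zero_mem (traceSum G M))
    (fun {x y} hx hy => (traceSum G M).add_mem (x := (x : M)) (y := (y : M)) hx hy)
    (fun {x} hx => (traceSum G M).neg_mem (x := (x : M)) hx)
    (fun {x _} hy => mul_mem_traceSum hmul x.2 hy)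
    (fun {_ y} hx => mem_traceSum_mul hmul y.2 hx)

/-- The Brauer quotient `Br_G(M) = M^G / Tr(M)`. -/
abbrev BrauerQuotient [Finite G] (hmul : ∀ (g : G) (a b : M), g • (a * b) = (g • a) * (g • b)) :
    Type _ :=
  (traceIdeal hmul).ringCon.Quotient

/-- The canonical map `br_G : M^G → Br_G(M)`. -/
def br [Finite G] (hmul : ∀ (g : G) (a b : M), g • (a * b) = (g • a) * (g • b))
    (m : fixedRing hmul) : BrauerQuotient hmul := (m : (traceIdeal hmul).ringCon.Quotient)

end Brauer

/-! ### Group actions on `(W, S, Γ, φ)` and the fixed point datum -/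

section Action

variable (G : Type*) [Group G] {W : Type*} [Group W] [MulDistribMulAction G W] (S : Set W)
  {Γ : Type*} [AddCommGroup Γ] [LinearOrder Γ] (φ : W → Γ)

/-- The set `S_G` of the longest elements `s_ω` of the finite subgroups `W_ω = ⟨ω⟩`, where `ω` runs
over the `G`-orbits in `S`. -/
def fixedSimple : Set (FixedPoints.subgroup G W) :=
  {w | ∃ s ∈ S, (Subgroup.closure (MulAction.orbit G s) : Set W).Finite ∧
    (w : W) ∈ Subgroup.closure (MulAction.orbit G s) ∧
    ∀ w' ∈ Subgroup.closure (MulAction.orbit G s), len S w' ≤ len S (w : W)}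

/-- The restriction `φ_G` of `φ` to `W^G`. -/
def fixedWeight : FixedPoints.subgroup G W → Γ := fun w => φ w

/-- The action of `G` on `J` by `σ(t_w) = t_{σ(w)}`. -/
instance : DistribMulAction G (AsympRing S φ) where
  smul g f := Finsupp.mapDomain (g • ·) (f : W →₀ ℤ)
  one_smul f := by
    change Finsupp.mapDomain (fun w : W => (1 : G) • w) (f : W →₀ ℤ) = f
    simp only [one_smul]
    exact Finsupp.mapDomain_id
  mul_smul g g' f := by
    have : (fun w : W => (g * g') • w) = (g • ·) ∘ (g' • ·) := funext fun w => mul_smul g g' w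
    change Finsupp.mapDomain (fun w : W => (g * g') • w) _ = _
    rw [this]
    exact Finsupp.mapDomain_comp
  smul_zero _ := Finsupp.mapDomain_zero
  smul_add _ _ _ := Finsupp.mapDomain_add

theorem smul_t (g : G) (w : W) : g • t S φ w = t S φ (g • w) :=
  Finsupp.mapDomain_single

variable {G S φ}

theorem preserves_of_action (hS : ∀ (g : G), ∀ s ∈ S, g • s ∈ S)
    (hφ : ∀ (g : G) (w : W), φ (g • w) = φ w) (g : G) :
    Preserves S φ (MulDistribMulAction.toMulEquiv W g) where
  mem_iff w := ⟨fun h => by simpa using hS g⁻¹ _ h, fun h => hS g w h⟩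
  weight w := hφ g w

/-- `G` acts on `J` by ring automorphisms. -/
theorem smul_mul_asymp (hS : ∀ (g : G), ∀ s ∈ S, g • s ∈ S)
    (hφ : ∀ (g : G) (w : W), φ (g • w) = φ w) (g : G) (a b : AsympRing S φ) :
    g • (a * b) = (g • a) * (g • b) := by
  have hg := preserves_of_action hS hφ g
  have key : ∀ x y : W, Finsupp.mapDomain (g • ·) (tmul S φ x y) = tmul S φ (g • x) (g • y) := by
    intro x y
    ext z
    have hz : z = g • (g⁻¹ • z) := (smul_inv_smul g z).symm
    rw [hz]
    refine (Finsupp.mapDomain_apply (MulAction.injective g) _ _).trans ?_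
    change gam S φ x y (g⁻¹ • z)⁻¹ = gam S φ (g • x) (g • y) (g • g⁻¹ • z)⁻¹
    have e : (g • g⁻¹ • z)⁻¹ = g • (g⁻¹ • z)⁻¹ := (smul_inv' g _).symm
    rw [e]
    exact (hg.gam_eq x y _).symm
  let L : (W →₀ ℤ) →ₗ[ℤ] (W →₀ ℤ) := Finsupp.lmapDomain ℤ ℤ (g • ·)
  have : (asympMul S φ).compr₂ L = (asympMul S φ).compl₁₂ L L := by
    ext x y : 4
    simp only [asympMul, L, LinearMap.compr₂_apply, LinearMap.compl₁₂_apply, LinearMap.comp_apply,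
      Finsupp.lsingle_apply, Finsupp.lmapDomain_apply, Finsupp.mapDomain_single]
    simp [key]
  exact LinearMap.congr_fun₂ this a b

end Action

end

end UnequalHecke

/-! The theorem is a congruence modulo p between structure constants. When a p-group permutes a
finite set, its non-trivial orbits have cardinality divisible by p, so an invariant sum is congruent
to its restriction to the fixed points (`dvd_sum_sub_sum_fixed`). Let H_G be the Hecke algebra of
(W^G, S_G, φ_G) and let `rho : H → H_G` keep the T_w-coordinates with w in W^G and forget the
others. On G-invariant elements `rho` is, modulo p, multiplicative (`dvd_rho_mul`) and compatible
with the bar involutions (`dvd_rho_bar`). The one real computation is T_x² for x = s_ω (`rho_T_sq`):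
the fixed points of W_ω are only 1 and x, so two coefficients have to be found. The form τ gives the
first, and the index representation T_w ↦ e^{φ(w)} gives the second modulo p.

Next, `rho (C_w)` minus the corresponding element of H_G lies in the negative part and is
bar-invariant modulo p, hence vanishes modulo p (`dvd_rho_C`). So for fixed points the h_{x,y,z} and
the τ(C_w) of the two systems are congruent modulo p (`dvd_hcoef`, `dvd_tau_C`).

The integers γ are coefficients at the exponent a(z), so the two functions a must be shown to agree
on W^G (`exists_aFun_eq`). A congruence alone could lose a leading coefficient; Lusztig's
conjectures prevent this, because the relevant leading coefficients are ±1 and so survive modulo p.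
The congruence of the γ follows (`dvd_gam_sub`).

Finally, the sum of the proper traces in J consists exactly of the invariant elements whose
coefficients at fixed points are divisible by p (`dvd_of_mem_traceSum`, `mem_traceSum_of_dvd`). Thus
Br_G(J) and F_p ⊗ J_G are both described by coordinates in F_p indexed by W^G, with the same
structure constants.

All of this requires that (W^G, S_G) behave like a Coxeter system and that the basis T_w, the bar
involution and the C_w exist for both systems. Both are treated at once through `ExchangeSystem` and
`HeckeDatum`. -/

namespace UnequalHecke

noncomputable section

/-! ### Exchange systems -/

section Exchange

/-- A group `V` generated by a set `S` of involutions, with descent sets satisfying the folding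
condition.  This is equivalent to `(V, S)` being a Coxeter system. -/
structure ExchangeSystem {V : Type*} [Group V] (S : Set V) : Prop where
  sq : ∀ s ∈ S, s * s = 1
  gen : ∀ w : V, ∃ l : List V, (∀ s ∈ l, s ∈ S) ∧ l.prod = w
  -- `D s w` plays the role of ℓ(sw) < ℓ(w). It is left free because it is given by a parity of
  -- inversions for Coxeter systems and by the length of W for the fixed point system;
  -- `descent_iff_len_lt` shows that it is forced.
  exch : ∃ D : V → V → Prop, (∀ s ∈ S, ¬ D s 1) ∧ (∀ s ∈ S, ∀ w, D s (s * w) ↔ ¬ D s w) ∧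
    ∀ s ∈ S, ∀ t ∈ S, ∀ w, ¬ D s w → D s (w * t) → s * w = w * t

variable {V : Type*} [Group V] {S : Set V}

theorem len_prod_le {l : List V} (hl : ∀ s ∈ l, s ∈ S) : len S l.prod ≤ l.length :=
  Nat.sInf_le ⟨l, rfl, hl, rfl⟩

namespace ExchangeSystem

variable (hS : ExchangeSystem S)
include hS

theorem inv_eq {s : V} (hs : s ∈ S) : s⁻¹ = s := inv_eq_of_mul_eq_one_left (hS.sq s hs)

theorem mul_cancel {s : V} (hs : s ∈ S) (w : V) : s * (s * w) = w := by
  rw [← mul_assoc, hS.sq s hs, one_mul]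

theorem mul_cancel_right {s : V} (hs : s ∈ S) (w : V) : w * s * s = w := by
  rw [mul_assoc, hS.sq s hs, mul_one]

theorem exists_reduced (w : V) :
    ∃ l : List V, l.length = len S w ∧ (∀ s ∈ l, s ∈ S) ∧ l.prod = w := by
  obtain ⟨l, h1, h2⟩ := hS.gen w
  exact Nat.sInf_mem (s := {n | ∃ l : List V, l.length = n ∧ (∀ s ∈ l, s ∈ S) ∧ l.prod = w})
    ⟨l.length, l, rfl, h1, h2⟩

theorem len_one : len S (1 : V) = 0 :=
  Nat.le_zero.1 (len_prod_le (S := S) (l := []) (by simp))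

theorem len_eq_zero {w : V} : len S w = 0 ↔ w = 1 := by
  refine ⟨fun h => ?_, fun h => h ▸ hS.len_one⟩
  obtain ⟨l, h1, -, rfl⟩ := hS.exists_reduced w
  rw [h, List.length_eq_zero_iff] at h1
  simp [h1]

theorem len_mul_le (u v : V) : len S (u * v) ≤ len S u + len S v := by
  obtain ⟨l, h1, h2, h3⟩ := hS.exists_reduced u
  obtain ⟨l', h1', h2', h3'⟩ := hS.exists_reduced v
  rw [← h1, ← h1', ← h3, ← h3', ← List.length_append, ← List.prod_append]
  refine len_prod_le fun s hs => ?_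
  rcases List.mem_append.1 hs with h | h
  · exact h2 s h
  · exact h2' s h

theorem len_inv_le (w : V) : len S w⁻¹ ≤ len S w := by
  obtain ⟨l, h1, h2, rfl⟩ := hS.exists_reduced w
  rw [List.prod_inv_reverse, ← h1]
  refine (len_prod_le fun s hs => ?_).trans (by simp)
  simp only [List.mem_reverse, List.mem_map] at hs
  obtain ⟨a, ha, rfl⟩ := hs
  rw [hS.inv_eq (h2 a ha)]
  exact h2 a ha

theorem len_inv (w : V) : len S w⁻¹ = len S w :=
  le_antisymm (hS.len_inv_le w) (by simpa using hS.len_inv_le w⁻¹)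

theorem len_le_add_left (u v : V) : len S v ≤ len S u + len S (u * v) := by
  simpa [hS.len_inv] using hS.len_mul_le u⁻¹ (u * v)

theorem len_simple_le {s : V} (hs : s ∈ S) : len S s ≤ 1 := by
  simpa using len_prod_le (S := S) (l := [s]) (by simpa)

/-- Along the prefixes of the word, `D s` is false at the start and true at the end. Where it
switches, folding gives s w = w t, and this deletes the letter t. -/
theorem exchange_of_descent {D : V → V → Prop} (h1 : ∀ s ∈ S, ¬ D s 1)
    (h3 : ∀ s ∈ S, ∀ t ∈ S, ∀ w, ¬ D s w → D s (w * t) → s * w = w * t) {s : V} (hs : s ∈ S)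
    (l : List V) (hl : ∀ r ∈ l, r ∈ S) (hD : D s l.prod) :
    ∃ i < l.length, s * l.prod = (l.eraseIdx i).prod := by
  induction l using List.reverseRecOn with
  | nil => exact absurd hD (h1 s hs)
  | append_singleton l t ih =>
    have ht : t ∈ S := hl t (by simp)
    by_cases h : D s l.prod
    · obtain ⟨i, hi, h'⟩ := ih (fun r hr => hl r (by simp [hr])) h
      refine ⟨i, by simp; omega, ?_⟩
      rw [List.eraseIdx_append_of_lt_length hi, List.prod_append, List.prod_append, ← mul_assoc, h']
    · refine ⟨l.length, by simp, ?_⟩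
      have := h3 s hs t ht l.prod h (by simpa using hD)
      rw [List.eraseIdx_append_of_length_le le_rfl]
      simp only [List.prod_append, List.prod_singleton, Nat.sub_self, List.eraseIdx_zero,
        List.tail_cons, List.prod_nil, mul_one]
      rw [← mul_assoc, this, hS.mul_cancel_right ht]

theorem len_lt_of_descent {D : V → V → Prop} (h1 : ∀ s ∈ S, ¬ D s 1)
    (h3 : ∀ s ∈ S, ∀ t ∈ S, ∀ w, ¬ D s w → D s (w * t) → s * w = w * t) {s : V} (hs : s ∈ S)
    (w : V) (hD : D s w) : len S (s * w) < len S w := by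
  obtain ⟨l, h, hl, rfl⟩ := hS.exists_reduced w
  obtain ⟨i, hi, e⟩ := hS.exchange_of_descent h1 h3 hs l hl hD
  rw [e, ← h]
  refine (len_prod_le fun r hr => hl r (List.mem_of_mem_eraseIdx hr)).trans_lt ?_
  rw [List.length_eraseIdx_of_lt hi]
  omega

/-- A descent shortens, and exactly one of w and sw has the descent s; hence the converse. -/
theorem descent_iff_len_lt {D : V → V → Prop} (h1 : ∀ s ∈ S, ¬ D s 1)
    (h2 : ∀ s ∈ S, ∀ w, D s (s * w) ↔ ¬ D s w)
    (h3 : ∀ s ∈ S, ∀ t ∈ S, ∀ w, ¬ D s w → D s (w * t) → s * w = w * t) {s : V} (hs : s ∈ S)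
    (w : V) : D s w ↔ len S (s * w) < len S w := by
  refine ⟨hS.len_lt_of_descent h1 h3 hs w, fun h => ?_⟩
  by_contra hD
  have := hS.len_lt_of_descent h1 h3 hs (s * w) ((h2 s hs w).2 hD)
  rw [hS.mul_cancel hs] at this
  omega

theorem len_mul_ne {s : V} (hs : s ∈ S) (w : V) : len S (s * w) ≠ len S w := by
  obtain ⟨D, h1, h2, h3⟩ := hS.exch
  have a := hS.descent_iff_len_lt h1 h2 h3 hs w
  have b := hS.descent_iff_len_lt h1 h2 h3 hs (s * w)
  rw [h2 s hs, hS.mul_cancel hs] at b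
  by_cases h : D s w
  · exact (a.1 h).ne
  · exact (b.1 h).ne'

theorem len_mul_cases {s : V} (hs : s ∈ S) (w : V) :
    len S (s * w) = len S w + 1 ∨ len S w = len S (s * w) + 1 := by
  have := hS.len_mul_ne hs w
  have := hS.len_mul_le s w
  have := hS.len_le_add_left s w
  have := hS.len_simple_le hs
  omega

theorem len_mul_right_cases {s : V} (hs : s ∈ S) (w : V) :
    len S (w * s) = len S w + 1 ∨ len S w = len S (w * s) + 1 := by
  have := hS.len_mul_cases hs w⁻¹
  rwa [← hS.len_inv w, ← hS.len_inv (w * s), mul_inv_rev, hS.inv_eq hs]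

theorem len_simple {s : V} (hs : s ∈ S) : len S s = 1 := by
  have := hS.len_mul_cases hs 1
  rw [mul_one, hS.len_one] at this
  omega

theorem exchange {s : V} (hs : s ∈ S) (l : List V) (hl : ∀ r ∈ l, r ∈ S)
    (h : len S (s * l.prod) < len S l.prod) :
    ∃ i < l.length, s * l.prod = (l.eraseIdx i).prod := by
  obtain ⟨D, h1, h2, h3⟩ := hS.exch
  exact hS.exchange_of_descent h1 h3 hs l hl ((hS.descent_iff_len_lt h1 h2 h3 hs _).2 h)

theorem fold {s t : V} (hs : s ∈ S) (ht : t ∈ S) {w : V} (h1 : len S w < len S (s * w))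
    (h2 : len S (s * (w * t)) < len S (w * t)) : s * w = w * t := by
  obtain ⟨D, d1, d2, d3⟩ := hS.exch
  refine d3 s hs t ht w ?_ ((hS.descent_iff_len_lt d1 d2 d3 hs _).2 h2)
  rw [hS.descent_iff_len_lt d1 d2 d3 hs]
  omega

/-- Induction on length, multiplying on the left. -/
theorem induction_left {P : V → Prop} (w : V) (one : P 1)
    (mul : ∀ s ∈ S, ∀ w, len S (s * w) = len S w + 1 → P w → P (s * w)) : P w := by
  obtain ⟨l, h, hl, rfl⟩ := hS.exists_reduced w
  induction l with
  | nil => simpa using one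
  | cons s l ih =>
    have hs : s ∈ S := hl s (by simp)
    have hl' : ∀ r ∈ l, r ∈ S := fun r hr => hl r (by simp [hr])
    have a := len_prod_le hl'
    rw [List.prod_cons] at h ⊢
    rw [List.length_cons] at h
    have b := hS.len_mul_le s l.prod
    have c := hS.len_simple hs
    exact mul s hs _ (by omega) (ih hl' (by omega))

/-- Induction on length, multiplying on the right. -/
theorem induction_right {P : V → Prop} (w : V) (one : P 1)
    (mul : ∀ s ∈ S, ∀ w, len S (w * s) = len S w + 1 → P w → P (w * s)) : P w := by
  have : P (w⁻¹)⁻¹ := by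
    refine hS.induction_left (P := fun v => P v⁻¹) w⁻¹ (by simpa) fun s hs v hv h => ?_
    rw [mul_inv_rev, hS.inv_eq hs]
    refine mul s hs _ ?_ h
    rw [← hS.len_inv, mul_inv_rev, hS.inv_eq hs, inv_inv, hv, hS.len_inv]
  simpa using this

theorem exists_descent {w : V} (hw : w ≠ 1) : ∃ s ∈ S, len S (s * w) < len S w := by
  induction w using hS.induction_left with
  | one => exact absurd rfl hw
  | mul s hs w h _ => exact ⟨s, hs, by rw [hS.mul_cancel hs]; omega⟩

end ExchangeSystem

end Exchange

/-! ### Coxeter systems are exchange systems -/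

section Coxeter

variable {B W : Type*} [Group W] {M : CoxeterMatrix B} (cs : CoxeterSystem M W)

open Classical in
/-- The involution `(t, ε) ↦ (sts, ε + [t = s])`. -/
def flipPerm (s : W) (hs : s * s = 1) : Equiv.Perm (W × ZMod 2) :=
  Function.Involutive.toPerm (fun x => (s * x.1 * s, x.2 + if x.1 = s then 1 else 0)) <| by
    rintro ⟨t, ε⟩
    have h : s * t * s = s ↔ t = s := by
      constructor
      · intro h
        have : s * (s * t * s) * s = s * s * s := by rw [h]
        rw [← mul_assoc, ← mul_assoc, hs, one_mul, mul_assoc, hs, mul_one, one_mul] at this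
        exact this
      · rintro rfl
        rw [hs, one_mul]
    ext
    · simp only
      rw [← mul_assoc, ← mul_assoc, hs, one_mul, mul_assoc, hs, mul_one]
    · simp only [h, add_assoc]
      split_ifs
      · rw [CharTwo.add_self_eq_zero, add_zero]
      · simp

open Classical in
theorem flipPerm_apply (s : W) (hs : s * s = 1) (t : W) (ε : ZMod 2) :
    flipPerm s hs (t, ε) = (s * t * s, ε + if t = s then 1 else 0) := rfl

open Classical in
-- Pulled back to the initial t, the 2n successive toggles occur at the reflections (ab)^{-k} b of
-- the dihedral group ⟨a, b⟩, for k < 2n.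
theorem flipPerm_mul_pow (a b : W) (ha : a * a = 1) (hb : b * b = 1) (n : ℕ) (t : W)
    (ε : ZMod 2) :
    ((flipPerm a ha * flipPerm b hb) ^ n) (t, ε) =
      ((a * b) ^ n * t * ((a * b) ^ n)⁻¹,
        ε + ∑ k ∈ Finset.range (2 * n), if t = ((a * b) ^ k)⁻¹ * b then 1 else 0) := by
  have ha' : a⁻¹ = a := inv_eq_of_mul_eq_one_left ha
  have hb' : b⁻¹ = b := inv_eq_of_mul_eq_one_left hb
  have hr : b * (a * b) * b⁻¹ = (a * b)⁻¹ := by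
    rw [mul_inv_rev, ha', hb', mul_assoc, mul_assoc, hb, mul_one]
  have hrn : ∀ n : ℕ, b * (a * b) ^ n = ((a * b) ^ n)⁻¹ * b := by
    intro n
    rw [← inv_pow, ← hr, conj_pow, mul_assoc, inv_mul_cancel, mul_one]
  induction n with
  | zero => simp
  | succ n ih =>
    rw [pow_succ', Equiv.Perm.mul_apply, ih, Equiv.Perm.mul_apply, flipPerm_apply, flipPerm_apply,
      Nat.mul_succ, Finset.sum_range_succ, Finset.sum_range_succ]
    have e1 : (a * b) ^ n * t * ((a * b) ^ n)⁻¹ = b ↔ t = ((a * b) ^ (2 * n))⁻¹ * b := by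
      rw [mul_inv_eq_iff_eq_mul, hrn, ← eq_inv_mul_iff_mul_eq, ← mul_assoc, two_mul, pow_add,
        mul_inv_rev]
    have e2 : b * ((a * b) ^ n * t * ((a * b) ^ n)⁻¹) * b = a ↔
        t = ((a * b) ^ (2 * n + 1))⁻¹ * b := by
      have e3 : ∀ y : W, b * y * b = a ↔ y = (a * b)⁻¹ * b := by
        intro y
        rw [mul_inv_rev, ha', hb', mul_assoc, ← eq_inv_mul_iff_mul_eq, ← eq_mul_inv_iff_mul_eq, hb']
      rw [e3, mul_inv_eq_iff_eq_mul, mul_assoc _ b, hrn, ← eq_inv_mul_iff_mul_eq,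
        show 2 * n + 1 = n + 1 + n by omega, pow_add, pow_succ]
      simp only [mul_inv_rev, mul_assoc]
    rw [if_congr e1 rfl rfl, if_congr e2 rfl rfl]
    ext
    · simp only [pow_succ', mul_inv_rev, ha', hb', mul_assoc]
    · simp only [add_assoc]

open Classical in
-- As (ab)^m = 1 for m = `M i j`, the list of 2m reflections runs twice through the same m elements,
-- and the toggles cancel in ℤ/2.
theorem isLiftable_flipPerm :
    CoxeterMatrix.IsLiftable M fun i => flipPerm (cs.simple i) (cs.simple_mul_simple_self i) := by
  intro i j
  ext ⟨t, ε⟩ : 1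
  rw [flipPerm_mul_pow, cs.simple_mul_simple_pow, two_mul, Finset.sum_range_add]
  have h : ∀ k, (cs.simple i * cs.simple j) ^ (M i j + k) = (cs.simple i * cs.simple j) ^ k :=
    fun k => by rw [pow_add, cs.simple_mul_simple_pow, one_mul]
  have h' : (∑ k ∈ Finset.range (M i j),
      if t = ((cs.simple i * cs.simple j) ^ (M i j + k))⁻¹ * cs.simple j then (1 : ZMod 2) else 0) =
      ∑ k ∈ Finset.range (M i j),
        if t = ((cs.simple i * cs.simple j) ^ k)⁻¹ * cs.simple j then 1 else 0 :=
    Finset.sum_congr rfl fun k _ => by rw [h k]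
  rw [h', CharTwo.add_self_eq_zero]
  simp

/-- The action of `W` on `W × ℤ/2` recording inversions. -/
def flipHom : W →* Equiv.Perm (W × ZMod 2) := cs.lift ⟨_, isLiftable_flipPerm cs⟩

theorem flipHom_simple (i : B) :
    flipHom cs (cs.simple i) = flipPerm (cs.simple i) (cs.simple_mul_simple_self i) :=
  cs.lift_apply_simple (isLiftable_flipPerm cs) i

theorem flipHom_apply (w t : W) (ε : ZMod 2) :
    flipHom cs w (t, ε) = (w * t * w⁻¹, ε + (flipHom cs w (t, 0)).2) := by
  induction w using cs.simple_induction_left generalizing ε with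
  | one => simp
  | mul_simple_left w i ih =>
    rw [map_mul, Equiv.Perm.mul_apply, Equiv.Perm.mul_apply, ih ε, flipHom_simple, flipPerm_apply]
    have ih' : flipHom cs w (t, 0) = (w * t * w⁻¹, (flipHom cs w (t, 0)).2) := by
      simpa using ih 0
    rw [ih', flipPerm_apply]
    ext
    · simp [mul_assoc]
    · simp [add_assoc]

theorem exchangeSystem_range_simple : ExchangeSystem (Set.range cs.simple) where
  sq := by
    rintro _ ⟨i, rfl⟩
    exact cs.simple_mul_simple_self i
  gen w := by
    obtain ⟨l, rfl⟩ := cs.wordProd_surjective w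
    exact ⟨l.map cs.simple, by simp, rfl⟩
  exch := by
    -- For w = s₁⋯sₙ this is the parity of the number of k with s = s₁⋯s_{k-1} s_k s_{k-1}⋯s₁.
    refine ⟨fun s w => (flipHom cs w⁻¹ (s, 0)).2 = 1, ?_, ?_, ?_⟩
    · rintro _ ⟨i, rfl⟩
      simp
    · rintro _ ⟨i, rfl⟩ w
      beta_reduce
      rw [mul_inv_rev, cs.inv_simple, map_mul, Equiv.Perm.mul_apply, flipHom_simple, flipPerm_apply,
        flipHom_apply]
      simp only [cs.simple_mul_simple_self, one_mul, if_true, zero_add]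
      generalize (flipHom cs w⁻¹ (cs.simple i, 0)).2 = a
      revert a
      decide
    · rintro _ ⟨i, rfl⟩ _ ⟨j, rfl⟩ w h1 h2
      rw [mul_inv_rev, cs.inv_simple, map_mul, Equiv.Perm.mul_apply, flipHom_simple, flipHom_apply,
        flipPerm_apply] at h2
      simp only [inv_inv, zero_add] at h2
      -- Appending a letter s_j to w can change this parity only if w⁻¹ s w = s_j, which is the
      -- folding relation.
      split_ifs at h2 with h
      · rw [← h, inv_inv, ← mul_assoc, ← mul_assoc, mul_inv_cancel, one_mul]
      · exact absurd (by simpa using h2) h1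

end Coxeter

/-! ### Parabolic subgroups -/

section Parabolic

variable {V : Type*} [Group V] {S : Set V}

namespace ExchangeSystem

variable (hS : ExchangeSystem S) {I : Set V} (hI : I ⊆ S)
include hS hI

theorem exists_list_of_mem_closure {y : V} (hy : y ∈ Subgroup.closure I) :
    ∃ l : List V, (∀ r ∈ l, r ∈ I) ∧ l.prod = y := by
  induction hy using Subgroup.closure_induction with
  | mem r hr => exact ⟨[r], by simpa using hr, by simp⟩
  | one => exact ⟨[], by simp, by simp⟩
  | mul x y _ _ hx hy =>
    obtain ⟨l, h1, rfl⟩ := hx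
    obtain ⟨l', h1', rfl⟩ := hy
    refine ⟨l ++ l', fun r hr => ?_, List.prod_append⟩
    exact (List.mem_append.1 hr).elim (h1 r) (h1' r)
  | inv x _ hx =>
    obtain ⟨l, h1, rfl⟩ := hx
    refine ⟨(l.map (·⁻¹)).reverse, fun r hr => ?_, (List.prod_inv_reverse l).symm⟩
    simp only [List.mem_reverse, List.mem_map] at hr
    obtain ⟨a, ha, rfl⟩ := hr
    rw [hS.inv_eq (hI (h1 a ha))]
    exact h1 a ha

/-- If a new letter r shortened the product, the exchange condition would delete a letter of l,
against the minimality of the word over I, or a letter of x, against the minimality of x in its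
coset. The case x = 1 shows that words minimal over I are reduced over S. -/
theorem len_list_mul_of_minimal {x : V} (hx : ∀ y ∈ Subgroup.closure I, len S x ≤ len S (y * x))
    (l : List V) (hl : ∀ r ∈ l, r ∈ I)
    (hmin : ∀ l' : List V, (∀ r ∈ l', r ∈ I) → l'.prod = l.prod → l.length ≤ l'.length) :
    len S (l.prod * x) = l.length + len S x := by
  induction l with
  | nil => simp
  | cons r l ih =>
    have hr : r ∈ I := hl r (by simp)
    have hl' : ∀ r ∈ l, r ∈ I := fun r hr => hl r (by simp [hr])
    have hlI : l.prod ∈ Subgroup.closure I :=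
      Subgroup.list_prod_mem _ fun r hr => Subgroup.subset_closure (hl' r hr)
    have ih' := ih hl' fun l' h1 h2 => by
      have := hmin (r :: l') (by simpa using ⟨hr, h1⟩) (by simp [h2])
      simpa using this
    rw [List.prod_cons, mul_assoc, List.length_cons]
    rcases hS.len_mul_cases (hI hr) (l.prod * x) with h | h
    · omega
    · exfalso
      obtain ⟨lx, k1, k2, k3⟩ := hS.exists_reduced x
      have e : l.prod * x = (l ++ lx).prod := by rw [List.prod_append, k3]
      have hlx : ∀ s ∈ l ++ lx, s ∈ S := by
        intro s hs
        rcases List.mem_append.1 hs with h | h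
        · exact hI (hl' s h)
        · exact k2 s h
      obtain ⟨i, hi, he⟩ := hS.exchange (hI hr) (l ++ lx) hlx (by rw [← e]; omega)
      rw [← e] at he
      rcases lt_or_ge i l.length with hil | hil
      · rw [List.eraseIdx_append_of_lt_length hil, List.prod_append, k3, ← mul_assoc] at he
        have := hmin (l.eraseIdx i) (fun s hs => hl' s (List.mem_of_mem_eraseIdx hs))
          (by rw [List.prod_cons, mul_right_cancel he])
        rw [List.length_eraseIdx_of_lt hil, List.length_cons] at this
        omega
      · rw [List.eraseIdx_append_of_length_le hil, List.prod_append] at he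
        have h1 := hx (l.prod⁻¹ * r * l.prod)
          (mul_mem (mul_mem (inv_mem hlI) (Subgroup.subset_closure hr)) hlI)
        rw [mul_assoc, mul_assoc, he, inv_mul_cancel_left] at h1
        have h2 := len_prod_le (S := S) (l := lx.eraseIdx (i - l.length))
          fun s hs => k2 s (List.mem_of_mem_eraseIdx hs)
        rw [List.length_append] at hi
        rw [List.length_eraseIdx_of_lt (by omega)] at h2
        omega

theorem exists_minimal_list {y : V} (hy : y ∈ Subgroup.closure I) :
    ∃ l : List V, (∀ r ∈ l, r ∈ I) ∧ l.prod = y ∧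
      ∀ l' : List V, (∀ r ∈ l', r ∈ I) → l'.prod = l.prod → l.length ≤ l'.length := by
  have hne : {l : List V | (∀ r ∈ l, r ∈ I) ∧ l.prod = y}.Nonempty :=
    hS.exists_list_of_mem_closure hI hy
  obtain ⟨l, hl, hmin⟩ := exists_minimalFor_of_wellFoundedLT _ List.length hne
  refine ⟨l, hl.1, hl.2, fun l' h1 h2 => ?_⟩
  by_contra hlt
  exact hlt (hmin ⟨h1, h2.trans hl.2⟩ (by omega))

theorem exists_reduced_of_mem_closure {y : V} (hy : y ∈ Subgroup.closure I) :
    ∃ l : List V, l.length = len S y ∧ (∀ r ∈ l, r ∈ I) ∧ l.prod = y := by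
  obtain ⟨l, h1, rfl, h3⟩ := hS.exists_minimal_list hI hy
  refine ⟨l, ?_, h1, rfl⟩
  have := hS.len_list_mul_of_minimal hI (x := 1) (by simp [hS.len_one]) l h1 h3
  rw [mul_one, hS.len_one] at this
  omega

theorem len_mul_of_minimal {x : V} (hx : ∀ y ∈ Subgroup.closure I, len S x ≤ len S (y * x))
    {y : V} (hy : y ∈ Subgroup.closure I) : len S (y * x) = len S y + len S x := by
  obtain ⟨l, h1, rfl, h3⟩ := hS.exists_minimal_list hI hy
  rw [hS.len_list_mul_of_minimal hI hx l h1 h3]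
  have := hS.len_list_mul_of_minimal hI (x := 1) (by simp [hS.len_one]) l h1 h3
  rw [mul_one, hS.len_one] at this
  omega

/-- Write x = a⁻¹m with m minimal in the coset. If a ≠ 1, the first letter of a reduced word of a⁻¹
over I is a descent of x. -/
theorem len_mul_of_forall_not_descent {x : V} (hx : ∀ r ∈ I, len S x < len S (r * x))
    {y : V} (hy : y ∈ Subgroup.closure I) : len S (y * x) = len S y + len S x := by
  refine hS.len_mul_of_minimal hI ?_ hy
  have hne : {m : V | ∃ a ∈ Subgroup.closure I, m = a * x}.Nonempty := ⟨x, 1, one_mem _, by simp⟩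
  obtain ⟨m, ⟨a, ha, rfl⟩, hmin⟩ := exists_minimalFor_of_wellFoundedLT _ (len S) hne
  have hm : ∀ y ∈ Subgroup.closure I, len S (a * x) ≤ len S (y * (a * x)) := by
    intro y hy
    by_contra hlt
    exact hlt (hmin (j := y * (a * x)) ⟨y * a, mul_mem hy ha, by rw [mul_assoc]⟩ (by omega))
  by_cases ha1 : a = 1
  · subst ha1
    simpa using hm
  · exfalso
    obtain ⟨l, h1, h2, h3⟩ := hS.exists_reduced_of_mem_closure hI (inv_mem ha)
    cases l with
    | nil => exact ha1 (by simpa using h3.symm)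
    | cons r l =>
      have hr : r ∈ I := h2 r (by simp)
      have hl : ∀ r ∈ l, r ∈ I := fun r hr => h2 r (by simp [hr])
      have hx1 := hS.len_mul_of_minimal hI hm (inv_mem ha)
      have hlm : l.prod ∈ Subgroup.closure I :=
        Subgroup.list_prod_mem _ fun r hr => Subgroup.subset_closure (hl r hr)
      have hx2 := hS.len_mul_of_minimal hI hm hlm
      rw [inv_mul_cancel_left] at hx1
      have e : l.prod * (a * x) = r * x := by
        rw [List.prod_cons] at h3
        rw [← mul_assoc, ← hS.mul_cancel (hI hr) l.prod, h3, inv_mul_cancel_right]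
      rw [e] at hx2
      have := hx r hr
      have h4 := len_prod_le (S := S) (l := l) fun s hs => hI (hl s hs)
      rw [List.length_cons] at h1
      omega

/-- Every element of W_I is a prefix of x, by induction along a reduced word rl. Exchanging r in a
reduced word of x that starts with l cannot delete a letter of l, since rl is reduced; so it deletes
a later letter. -/
theorem len_inv_mul_of_forall_descent {x : V} (hx : ∀ r ∈ I, len S (r * x) < len S x)
    {z : V} (hz : z ∈ Subgroup.closure I) : len S (z⁻¹ * x) + len S z = len S x := by
  obtain ⟨l, h1, h2, rfl⟩ := hS.exists_reduced_of_mem_closure hI hz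
  clear hz
  induction l with
  | nil => simp [hS.len_one]
  | cons r l ih =>
    have hr : r ∈ I := h2 r (by simp)
    have hl : ∀ r ∈ l, r ∈ I := fun r hr => h2 r (by simp [hr])
    have a1 := len_prod_le (S := S) (l := l) fun s hs => hI (hl s hs)
    rw [List.prod_cons, List.length_cons] at h1
    have a2 := hS.len_mul_cases (hI hr) l.prod
    have ih' := ih hl (by omega)
    obtain ⟨lx, k1, k2, k3⟩ := hS.exists_reduced (l.prod⁻¹ * x)
    have e : x = (l ++ lx).prod := by rw [List.prod_append, k3, mul_inv_cancel_left]
    have hlx : ∀ s ∈ l ++ lx, s ∈ S := by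
      intro s hs
      rcases List.mem_append.1 hs with h | h
      · exact hI (hl s h)
      · exact k2 s h
    obtain ⟨i, hi, he⟩ := hS.exchange (hI hr) (l ++ lx) hlx (by rw [← e]; exact hx r hr)
    rw [List.prod_cons]
    rcases lt_or_ge i l.length with hil | hil
    · exfalso
      rw [List.eraseIdx_append_of_lt_length hil, List.prod_append, List.prod_append,
        ← mul_assoc] at he
      have := len_prod_le (S := S) (l := l.eraseIdx i)
        fun s hs => hI (hl s (List.mem_of_mem_eraseIdx hs))
      rw [List.length_eraseIdx_of_lt hil, ← mul_right_cancel he] at this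
      omega
    · rw [← e, List.eraseIdx_append_of_length_le hil, List.prod_append] at he
      have e2 : (r * l.prod)⁻¹ * x = (lx.eraseIdx (i - l.length)).prod := by
        rw [mul_inv_rev, hS.inv_eq (hI hr), mul_assoc, he, inv_mul_cancel_left]
      have h4 := len_prod_le (S := S) (l := lx.eraseIdx (i - l.length))
          fun s hs => k2 s (List.mem_of_mem_eraseIdx hs)
      rw [List.length_append] at hi
      rw [List.length_eraseIdx_of_lt (by omega), ← e2] at h4
      have h5 := hS.len_le_add_left (r * l.prod)⁻¹ x
      rw [hS.len_inv] at h5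
      omega

/-- All elements of W_I are prefixes of x, so their lengths are bounded. This provides the
finiteness of W_ω required in the definition of S_G. -/
theorem finite_closure_of_forall_descent (hfin : S.Finite) {x : V}
    (hx : ∀ r ∈ I, len S (r * x) < len S x) : (Subgroup.closure I : Set V).Finite := by
  have := hfin.to_subtype
  have hf : {l : List S | l.length ≤ len S x}.Finite := List.finite_length_le S (len S x)
  refine (hf.image fun l => (l.map Subtype.val).prod).subset fun z hz => ?_
  have h := hS.len_inv_mul_of_forall_descent hI hx hz
  obtain ⟨l, h1, h2, h3⟩ := hS.exists_reduced z
  refine ⟨l.attach.map fun s => ⟨s.1, h2 _ s.2⟩, ?_, ?_⟩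
  · simp only [Set.mem_ofPred_eq, List.length_map, List.length_attach]
    omega
  · rw [← h3]
    simp [List.map_map, Function.comp_def]

/-- Append the letters of t to w one by one. Where r becomes a descent, folding reads r(wv) = (wv)r'
with v in W_I and r' in I, so w⁻¹rw = vr'v⁻¹. -/
theorem mul_inv_mem_closure_of_descent {w r : V} (hr : r ∈ S) (h1 : len S w < len S (r * w))
    {t : V} (ht : t ∈ Subgroup.closure I) (h2 : len S (r * (w * t)) < len S (w * t)) :
    w⁻¹ * r * w ∈ Subgroup.closure I := by
  obtain ⟨l, hl, rfl⟩ := hS.exists_list_of_mem_closure hI ht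
  clear ht
  induction l using List.reverseRecOn with
  | nil => simp only [List.prod_nil, mul_one] at h2; omega
  | append_singleton l r' ih =>
    have hr' : r' ∈ I := hl r' (by simp)
    have hl' : ∀ r ∈ l, r ∈ I := fun r hr => hl r (by simp [hr])
    by_cases h : len S (r * (w * l.prod)) < len S (w * l.prod)
    · exact ih hl' h
    · have h' := hS.len_mul_ne hr (w * l.prod)
      rw [List.prod_append, List.prod_singleton, ← mul_assoc w] at h2
      have h3 := hS.fold hr (hI hr') (w := w * l.prod) (by omega) h2
      have hlm : l.prod ∈ Subgroup.closure I :=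
        Subgroup.list_prod_mem _ fun r hr => Subgroup.subset_closure (hl' r hr)
      have e : w⁻¹ * r * w = l.prod * r' * l.prod⁻¹ := by
        rw [eq_mul_inv_iff_mul_eq, mul_assoc, mul_assoc, h3, mul_assoc w, inv_mul_cancel_left]
      rw [e]
      exact mul_mem (mul_mem hlm (Subgroup.subset_closure hr')) (inv_mem hlm)

end ExchangeSystem

/-- `s` is an element of maximal length in the subgroup generated by `I`. -/
structure IsLongest (S I : Set V) (s : V) : Prop where
  mem : s ∈ Subgroup.closure I
  le : ∀ w ∈ Subgroup.closure I, len S w ≤ len S s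

namespace IsLongest

variable (hS : ExchangeSystem S) {I : Set V} (hI : I ⊆ S) {s : V} (hs : IsLongest S I s)
include hS hI hs

theorem descent {r : V} (hr : r ∈ I) : len S (r * s) < len S s :=
  lt_of_le_of_ne (hs.le _ (mul_mem (Subgroup.subset_closure hr) hs.mem)) (hS.len_mul_ne (hI hr) s)

theorem eq {s' : V} (hs' : IsLongest S I s') : s' = s := by
  have := hS.len_inv_mul_of_forall_descent hI (fun r hr => hs.descent hS hI hr) hs'.mem
  have h1 := hs'.le s hs.mem
  exact inv_mul_eq_one.1 (hS.len_eq_zero.1 (by omega))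

theorem inv_eq : s⁻¹ = s :=
  hs.eq hS hI ⟨inv_mem hs.mem, by rw [hS.len_inv]; exact hs.le⟩

theorem mul_self : s * s = 1 := by
  conv_lhs => rw [← hs.inv_eq hS hI]
  rw [hs.inv_eq hS hI]
  exact mul_eq_one_iff_inv_eq.2 (hs.inv_eq hS hI)

theorem len_mul_of_forall_descent {x : V} (hx : ∀ r ∈ I, len S (r * x) < len S x) :
    len S (s * x) + len S s = len S x := by
  have := hS.len_inv_mul_of_forall_descent hI hx hs.mem
  rwa [hs.inv_eq hS hI] at this

end IsLongest

theorem exists_isLongest {I : Set V} (h : (Subgroup.closure I : Set V).Finite) :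
    ∃ s, IsLongest S I s := by
  obtain ⟨s, hs, h⟩ := Set.exists_max_image _ (len S) h ⟨1, one_mem (Subgroup.closure I)⟩
  exact ⟨s, hs, h⟩

end Parabolic

/-! ### The fixed point system -/

section Fixed

variable {G : Type*} [Group G] {W : Type*} [Group W] [MulDistribMulAction G W] {S : Set W}

theorem len_smul (hGS : ∀ (g : G), ∀ s ∈ S, g • s ∈ S) (g : G) (w : W) :
    len S (g • w) = len S w :=
  (preserves_of_action (φ := fun _ => (0 : ℤ)) hGS (fun _ _ => rfl) g).len_eq w

theorem smul_mem_closure_orbit {s w : W} (g : G)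
    (hw : w ∈ Subgroup.closure (MulAction.orbit G s)) :
    g • w ∈ Subgroup.closure (MulAction.orbit G s) := by
  induction hw using Subgroup.closure_induction with
  | mem x hx =>
    obtain ⟨g', rfl⟩ := hx
    exact Subgroup.subset_closure ⟨g * g', mul_smul g g' s⟩
  | one => rw [smul_one]; exact one_mem _
  | mul x y _ _ hx hy => rw [smul_mul']; exact mul_mem hx hy
  | inv x _ hx => rw [smul_inv']; exact inv_mem hx

theorem mem_fixedSimple {w : FixedPoints.subgroup G W} :
    w ∈ fixedSimple G S ↔ ∃ s ∈ S, (Subgroup.closure (MulAction.orbit G s) : Set W).Finite ∧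
      IsLongest S (MulAction.orbit G s) (w : W) :=
  ⟨fun ⟨s, h1, h2, h3, h4⟩ => ⟨s, h1, h2, h3, h4⟩, fun ⟨s, h1, h2, h3⟩ => ⟨s, h1, h2, h3.1, h3.2⟩⟩

variable (hS : ExchangeSystem S) (hGS : ∀ (g : G), ∀ s ∈ S, g • s ∈ S)
include hS hGS

omit hS in
theorem orbit_subset {s : W} (hs : s ∈ S) : MulAction.orbit G s ⊆ S := by
  rintro _ ⟨g, rfl⟩
  exact hGS g s hs

omit hS in
theorem smul_descent_iff {w : W} (hw : ∀ g : G, g • w = w) (g : G) (r : W) :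
    len S (g • r * w) < len S w ↔ len S (r * w) < len S w := by
  rw [← len_smul hGS g (r * w), smul_mul', hw]

omit hS in
theorem forall_orbit_descent {w : W} (hw : ∀ g : G, g • w = w) {r s : W}
    (hr : r ∈ MulAction.orbit G s) (h : len S (r * w) < len S w) :
    ∀ r' ∈ MulAction.orbit G s, len S (r' * w) < len S w := by
  rw [← MulAction.orbit_eq_iff.2 hr]
  rintro _ ⟨g, rfl⟩
  exact (smul_descent_iff hGS hw g r).2 h

/-- The descents of a fixed x form a G-stable set, so the orbit contains only descents or none. In
the first case each element of W_ω is a prefix of x; in the second ℓ(x⁻¹x) = 2ℓ(x), so x = 1. Hence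
W_ω has no fixed points besides 1 and s_ω. -/
theorem isLongest_of_fixed {s : W} (hs : s ∈ S) {x : W} (hx : ∀ g : G, g • x = x)
    (hx1 : x ≠ 1) (hxm : x ∈ Subgroup.closure (MulAction.orbit G s)) :
    IsLongest S (MulAction.orbit G s) x := by
  have hI := orbit_subset hGS hs
  refine ⟨hxm, fun w hw => ?_⟩
  by_cases h : ∃ r ∈ MulAction.orbit G s, len S (r * x) < len S x
  · obtain ⟨r, hr, h⟩ := h
    have := hS.len_inv_mul_of_forall_descent hI (forall_orbit_descent hGS hx hr h) hw
    omega
  · push Not at h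
    have := hS.len_mul_of_forall_not_descent hI (x := x)
      (fun r hr => lt_of_le_of_ne (h r hr) (hS.len_mul_ne (hI hr) x).symm) (inv_mem hxm)
    rw [inv_mul_cancel, hS.len_one] at this
    exact absurd (hS.len_eq_zero.1 (by omega)) hx1

theorem IsLongest.smul_eq {s x : W} (hs : s ∈ S) (hx : IsLongest S (MulAction.orbit G s) x)
    (g : G) : g • x = x :=
  hx.eq hS (orbit_subset hGS hs)
    ⟨smul_mem_closure_orbit g hx.mem, by rw [len_smul hGS]; exact hx.le⟩

theorem IsLongest.len_mul_cases {s x : W} (hs : s ∈ S)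
    (hx : IsLongest S (MulAction.orbit G s) x) {w : W} (hw : ∀ g : G, g • w = w) :
    (len S (x * w) = len S x + len S w ∧ len S w < len S (s * w)) ∨
      len S (x * w) + len S x = len S w := by
  have hI := orbit_subset hGS hs
  by_cases h : ∃ r ∈ MulAction.orbit G s, len S (r * w) < len S w
  · obtain ⟨r, hr, h⟩ := h
    exact Or.inr (hx.len_mul_of_forall_descent hS hI (forall_orbit_descent hGS hw hr h))
  · push Not at h
    have h' : ∀ r ∈ MulAction.orbit G s, len S w < len S (r * w) :=
      fun r hr => lt_of_le_of_ne (h r hr) (hS.len_mul_ne (hI hr) w).symm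
    exact Or.inl ⟨hS.len_mul_of_forall_not_descent hI h' hx.mem, h' s (MulAction.mem_orbit_self s)⟩

omit hGS in
theorem IsLongest.len_pos {s x : W} (hs : s ∈ S) (hx : IsLongest S (MulAction.orbit G s) x) :
    0 < len S x := by
  have := hx.le s (Subgroup.subset_closure (MulAction.mem_orbit_self s))
  rw [hS.len_simple hs] at this
  omega

/-- A descent r of w brings its whole orbit, so W_ω is finite and its longest element is a prefix of
w. By induction S_G generates W^G. -/
theorem exists_mem_fixedSimple_descent (hfin : S.Finite) {w : FixedPoints.subgroup G W}
    (hw : w ≠ 1) : ∃ x ∈ fixedSimple G S, len S ((x * w : FixedPoints.subgroup G W) : W) <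
      len S (w : W) := by
  obtain ⟨r, hr, h⟩ := hS.exists_descent (w := (w : W)) (by simpa using hw)
  have hd := forall_orbit_descent hGS w.2 (MulAction.mem_orbit_self r) h
  have hf := hS.finite_closure_of_forall_descent (orbit_subset hGS hr) hfin hd
  obtain ⟨x, hx⟩ := exists_isLongest (S := S) hf
  refine ⟨⟨x, hx.smul_eq hS hGS hr⟩, mem_fixedSimple.2 ⟨r, hr, hf, hx⟩, ?_⟩
  have h1 := hx.len_mul_of_forall_descent hS (orbit_subset hGS hr) hd
  have h2 := hx.len_pos hS hr
  change len S (x * (w : W)) < _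
  omega

/-- All r in the orbit of x are non-descents of w and descents of wy, so w⁻¹rw lies in the parabolic
subgroup of y. Then w⁻¹xw is a non-trivial fixed point of that subgroup, and y is the only one. -/
theorem fixedSimple_fold {x y w : FixedPoints.subgroup G W} (hx : x ∈ fixedSimple G S)
    (hy : y ∈ fixedSimple G S) (h1 : ¬ len S ((x * w : FixedPoints.subgroup G W) : W) < len S (w : W))
    (h2 : len S ((x * (w * y) : FixedPoints.subgroup G W) : W) <
      len S ((w * y : FixedPoints.subgroup G W) : W)) : x * w = w * y := by
  obtain ⟨s, hs, -, hx⟩ := mem_fixedSimple.1 hx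
  obtain ⟨t, ht, -, hy⟩ := mem_fixedSimple.1 hy
  have hxp := hx.len_pos hS hs
  have key : ∀ r ∈ MulAction.orbit G s, (w : W)⁻¹ * r * w ∈ Subgroup.closure (MulAction.orbit G t) := by
    intro r hr
    have hr' := orbit_subset hGS hs hr
    refine hS.mul_inv_mem_closure_of_descent (orbit_subset hGS ht) hr' ?_ hy.mem ?_
    · by_contra hlt
      have h3 : len S (r * w) < len S (w : W) := by
        have := hS.len_mul_ne hr' (w : W)
        omega
      have := hx.len_mul_of_forall_descent hS (orbit_subset hGS hs)
        (forall_orbit_descent hGS w.2 hr h3)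
      exact h1 (show len S ((x : W) * w) < len S (w : W) by omega)
    · by_contra hlt
      have hn : ∀ r' ∈ MulAction.orbit G s, len S ((w : W) * y) < len S (r' * ((w : W) * y)) := by
        intro r' hr'
        refine lt_of_le_of_ne ?_ (hS.len_mul_ne (orbit_subset hGS hs hr') _).symm
        by_contra hlt'
        exact hlt (forall_orbit_descent hGS (w * y).2 hr' (not_le.1 hlt') r hr)
      have := hS.len_mul_of_forall_not_descent (orbit_subset hGS hs) hn hx.mem
      change len S ((x : W) * (w * y)) < len S ((w : W) * y) at h2
      omega
  have hc : (w : W)⁻¹ * x * w ∈ Subgroup.closure (MulAction.orbit G t) := by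
    have hxm := hx.mem
    clear hx hxp h1 h2
    generalize (x : W) = x' at hxm ⊢
    induction hxm using Subgroup.closure_induction with
    | mem r hr => exact key r hr
    | one => simp
    | mul a b _ _ ha hb =>
      have := mul_mem ha hb
      simpa [mul_assoc] using this
    | inv a _ ha =>
      have := inv_mem ha
      simpa [mul_assoc] using this
  have hne : (w : W)⁻¹ * x * w ≠ 1 := by
    intro h
    rw [mul_assoc, inv_mul_eq_one] at h
    have hx1 : (x : W) = 1 := by simpa using h
    rw [hx1, hS.len_one] at hxp
    omega
  have := (isLongest_of_fixed hS hGS ht (w⁻¹ * x * w).2 hne hc).eq hS (orbit_subset hGS ht) hy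
  ext
  change (x : W) * w = w * y
  rw [this]
  simp [mul_assoc]

theorem exchangeSystem_fixedSimple (hfin : S.Finite) : ExchangeSystem (fixedSimple G S) where
  sq x hx := by
    obtain ⟨s, hs, -, hx⟩ := mem_fixedSimple.1 hx
    ext
    exact hx.mul_self hS (orbit_subset hGS hs)
  gen w := by
    induction h : len S (w : W) using Nat.strong_induction_on generalizing w with
    | h n ih =>
      by_cases hw : w = 1
      · exact ⟨[], by simp, by simp [hw]⟩
      · obtain ⟨x, hx, hlt⟩ := exists_mem_fixedSimple_descent hS hGS hfin hw
        obtain ⟨l, h1, h2⟩ := ih _ (h ▸ hlt) (x * w) rfl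
        refine ⟨x :: l, List.forall_mem_cons.2 ⟨hx, h1⟩, ?_⟩
        obtain ⟨s, hs, -, hx⟩ := mem_fixedSimple.1 hx
        rw [List.prod_cons, h2, ← mul_assoc]
        ext
        change (x : W) * x * w = w
        rw [hx.mul_self hS (orbit_subset hGS hs), one_mul]
  exch := by
    refine ⟨fun x w => len S ((x * w : FixedPoints.subgroup G W) : W) < len S (w : W), ?_, ?_, ?_⟩
    · intro x _ h
      rw [Subgroup.coe_one, hS.len_one] at h
      omega
    · intro x hx w
      obtain ⟨s, hs, -, hx⟩ := mem_fixedSimple.1 hx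
      have e : (x * (x * w) : FixedPoints.subgroup G W) = w := by
        ext
        change (x : W) * (x * w) = w
        rw [← mul_assoc, hx.mul_self hS (orbit_subset hGS hs), one_mul]
      beta_reduce
      rw [e]
      change len S (w : W) < len S ((x : W) * w) ↔ ¬ len S ((x : W) * w) < _
      have := hx.len_pos hS hs
      rcases hx.len_mul_cases hS hGS hs w.2 with h | h <;> omega
    · intro x hx y hy w h1 h2
      exact fixedSimple_fold hS hGS hx hy h1 h2

theorem len_mul_fixed_of_len_lt (hfin : S.Finite) {x w : FixedPoints.subgroup G W}
    (hx : x ∈ fixedSimple G S) (h : len (fixedSimple G S) w < len (fixedSimple G S) (x * w)) :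
    len S ((x : W) * w) = len S (x : W) + len S (w : W) := by
  have hE := exchangeSystem_fixedSimple hS hGS hfin
  by_contra hne
  obtain ⟨s, hs, -, hx'⟩ := mem_fixedSimple.1 hx
  have hp := hx'.len_pos hS hs
  rcases hx'.len_mul_cases hS hGS hs w.2 with h1 | h1
  · exact hne h1.1
  · have e : x * (x * w) = w := hE.mul_cancel hx w
    refine absurd (hE.len_lt_of_descent
      (D := fun x w => len S ((x * w : FixedPoints.subgroup G W) : W) < len S (w : W))
      ?_ ?_ hx w ?_) (by omega)
    · intro x _ h
      rw [Subgroup.coe_one, hS.len_one] at h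
      omega
    · intro x hx y hy w h1 h2
      exact fixedSimple_fold hS hGS hx hy h1 h2
    · change len S ((x : W) * w) < _
      omega

/-- This makes φ_G a weight function, and it makes T_u T_v = T_{uv} hold in H as soon as it holds in
H_G for reasons of length. -/
theorem len_mul_fixed (hfin : S.Finite) {u v : FixedPoints.subgroup G W}
    (h : len (fixedSimple G S) (u * v) = len (fixedSimple G S) u + len (fixedSimple G S) v) :
    len S ((u : W) * v) = len S (u : W) + len S (v : W) := by
  have hE := exchangeSystem_fixedSimple hS hGS hfin
  induction u using hE.induction_left with
  | one => simp [hS.len_one]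
  | mul x hx u hu ih =>
    have h1 := hE.len_mul_le u v
    have h2 := hE.len_mul_cases hx (u * v)
    rw [mul_assoc] at h
    have h3 := ih (by omega)
    have h4 := len_mul_fixed_of_len_lt hS hGS hfin hx (w := u) (by omega)
    have h5 := len_mul_fixed_of_len_lt hS hGS hfin hx (w := u * v) (by omega)
    rw [Subgroup.coe_mul, ← mul_assoc] at h5
    rw [Subgroup.coe_mul]
    omega

end Fixed

theorem theUnique_eq {α : Type*} {d : α} {P : α → Prop} {x : α} (hx : P x)
    (hu : ∀ y, P y → y = x) : theUnique d P = x := by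
  have h : ∃! x, P x := ⟨x, hx, hu⟩
  unfold theUnique
  rw [dif_pos h]
  exact hu _ h.choose_spec.1

/-! ### The standard basis of the Hecke algebra -/

section HeckeBasis

variable {W : Type*} [Group W] {S : Set W} {Γ : Type*} [AddCommGroup Γ] [LinearOrder Γ] {φ : W → Γ}

theorem expo_zero : expo (0 : Γ) = 1 := rfl

theorem expo_add (a b : Γ) : expo (a + b) = expo a * expo b := by
  simp [expo, AddMonoidAlgebra.single_mul_single]

/-- `e^{φ(s)} - e^{-φ(s)}`. -/
def qdiff (φ : W → Γ) (s : W) : GrpAlg Γ := expo (φ s) - expo (-φ s)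

/-- An exchange system together with a weight function. -/
structure HeckeDatum (S : Set W) (φ : W → Γ) : Prop where
  exch : ExchangeSystem S
  weight : IsWeight S φ

namespace ExchangeSystem

/-- Unless sw = wt, folding forbids multiplication by t on the right to change whether s is a left
descent, and conversely. This is what makes left and right multiplication commute. -/
theorem mul_mul_cases (hS : ExchangeSystem S) {s t : W} (hs : s ∈ S) (ht : t ∈ S) (w : W) :
    s * w = w * t ∨ ((len S (s * (w * t)) < len S (w * t) ↔ len S (s * w) < len S w) ∧
      (len S (s * (w * t)) < len S (s * w) ↔ len S (w * t) < len S w)) := by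
  by_cases hsw : s * w = w * t
  · exact Or.inl hsw
  right
  have h1 := hS.len_mul_cases hs w
  have h2 := hS.len_mul_cases hs (w * t)
  have h3 := hS.len_mul_right_cases ht w
  have h4 := hS.len_mul_right_cases ht (s * w)
  have key : len S (s * (w * t)) < len S (w * t) ↔ len S (s * w) < len S w := by
    constructor
    · intro h
      by_contra h'
      exact hsw (hS.fold hs ht (by omega) h)
    · intro h
      by_contra h'
      have := hS.fold hs ht (w := s * w) (by rw [hS.mul_cancel hs]; exact h)
        (by rw [mul_assoc s w t, hS.mul_cancel hs]; omega)
      rw [hS.mul_cancel hs] at this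
      apply hsw
      conv_rhs => rw [this]
      rw [hS.mul_cancel_right ht]
  refine ⟨key, ?_⟩
  rw [mul_assoc] at h4
  omega

end ExchangeSystem

namespace HeckeDatum

theorem weight_one (hD : HeckeDatum S φ) : φ 1 = 0 := by
  have := hD.weight 1 1 (by simp [hD.exch.len_one])
  simpa using this

theorem weight_eq_of_mul_eq (hD : HeckeDatum S φ) {s t w : W} (hs : s ∈ S) (ht : t ∈ S)
    (h : s * w = w * t) : φ s = φ t := by
  have hS := hD.exch
  have key : ∀ w, s * w = w * t → len S (s * w) = len S w + 1 → φ s = φ t := by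
    intro w h h1
    have e1 := hD.weight s w (by rw [hS.len_simple hs]; omega)
    have e2 := hD.weight w t (by rw [hS.len_simple ht, ← h]; omega)
    rw [h, e2, add_comm] at e1
    exact (add_right_cancel e1).symm
  rcases hS.len_mul_cases hs w with h1 | h1
  · exact key w h h1
  · refine key (s * w) ?_ (by rw [hS.mul_cancel hs]; exact h1)
    rw [hS.mul_cancel hs, h, hS.mul_cancel_right ht]

end HeckeDatum

open Classical in
/-- Left multiplication by `T_s` on the free module with basis `W`. -/
def leftOp (S : Set W) (φ : W → Γ) (s : W) : (W →₀ GrpAlg Γ) →ₗ[GrpAlg Γ] (W →₀ GrpAlg Γ) :=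
  Finsupp.linearCombination (GrpAlg Γ) fun w =>
    Finsupp.single (s * w) 1 + if len S (s * w) < len S w then Finsupp.single w (qdiff φ s) else 0

open Classical in
/-- Right multiplication by `T_t` on the free module with basis `W`. -/
def rightOp (S : Set W) (φ : W → Γ) (t : W) : (W →₀ GrpAlg Γ) →ₗ[GrpAlg Γ] (W →₀ GrpAlg Γ) :=
  Finsupp.linearCombination (GrpAlg Γ) fun w =>
    Finsupp.single (w * t) 1 + if len S (w * t) < len S w then Finsupp.single w (qdiff φ t) else 0

open Classical in
theorem leftOp_single (s w : W) (a : GrpAlg Γ) :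
    leftOp S φ s (Finsupp.single w a) = Finsupp.single (s * w) a +
      if len S (s * w) < len S w then Finsupp.single w (a * qdiff φ s) else 0 := by
  rw [leftOp, Finsupp.linearCombination_single]
  split_ifs <;> simp

open Classical in
theorem rightOp_single (t w : W) (a : GrpAlg Γ) :
    rightOp S φ t (Finsupp.single w a) = Finsupp.single (w * t) a +
      if len S (w * t) < len S w then Finsupp.single w (a * qdiff φ t) else 0 := by
  rw [rightOp, Finsupp.linearCombination_single]
  split_ifs <;> simp

namespace HeckeDatum

variable (hD : HeckeDatum S φ)
include hD

/-- The expected formulas for multiplication by T_s and T_t are imposed on the free module with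
basis W, where independence of the T_w is free of charge. -/
theorem leftOp_rightOp {s t : W} (hs : s ∈ S) (ht : t ∈ S) (x : W →₀ GrpAlg Γ) :
    leftOp S φ s (rightOp S φ t x) = rightOp S φ t (leftOp S φ s x) := by
  classical
  induction x using Finsupp.induction_linear with
  | zero => simp
  | add f g hf hg => simp only [map_add, hf, hg]
  | single w a =>
    have hr : ∀ (P : Prop) [Decidable P] (f : W →₀ GrpAlg Γ),
      rightOp S φ t (if P then f else 0) = if P then rightOp S φ t f else 0 := by
      intro P _ f
      split_ifs <;> simp
    have hl : ∀ (P : Prop) [Decidable P] (f : W →₀ GrpAlg Γ),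
      leftOp S φ s (if P then f else 0) = if P then leftOp S φ s f else 0 := by
      intro P _ f
      split_ifs <;> simp
    rw [rightOp_single, leftOp_single, map_add, map_add, hr, hl]
    simp only [leftOp_single, rightOp_single]
    -- If sw = wt then φ(s) = φ(t) and both sides have the same terms; otherwise the two descent
    -- conditions are independent.
    rcases hD.exch.mul_mul_cases hs ht w with h | ⟨h1, h2⟩
    · have hq : qdiff φ s = qdiff φ t := by
        unfold qdiff
        rw [hD.weight_eq_of_mul_eq hs ht h]
      rw [← mul_assoc, h, hq]
    · simp only [h1, h2, mul_assoc]
      rw [mul_comm (qdiff φ t) (qdiff φ s)]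
      split_ifs <;> abel

/-- The basis vector at 1 generates the module under the right operators. The relations of the Hecke
algebra therefore need checking on that vector only. -/
theorem end_eq_of_commute {f g : (W →₀ GrpAlg Γ) →ₗ[GrpAlg Γ] (W →₀ GrpAlg Γ)}
    (hf : ∀ t ∈ S, ∀ x, f (rightOp S φ t x) = rightOp S φ t (f x))
    (hg : ∀ t ∈ S, ∀ x, g (rightOp S φ t x) = rightOp S φ t (g x))
    (h : f (Finsupp.single 1 1) = g (Finsupp.single 1 1)) : f = g := by
  ext w : 2
  simp only [LinearMap.comp_apply, Finsupp.lsingle_apply]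
  induction w using hD.exch.induction_right with
  | one => exact h
  | mul t ht w hw ih =>
    have : Finsupp.single (w * t) 1 = rightOp S φ t (Finsupp.single w 1) := by
      classical
      rw [rightOp_single, if_neg (by omega), add_zero]
    rw [this, hf t ht, hg t ht, ih]

theorem exists_leftMul (w : W) : ∃ f : (W →₀ GrpAlg Γ) →ₗ[GrpAlg Γ] (W →₀ GrpAlg Γ),
    (∀ t ∈ S, ∀ x, f (rightOp S φ t x) = rightOp S φ t (f x)) ∧
      f (Finsupp.single 1 1) = Finsupp.single w 1 := by
  induction w using hD.exch.induction_left with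
  | one => exact ⟨LinearMap.id, fun _ _ _ => rfl, rfl⟩
  | mul s hs w hw ih =>
    obtain ⟨f, h1, h2⟩ := ih
    refine ⟨leftOp S φ s ∘ₗ f, fun t ht x => ?_, ?_⟩
    · rw [LinearMap.comp_apply, LinearMap.comp_apply, h1 t ht, hD.leftOp_rightOp hs ht]
    · classical
      rw [LinearMap.comp_apply, h2, leftOp_single, if_neg (by omega), add_zero]

/-- Left multiplication by `T_w` on the free module with basis `W`. -/
def leftMul (w : W) : Module.End (GrpAlg Γ) (W →₀ GrpAlg Γ) := (hD.exists_leftMul w).choose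

theorem leftMul_rightOp (w : W) {t : W} (ht : t ∈ S) (x : W →₀ GrpAlg Γ) :
    hD.leftMul w (rightOp S φ t x) = rightOp S φ t (hD.leftMul w x) :=
  (hD.exists_leftMul w).choose_spec.1 t ht x

theorem leftMul_one_single (w : W) :
    hD.leftMul w (Finsupp.single 1 1) = Finsupp.single w 1 :=
  (hD.exists_leftMul w).choose_spec.2

theorem leftMul_single (w w' : W) (h : len S (w * w') = len S w + len S w') :
    hD.leftMul w (Finsupp.single w' 1) = Finsupp.single (w * w') 1 := by
  classical
  induction w' using hD.exch.induction_right with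
  | one => rw [mul_one, leftMul_one_single]
  | mul t ht w' hw ih =>
    have h1 := hD.exch.len_mul_le w w'
    have h2 := hD.exch.len_mul_right_cases ht (w * w')
    rw [mul_assoc] at h2
    have e : Finsupp.single (w' * t) 1 = rightOp S φ t (Finsupp.single w' 1) := by
      rw [rightOp_single, if_neg (by omega), add_zero]
    rw [e, hD.leftMul_rightOp w ht, ih (by omega), rightOp_single, mul_assoc, if_neg (by omega),
      add_zero]

theorem leftMul_eq_leftOp {s : W} (hs : s ∈ S) : hD.leftMul s = leftOp S φ s := by
  classical
  refine hD.end_eq_of_commute (fun t ht x => hD.leftMul_rightOp s ht x)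
    (fun t ht x => hD.leftOp_rightOp hs ht x) ?_
  rw [leftMul_one_single, leftOp_single, mul_one, hD.exch.len_one, if_neg (by omega), add_zero]

/-- The regular representation of the Hecke algebra. -/
def regRep : Hecke S φ →ₐ[GrpAlg Γ] Module.End (GrpAlg Γ) (W →₀ GrpAlg Γ) :=
  RingQuot.liftAlgHom (GrpAlg Γ) (s := HeckeRel S φ)
    ⟨FreeAlgebra.lift (GrpAlg Γ) hD.leftMul, by
      intro x y hxy
      induction hxy with
      | one =>
        rw [FreeAlgebra.lift_ι_apply, map_one]
        exact hD.end_eq_of_commute (fun t ht x => hD.leftMul_rightOp 1 ht x) (fun _ _ _ => rfl)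
          (hD.leftMul_one_single 1)
      | mul w w' h =>
        rw [map_mul, FreeAlgebra.lift_ι_apply, FreeAlgebra.lift_ι_apply, FreeAlgebra.lift_ι_apply]
        refine hD.end_eq_of_commute (fun t ht x => ?_) (fun t ht x => hD.leftMul_rightOp _ ht x) ?_
        · rw [Module.End.mul_apply, Module.End.mul_apply, hD.leftMul_rightOp w' ht,
            hD.leftMul_rightOp w ht]
        · rw [Module.End.mul_apply, hD.leftMul_one_single, hD.leftMul_single w w' h,
            hD.leftMul_one_single]
      | quad s hs =>
        classical
        rw [map_mul, map_sub, map_add, AlgHom.commutes, AlgHom.commutes, map_zero,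
          FreeAlgebra.lift_ι_apply, hD.leftMul_eq_leftOp hs]
        refine hD.end_eq_of_commute (fun t ht x => ?_) (fun t ht x => ?_) ?_
        · simp only [Module.End.mul_apply, LinearMap.sub_apply, LinearMap.add_apply,
            Module.algebraMap_end_apply, hD.leftOp_rightOp hs ht, ← map_smul, ← map_add, ← map_sub]
        · simp
        · simp only [Module.End.mul_apply, LinearMap.sub_apply, LinearMap.add_apply,
            Module.algebraMap_end_apply, map_add, map_smul, LinearMap.zero_apply]
          have e : expo (φ s) * expo (-φ s) = 1 := by rw [← expo_add, add_neg_cancel, expo_zero]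
          have e1 : leftOp S φ s (Finsupp.single 1 1) = Finsupp.single s 1 := by
            rw [leftOp_single, mul_one, hD.exch.len_one, if_neg (by omega), add_zero]
          have e2 : leftOp S φ s (Finsupp.single s 1) =
              Finsupp.single 1 1 + qdiff φ s • Finsupp.single s 1 := by
            rw [leftOp_single, hD.exch.sq s hs, hD.exch.len_one, hD.exch.len_simple hs,
              if_pos (by omega), one_mul, Finsupp.smul_single, smul_eq_mul, mul_one]
          rw [e1, e2, qdiff, smul_sub, smul_smul, mul_comm (expo (-φ s)), e, one_smul, sub_smul]
          abel⟩

theorem regRep_T (w : W) : hD.regRep (T S φ w) = hD.leftMul w := by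
  refine (RingQuot.liftAlgHom_mkAlgHom_apply (GrpAlg Γ) _ _ _).trans ?_
  exact FreeAlgebra.lift_ι_apply _ _

omit hD in
theorem T_one : T S φ 1 = 1 := by
  have := RingQuot.mkAlgHom_rel (GrpAlg Γ) (HeckeRel.one (S := S) (φ := φ))
  rwa [map_one] at this

omit hD in
theorem T_mul {w w' : W} (h : len S (w * w') = len S w + len S w') :
    T S φ w * T S φ w' = T S φ (w * w') := by
  have := RingQuot.mkAlgHom_rel (GrpAlg Γ) (HeckeRel.mul (S := S) (φ := φ) w w' h)
  rwa [map_mul] at this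

omit hD in
theorem T_quad {s : W} (hs : s ∈ S) :
    (T S φ s - algebraMap (GrpAlg Γ) _ (expo (φ s))) *
      (T S φ s + algebraMap (GrpAlg Γ) _ (expo (-φ s))) = 0 := by
  have := RingQuot.mkAlgHom_rel (GrpAlg Γ) (HeckeRel.quad (S := S) (φ := φ) s hs)
  rwa [map_mul, map_sub, map_add, AlgHom.commutes, AlgHom.commutes, map_zero] at this

omit hD in
theorem T_sq {s : W} (hs : s ∈ S) : T S φ s * T S φ s = 1 + qdiff φ s • T S φ s := by
  have h := T_quad (φ := φ) hs
  have e : expo (φ s) * expo (-φ s) = 1 := by rw [← expo_add, add_neg_cancel, expo_zero]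
  rw [sub_mul, mul_add, mul_add, ← map_mul, e, map_one, ← Algebra.smul_def,
    ← Algebra.commutes, ← Algebra.smul_def] at h
  rw [qdiff, sub_smul, ← sub_eq_zero, ← h]
  abel

theorem T_simple_mul {s : W} (hs : s ∈ S) {w : W} (h : len S w < len S (s * w)) :
    T S φ s * T S φ w = T S φ (s * w) := by
  refine T_mul ?_
  have := hD.exch.len_mul_cases hs w
  rw [hD.exch.len_simple hs]
  omega

theorem T_simple_mul_of_descent {s : W} (hs : s ∈ S) {w : W} (h : len S (s * w) < len S w) :
    T S φ s * T S φ w = T S φ (s * w) + qdiff φ s • T S φ w := by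
  have h1 := hD.T_simple_mul hs (w := s * w) (by rwa [hD.exch.mul_cancel hs])
  rw [hD.exch.mul_cancel hs] at h1
  conv_lhs => rw [← h1]
  rw [← mul_assoc, T_sq hs, add_mul, one_mul, smul_mul_assoc, h1]

omit hD in
theorem adjoin_range_T : Algebra.adjoin (GrpAlg Γ) (Set.range (T S φ)) = ⊤ := by
  have h := congrArg (Subalgebra.map (RingQuot.mkAlgHom (GrpAlg Γ) (HeckeRel S φ)))
    (FreeAlgebra.adjoin_range_ι (GrpAlg Γ) W)
  rw [AlgHom.map_adjoin, ← Set.range_comp, Algebra.map_top,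
    (AlgHom.range_eq_top _).2 (RingQuot.mkAlgHom_surjective _ _)] at h
  exact h

theorem mul_mem_span {s : W} (hs : s ∈ S) {h : Hecke S φ}
    (hh : h ∈ Submodule.span (GrpAlg Γ) (Set.range (T S φ))) :
    T S φ s * h ∈ Submodule.span (GrpAlg Γ) (Set.range (T S φ)) := by
  induction hh using Submodule.span_induction with
  | mem x hx =>
    obtain ⟨w, rfl⟩ := hx
    rcases hD.exch.len_mul_cases hs w with h | h
    · rw [hD.T_simple_mul hs (by omega)]
      exact Submodule.subset_span ⟨_, rfl⟩
    · rw [hD.T_simple_mul_of_descent hs (by omega)]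
      exact add_mem (Submodule.subset_span ⟨_, rfl⟩)
        (Submodule.smul_mem _ _ (Submodule.subset_span ⟨_, rfl⟩))
  | zero => rw [mul_zero]; exact zero_mem _
  | add x y _ _ hx hy => rw [mul_add]; exact add_mem hx hy
  | smul a x _ hx => rw [mul_smul_comm]; exact Submodule.smul_mem _ _ hx

theorem T_mul_mem_span (w : W) {h : Hecke S φ}
    (hh : h ∈ Submodule.span (GrpAlg Γ) (Set.range (T S φ))) :
    T S φ w * h ∈ Submodule.span (GrpAlg Γ) (Set.range (T S φ)) := by
  induction w using hD.exch.induction_left with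
  | one => rwa [T_one, one_mul]
  | mul s hs w hw ih =>
    rw [← hD.T_simple_mul hs (by omega), mul_assoc]
    exact hD.mul_mem_span hs ih

theorem span_range_T : Submodule.span (GrpAlg Γ) (Set.range (T S φ)) = ⊤ := by
  rw [eq_top_iff]
  intro h _
  have key : ∀ h ∈ Algebra.adjoin (GrpAlg Γ) (Set.range (T S φ)),
      ∀ x ∈ Submodule.span (GrpAlg Γ) (Set.range (T S φ)),
        h * x ∈ Submodule.span (GrpAlg Γ) (Set.range (T S φ)) := by
    intro h hh
    induction hh using Algebra.adjoin_induction with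
    | mem h hh =>
      obtain ⟨w, rfl⟩ := hh
      exact fun x hx => hD.T_mul_mem_span w hx
    | algebraMap a =>
      intro x hx
      rw [← Algebra.smul_def]
      exact Submodule.smul_mem _ _ hx
    | add a b _ _ ha hb =>
      intro x hx
      rw [add_mul]
      exact add_mem (ha x hx) (hb x hx)
    | mul a b _ _ ha hb =>
      intro x hx
      rw [mul_assoc]
      exact ha _ (hb x hx)
  have := key h (by rw [adjoin_range_T]; trivial) 1
    (Submodule.subset_span ⟨1, T_one⟩)
  rwa [mul_one] at this

theorem linearIndependent_T : LinearIndependent (GrpAlg Γ) (T S φ) := by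
  let f : Hecke S φ →ₗ[GrpAlg Γ] (W →₀ GrpAlg Γ) :=
    (LinearMap.applyₗ (Finsupp.single 1 1)).comp hD.regRep.toLinearMap
  refine LinearIndependent.of_comp f ?_
  have : ⇑f ∘ T S φ = fun w => Finsupp.single w 1 := by
    funext w
    change hD.regRep (T S φ w) (Finsupp.single 1 1) = _
    rw [hD.regRep_T, hD.leftMul_one_single]
  rw [this]
  exact Finsupp.linearIndependent_single_one (GrpAlg Γ) W

/-- The standard basis of the Hecke algebra. -/
def basis : Module.Basis W (GrpAlg Γ) (Hecke S φ) :=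
  Module.Basis.mk hD.linearIndependent_T hD.span_range_T.ge

@[simp]
theorem basis_apply (w : W) : hD.basis w = T S φ w := Module.Basis.mk_apply _ _ w

theorem repr_T (w : W) : hD.basis.repr (T S φ w) = Finsupp.single w 1 := by
  rw [← hD.basis_apply, Module.Basis.repr_self]

theorem tau_eq : tau S φ = hD.basis.coord 1 := by
  classical
  refine theUnique_eq (fun w => ?_) fun f hf => hD.basis.ext fun w => ?_
  · rw [Module.Basis.coord_apply, hD.repr_T, Finsupp.single_apply]
  · rw [hD.basis_apply, hf, Module.Basis.coord_apply, hD.repr_T, Finsupp.single_apply]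

theorem tau_apply (h : Hecke S φ) : tau S φ h = hD.basis.repr h 1 := by
  rw [hD.tau_eq]
  rfl

open Classical in
theorem tau_T_mul_T (u v : W) :
    tau S φ (T S φ u * T S φ v) = if u * v = 1 then 1 else 0 := by
  induction u using hD.exch.induction_right generalizing v with
  | one => rw [T_one, one_mul, one_mul, hD.tau_apply, hD.repr_T, Finsupp.single_apply]
  | mul s hs u hu ih =>
    have e : T S φ (u * s) = T S φ u * T S φ s :=
      (T_mul (by rw [hu, hD.exch.len_simple hs])).symm
    rw [e, mul_assoc]
    rcases hD.exch.len_mul_cases hs v with h | h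
    · rw [hD.T_simple_mul hs (by omega), ih, mul_assoc]
    · rw [hD.T_simple_mul_of_descent hs (by omega), mul_add, mul_smul_comm, map_add, map_smul, ih,
        ih, mul_assoc, if_neg (c := u * v = 1), smul_zero, add_zero]
      -- If u = v⁻¹, then s, a left descent of v, would be a right descent of u, although ℓ(us) =
      -- ℓ(u) + 1.
      intro huv
      have huv' : u = v⁻¹ := eq_inv_of_mul_eq_one_left huv
      rw [huv', hD.exch.len_inv, ← hD.exch.len_inv, mul_inv_rev, hD.exch.inv_eq hs, inv_inv] at hu
      omega

/-- The index representation `T_w ↦ e^{φ(w)}`. -/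
def indexRep : Hecke S φ →ₐ[GrpAlg Γ] GrpAlg Γ :=
  RingQuot.liftAlgHom (GrpAlg Γ) (s := HeckeRel S φ)
    ⟨FreeAlgebra.lift (GrpAlg Γ) fun w => expo (φ w), by
      intro x y hxy
      induction hxy with
      | one => rw [FreeAlgebra.lift_ι_apply, map_one, hD.weight_one, expo_zero]
      | mul w w' h =>
        rw [map_mul, FreeAlgebra.lift_ι_apply, FreeAlgebra.lift_ι_apply, FreeAlgebra.lift_ι_apply,
          hD.weight w w' h, expo_add]
      | quad s hs =>
        rw [map_mul, map_sub, map_add, AlgHom.commutes, AlgHom.commutes, map_zero,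
          FreeAlgebra.lift_ι_apply, Algebra.algebraMap_self_apply, sub_self, zero_mul]⟩

theorem indexRep_T (w : W) : hD.indexRep (T S φ w) = expo (φ w) := by
  refine (RingQuot.liftAlgHom_mkAlgHom_apply (GrpAlg Γ) _ _ _).trans ?_
  exact FreeAlgebra.lift_ι_apply _ _

end HeckeDatum

end HeckeBasis

/-! ### The bar involution -/

section GroupAlgebra

variable {Γ : Type*} [AddCommGroup Γ]

/-- The involution `e^γ ↦ e^{-γ}` of `ℤ[Γ]`. -/
def barA : GrpAlg Γ →+* GrpAlg Γ := AddMonoidAlgebra.mapDomainRingHom ℤ (-AddMonoidHom.id Γ)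

theorem barA_single (γ : Γ) (c : ℤ) :
    barA (AddMonoidAlgebra.single γ c) = AddMonoidAlgebra.single (-γ) c := by
  simp [barA]

theorem barA_expo (γ : Γ) : barA (expo γ) = expo (-γ) := barA_single γ 1

theorem barA_coeff (a : GrpAlg Γ) (γ : Γ) : (barA a).coeff γ = a.coeff (-γ) := by
  classical
  induction a using AddMonoidAlgebra.induction_linear with
  | zero => simp
  | add f g hf hg => simp [hf, hg]
  | single δ c =>
    rw [barA_single]
    simp only [AddMonoidAlgebra.coeff_single, Finsupp.single_apply, neg_eq_iff_eq_neg]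

variable [LinearOrder Γ]

/-- The elements of `ℤ[Γ]` involving only negative exponents. -/
def negPart (Γ : Type*) [AddCommGroup Γ] [LinearOrder Γ] : AddSubgroup (GrpAlg Γ) where
  carrier := {a | ∀ γ, 0 ≤ γ → a.coeff γ = 0}
  add_mem' ha hb γ hγ := by simp [ha γ hγ, hb γ hγ]
  zero_mem' γ _ := rfl
  neg_mem' ha γ hγ := by simp [ha γ hγ]

theorem single_mem_negPart {γ : Γ} (hγ : γ < 0) (c : ℤ) :
    AddMonoidAlgebra.single γ c ∈ negPart Γ := by
  intro δ hδ
  rw [AddMonoidAlgebra.coeff_single, Finsupp.single_apply_eq_zero]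
  rintro rfl
  exact absurd hγ (not_lt.2 hδ)

omit [LinearOrder Γ] in
theorem intCast_mul_coeff (m : ℤ) (a : GrpAlg Γ) (γ : Γ) :
    ((m : GrpAlg Γ) * a).coeff γ = m * a.coeff γ := by
  rw [← zsmul_eq_mul]
  rfl

omit [LinearOrder Γ] in
theorem intCast_dvd_iff {m : ℤ} {a : GrpAlg Γ} :
    (m : GrpAlg Γ) ∣ a ↔ ∀ γ, m ∣ a.coeff γ := by
  constructor
  · rintro ⟨b, rfl⟩ γ
    exact ⟨b.coeff γ, intCast_mul_coeff m b γ⟩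
  · intro h
    -- For m = 0 the quotient is 0, as it should be, since all coefficients then vanish. The case m
    -- = 0 serves later to prove equalities.
    refine ⟨AddMonoidAlgebra.ofCoeff (a.coeff.mapRange (· / m) (Int.zero_ediv m)), ?_⟩
    ext γ
    rw [intCast_mul_coeff]
    exact (Int.mul_ediv_cancel' (h γ)).symm

omit [LinearOrder Γ] in
theorem sum_smul_expo (a : GrpAlg Γ) : (a.coeff.sum fun γ c => c • expo γ) = a := by
  induction a using AddMonoidAlgebra.induction_linear with
  | zero => simp
  | add f g hf hg =>
    conv_rhs => rw [← hf, ← hg]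
    exact Finsupp.sum_add_index' (fun _ => zero_smul _ _) fun _ _ _ => add_smul _ _ _
  | single γ c =>
    rw [AddMonoidAlgebra.coeff_single, Finsupp.sum_single_index (by simp)]
    simp [expo]

variable [IsOrderedAddMonoid Γ]

/-- Each term with a positive exponent is completed by its mirror image, which is negative. -/
theorem exists_barA_fixed (a : GrpAlg Γ) : ∃ b, barA b = b ∧ a - b ∈ negPart Γ := by
  induction a using AddMonoidAlgebra.induction_linear with
  | zero => exact ⟨0, map_zero _, by simp⟩
  | add f g hf hg =>
    obtain ⟨b, h1, h2⟩ := hf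
    obtain ⟨c, h3, h4⟩ := hg
    exact ⟨b + c, by rw [map_add, h1, h3], by rw [add_sub_add_comm]; exact add_mem h2 h4⟩
  | single γ c =>
    rcases lt_trichotomy γ 0 with h | rfl | h
    · exact ⟨0, map_zero _, by rw [sub_zero]; exact single_mem_negPart h c⟩
    · exact ⟨AddMonoidAlgebra.single 0 c, by rw [barA_single, neg_zero], by simp⟩
    · refine ⟨AddMonoidAlgebra.single γ c + AddMonoidAlgebra.single (-γ) c, ?_, ?_⟩
      · rw [map_add, barA_single, barA_single, neg_neg, add_comm]
      · rw [sub_add_cancel_left]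
        exact neg_mem (single_mem_negPart (neg_lt_zero.2 h) c)

end GroupAlgebra

/-! ### The bar involution of the Hecke algebra: existence, uniqueness and triangularity. -/

section Bar

variable {W : Type*} [Group W] {S : Set W} {Γ : Type*} [AddCommGroup Γ] [LinearOrder Γ] {φ : W → Γ}

/-- The Hecke algebra, with the scalars `ℤ[Γ]` acting through the involution. -/
def HeckeTwist (S : Set W) (φ : W → Γ) : Type _ := Hecke S φ

instance : Ring (HeckeTwist S φ) := inferInstanceAs (Ring (Hecke S φ))

/-- With twisted scalars on the target the bar involution is A-linear, so the presentation of the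
Hecke algebra can define it. -/
instance : Algebra (GrpAlg Γ) (HeckeTwist S φ) :=
  RingHom.toAlgebra' (R := GrpAlg Γ) (S := HeckeTwist S φ)
    ((algebraMap (GrpAlg Γ) (Hecke S φ)).comp barA)
    fun c x => Algebra.commutes (A := Hecke S φ) (barA c) x

/-- The identity map from the Hecke algebra to its twist. -/
def toTwist : Hecke S φ ≃+* HeckeTwist S φ := RingEquiv.refl (Hecke S φ)

theorem heckeTwist_algebraMap (a : GrpAlg Γ) : algebraMap (GrpAlg Γ) (HeckeTwist S φ) a =
    toTwist (algebraMap (GrpAlg Γ) (Hecke S φ) (barA a)) := rfl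

theorem expo_mul_expo_neg (γ : Γ) : expo γ * expo (-γ) = 1 := by
  rw [← expo_add, add_neg_cancel, expo_zero]

namespace HeckeDatum

theorem T_simple_mul_inv {s : W} (hs : s ∈ S) :
    T S φ s * (T S φ s - algebraMap _ _ (qdiff φ s)) = 1 := by
  rw [mul_sub, T_sq hs, ← Algebra.commutes, ← Algebra.smul_def, add_sub_cancel_right]

theorem T_simple_inv_mul {s : W} (hs : s ∈ S) :
    (T S φ s - algebraMap _ _ (qdiff φ s)) * T S φ s = 1 := by
  rw [sub_mul, T_sq hs, ← Algebra.smul_def, add_sub_cancel_right]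

variable (hD : HeckeDatum S φ)
include hD

theorem isUnit_T (w : W) : IsUnit (T S φ w) := by
  induction w using hD.exch.induction_left with
  | one => rw [T_one]; exact isUnit_one
  | mul s hs w hw ih =>
    rw [← hD.T_simple_mul hs (by omega)]
    exact IsUnit.mul ⟨⟨_, _, T_simple_mul_inv hs, T_simple_inv_mul hs⟩, rfl⟩ ih

omit hD in
theorem inverse_T_simple {s : W} (hs : s ∈ S) :
    Ring.inverse (T S φ s) = T S φ s - algebraMap _ _ (qdiff φ s) :=
  Ring.inverse_unit ⟨T S φ s, _, T_simple_mul_inv hs, T_simple_inv_mul hs⟩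

theorem inverse_T_mul {w w' : W} (h : len S (w * w') = len S w + len S w') :
    Ring.inverse (T S φ w⁻¹) * Ring.inverse (T S φ w'⁻¹) = Ring.inverse (T S φ (w * w')⁻¹) := by
  have e : T S φ (w * w')⁻¹ = T S φ w'⁻¹ * T S φ w⁻¹ := by
    rw [mul_inv_rev, T_mul]
    rw [← mul_inv_rev, hD.exch.len_inv, hD.exch.len_inv, hD.exch.len_inv, h, add_comm]
  refine left_inv_eq_right_inv (a := T S φ (w * w')⁻¹) ?_ (Ring.mul_inverse_cancel _ (hD.isUnit_T _))
  rw [e, mul_assoc, ← mul_assoc _ (T S φ w'⁻¹), Ring.inverse_mul_cancel _ (hD.isUnit_T _), one_mul,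
    Ring.inverse_mul_cancel _ (hD.isUnit_T _)]

/-- The bar involution, as a semilinear homomorphism. -/
def barTwist : Hecke S φ →ₐ[GrpAlg Γ] HeckeTwist S φ :=
  RingQuot.liftAlgHom (GrpAlg Γ) (s := HeckeRel S φ) (B := HeckeTwist S φ)
    ⟨FreeAlgebra.lift (GrpAlg Γ) (A := HeckeTwist S φ) fun w => toTwist (Ring.inverse (T S φ w⁻¹)), by
      intro x y hxy
      induction hxy with
      | one => rw [FreeAlgebra.lift_ι_apply, map_one, inv_one, T_one, Ring.inverse_one, map_one]
      | mul w w' h =>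
        rw [map_mul, FreeAlgebra.lift_ι_apply, FreeAlgebra.lift_ι_apply, FreeAlgebra.lift_ι_apply,
          ← map_mul, hD.inverse_T_mul h]
      | quad s hs =>
        -- Since T_s⁻¹ = T_s - (e^{φ(s)} - e^{-φ(s)}), each of the two factors of the quadratic
        -- relation is carried to itself.
        rw [map_mul, map_sub, map_add, AlgHom.commutes, AlgHom.commutes, map_zero,
          FreeAlgebra.lift_ι_apply, hD.exch.inv_eq hs, inverse_T_simple hs, heckeTwist_algebraMap,
          heckeTwist_algebraMap, barA_expo, barA_expo, neg_neg, qdiff, ← map_sub, ← map_add,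
          ← map_mul, map_sub, sub_sub_eq_add_sub, sub_sub, sub_add_cancel]
        have h := T_quad (φ := φ) hs
        rw [← map_zero toTwist, ← h]
        congr 2
        abel⟩

/-- The bar involution. -/
def barHom : Hecke S φ →+* Hecke S φ :=
  ((toTwist (S := S) (φ := φ)).symm : HeckeTwist S φ →+* Hecke S φ).comp (hD.barTwist : Hecke S φ →+* HeckeTwist S φ)

theorem isBar_barHom : IsBar S φ hD.barHom := by
  constructor
  · intro γ
    change toTwist.symm (hD.barTwist _) = _
    rw [AlgHom.commutes, heckeTwist_algebraMap, barA_expo, RingEquiv.symm_apply_apply]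
  · intro w
    have e : hD.barHom (T S φ w) = Ring.inverse (T S φ w⁻¹) := by
      change toTwist.symm (hD.barTwist _) = _
      rw [RingEquiv.symm_apply_eq]
      refine (RingQuot.liftAlgHom_mkAlgHom_apply (GrpAlg Γ) _ _ _).trans ?_
      exact FreeAlgebra.lift_ι_apply _ _
    rw [e]
    exact ⟨Ring.inverse_mul_cancel _ (hD.isUnit_T _), Ring.mul_inverse_cancel _ (hD.isUnit_T _)⟩

omit hD in
theorem isBar_algebraMap {f : Hecke S φ →+* Hecke S φ} (hf : IsBar S φ f) (a : GrpAlg Γ) :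
    f (algebraMap (GrpAlg Γ) _ a) = algebraMap (GrpAlg Γ) _ (barA a) := by
  induction a using AddMonoidAlgebra.induction_linear with
  | zero => simp
  | add a b ha hb => simp only [map_add, ha, hb]
  | single γ c =>
    have e : ∀ γ : Γ, (AddMonoidAlgebra.single γ c : GrpAlg Γ) = c • expo γ := fun γ => by
      simp [expo]
    rw [barA_single, e, e, map_zsmul, map_zsmul, map_zsmul, hf.1]

omit hD in
theorem isBar_smul {f : Hecke S φ →+* Hecke S φ} (hf : IsBar S φ f) (a : GrpAlg Γ)
    (h : Hecke S φ) : f (a • h) = barA a • f h := by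
  rw [Algebra.smul_def, map_mul, isBar_algebraMap hf, ← Algebra.smul_def]

theorem isBar_unique {f g : Hecke S φ →+* Hecke S φ} (hf : IsBar S φ f) (hg : IsBar S φ g) :
    f = g := by
  ext h
  have hh : h ∈ Submodule.span (GrpAlg Γ) (Set.range (T S φ)) := by
    rw [hD.span_range_T]
    trivial
  induction hh using Submodule.span_induction with
  | mem x hx =>
    obtain ⟨w, rfl⟩ := hx
    exact left_inv_eq_right_inv (hf.2 w).1 (hg.2 w).2
  | zero => rw [map_zero, map_zero]
  | add x y _ _ hx hy => rw [map_add, map_add, hx, hy]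
  | smul a x _ hx => rw [isBar_smul hf, isBar_smul hg, hx]

theorem isBar_bar : IsBar S φ (bar S φ) := by
  have : bar S φ = hD.barHom :=
    theUnique_eq hD.isBar_barHom fun g hg => hD.isBar_unique hg hD.isBar_barHom
  rw [this]
  exact hD.isBar_barHom

theorem bar_smul (a : GrpAlg Γ) (h : Hecke S φ) : bar S φ (a • h) = barA a • bar S φ h :=
  isBar_smul hD.isBar_bar a h

theorem bar_T_simple {s : W} (hs : s ∈ S) :
    bar S φ (T S φ s) = T S φ s - algebraMap _ _ (qdiff φ s) := by
  have h := (hD.isBar_bar.2 s).1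
  rw [hD.exch.inv_eq hs] at h
  exact left_inv_eq_right_inv h (T_simple_mul_inv hs)

omit hD in
/-- The span of the `T_y` with `ℓ(y) < n`. -/
def low (S : Set W) (φ : W → Γ) (n : ℕ) : Submodule (GrpAlg Γ) (Hecke S φ) :=
  Submodule.span (GrpAlg Γ) (T S φ '' {y | len S y < n})

omit hD in
theorem T_mem_low {y : W} {n : ℕ} (h : len S y < n) : T S φ y ∈ low S φ n :=
  Submodule.subset_span ⟨y, h, rfl⟩

omit hD in
theorem low_mono {m n : ℕ} (h : m ≤ n) : low S φ m ≤ low S φ n :=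
  Submodule.span_mono (Set.image_mono fun _ hy => lt_of_lt_of_le hy h)

theorem repr_eq_zero_of_mem_low {h : Hecke S φ} {n : ℕ} (hh : h ∈ low S φ n) {y : W}
    (hy : n ≤ len S y) : hD.basis.repr h y = 0 := by
  have e : T S φ '' {y | len S y < n} = hD.basis '' {y | len S y < n} := by
    congr 1
    funext w
    simp
  rw [low, e, Module.Basis.mem_span_image] at hh
  by_contra hne
  have : len S y < n := hh (Finsupp.mem_support_iff.2 hne)
  omega

theorem T_simple_mul_mem_low {s : W} (hs : s ∈ S) {h : Hecke S φ} {n : ℕ} (hh : h ∈ low S φ n) :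
    T S φ s * h ∈ low S φ (n + 1) := by
  induction hh using Submodule.span_induction with
  | mem x hx =>
    obtain ⟨y, hy, rfl⟩ := hx
    have hy' : len S y < n := hy
    rcases hD.exch.len_mul_cases hs y with h | h
    · rw [hD.T_simple_mul hs (by omega)]
      exact T_mem_low (by omega)
    · rw [hD.T_simple_mul_of_descent hs (by omega)]
      exact add_mem (T_mem_low (by omega)) (Submodule.smul_mem _ _ (T_mem_low (by omega)))
  | zero => rw [mul_zero]; exact zero_mem _
  | add x y _ _ hx hy => rw [mul_add]; exact add_mem hx hy
  | smul a x _ hx => rw [mul_smul_comm]; exact Submodule.smul_mem _ _ hx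

/-- Filtering by length is enough for the triangularity arguments; the Bruhat order never enters. -/
theorem bar_T_sub_mem_low (w : W) : bar S φ (T S φ w) - T S φ w ∈ low S φ (len S w) := by
  induction w using hD.exch.induction_left with
  | one => rw [T_one, map_one, sub_self]; exact zero_mem _
  | mul s hs w hw ih =>
    rw [← hD.T_simple_mul hs (by omega), map_mul, hD.bar_T_simple hs, sub_mul, hw]
    have e : T S φ s * bar S φ (T S φ w) - algebraMap _ _ (qdiff φ s) * bar S φ (T S φ w) -
        T S φ s * T S φ w = T S φ s * (bar S φ (T S φ w) - T S φ w) -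
          qdiff φ s • (bar S φ (T S φ w) - T S φ w) - qdiff φ s • T S φ w := by
      rw [mul_sub, smul_sub, Algebra.smul_def, Algebra.smul_def]
      abel
    rw [e]
    exact sub_mem (sub_mem (hD.T_simple_mul_mem_low hs ih)
      (Submodule.smul_mem _ _ (low_mono (Nat.le_succ _) ih)))
      (Submodule.smul_mem _ _ (T_mem_low (Nat.lt_succ_self _)))

theorem repr_bar_T {w y : W} (h : len S w ≤ len S y) :
    hD.basis.repr (bar S φ (T S φ w)) y = hD.basis.repr (T S φ w) y := by
  have := hD.repr_eq_zero_of_mem_low (hD.bar_T_sub_mem_low w) h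
  rwa [map_sub, Finsupp.sub_apply, sub_eq_zero] at this

theorem sum_repr (h : Hecke S φ) : (hD.basis.repr h).sum (fun w a => a • T S φ w) = h := by
  have := hD.basis.linearCombination_repr h
  rw [Finsupp.linearCombination_apply] at this
  simpa using this

omit hD in
theorem expo_smul_mem_heckeNeg {γ : Γ} (hγ : γ < 0) (w : W) : expo γ • T S φ w ∈ heckeNeg S φ :=
  AddSubgroup.subset_closure ⟨γ, hγ, w, rfl⟩

theorem mem_heckeNeg {h : Hecke S φ} : h ∈ heckeNeg S φ ↔ ∀ w, hD.basis.repr h w ∈ negPart Γ := by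
  classical
  constructor
  · intro hh w
    induction hh using AddSubgroup.closure_induction with
    | mem x hx =>
      obtain ⟨γ, hγ, y, rfl⟩ := hx
      rw [map_smul, hD.repr_T, Finsupp.smul_single, smul_eq_mul, mul_one, Finsupp.single_apply]
      split_ifs
      · exact single_mem_negPart hγ 1
      · exact zero_mem _
    | zero => rw [map_zero]; exact zero_mem _
    | add x y _ _ hx hy => rw [map_add]; exact add_mem hx hy
    | neg x _ hx => rw [map_neg]; exact neg_mem hx
  · intro hh
    rw [← hD.sum_repr h]
    refine AddSubgroup.sum_mem _ fun w _ => ?_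
    have hw := hh w
    generalize hD.basis.repr h w = a at hw
    change a • T S φ w ∈ heckeNeg S φ
    rw [← sum_smul_expo a, Finsupp.sum, Finset.sum_smul]
    refine AddSubgroup.sum_mem _ fun γ hγ => ?_
    rw [smul_assoc]
    refine AddSubgroup.zsmul_mem _ (expo_smul_mem_heckeNeg ?_ w) _
    by_contra hlt
    exact Finsupp.mem_support_iff.1 hγ (hw γ (not_lt.1 hlt))

/-- An element of `H_{<0}` which is bar-invariant modulo `m` vanishes modulo `m`. -/
theorem dvd_of_bar_sub_dvd [IsOrderedAddMonoid Γ] (m : ℤ) {e : Hecke S φ} (he : e ∈ heckeNeg S φ)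
    (h : ∀ w, (m : GrpAlg Γ) ∣ hD.basis.repr (bar S φ e - e) w) (w : W) :
    (m : GrpAlg Γ) ∣ hD.basis.repr e w := by
  classical
  by_contra hw
  let X := (hD.basis.repr e).support.filter fun y => ¬ (m : GrpAlg Γ) ∣ hD.basis.repr e y
  have hX : ∀ y, y ∈ X ↔ ¬ (m : GrpAlg Γ) ∣ hD.basis.repr e y := by
    intro y
    simp only [X, Finset.mem_filter, Finsupp.mem_support_iff, and_iff_right_iff_imp]
    intro hy h0
    exact hy (h0 ▸ dvd_zero _)
  -- At a coordinate y of maximal length among those not divisible by m, triangularity gives e_y ≡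
  -- `barA` e_y modulo m. The left side has only negative exponents and the right side only positive
  -- ones, so e_y ≡ 0.
  obtain ⟨y, hy, hmax⟩ := X.exists_max_image (len S) ⟨w, (hX w).2 hw⟩
  rw [hX] at hy
  refine hy ?_
  have h1 : (m : GrpAlg Γ) ∣ hD.basis.repr (bar S φ e) y - barA (hD.basis.repr e y) := by
    have e1 : bar S φ e = (hD.basis.repr e).sum fun u a => barA a • bar S φ (T S φ u) := by
      conv_lhs => rw [← hD.sum_repr e]
      rw [map_finsuppSum]
      exact Finsupp.sum_congr fun u _ => hD.bar_smul _ _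
    have e2 : barA (hD.basis.repr e y) =
        (hD.basis.repr e).sum fun u a => barA a * hD.basis.repr (T S φ u) y := by
      rw [Finsupp.sum_eq_single y]
      · rw [hD.repr_T, Finsupp.single_eq_same, mul_one]
      · intro u _ hu
        rw [hD.repr_T, Finsupp.single_eq_of_ne' hu, mul_zero]
      · simp
    rw [e1, e2, Finsupp.sum, map_sum, Finsupp.finsetSum_apply, Finsupp.sum, ← Finset.sum_sub_distrib]
    refine Finset.dvd_sum fun u hu => ?_
    rw [map_smul, Finsupp.smul_apply, smul_eq_mul, ← mul_sub]
    by_cases hm : (m : GrpAlg Γ) ∣ hD.basis.repr e u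
    · have := map_dvd barA hm
      rw [map_intCast] at this
      exact Dvd.dvd.mul_right this _
    · rw [hD.repr_bar_T (hmax u ((hX u).2 hm)), sub_self, mul_zero]
      exact dvd_zero _
  have h2 := dvd_sub (h y) h1
  rw [map_sub, Finsupp.sub_apply, sub_sub_sub_cancel_left] at h2
  rw [intCast_dvd_iff] at h2 ⊢
  have hneg := hD.mem_heckeNeg.1 he y
  intro γ
  rcases le_total 0 γ with hγ | hγ
  · rw [hneg γ hγ]
    exact dvd_zero _
  · have := h2 γ
    rw [AddMonoidAlgebra.coeff_sub, Finsupp.sub_apply, barA_coeff,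
      hneg (-γ) (neg_nonneg.2 hγ), zero_sub, dvd_neg] at this
    exact this

end HeckeDatum

end Bar

/-! ### The Kazhdan-Lusztig basis -/

section KL

variable {W : Type*} [Group W] {S : Set W} {Γ : Type*} [AddCommGroup Γ] [LinearOrder Γ]
  [IsOrderedAddMonoid Γ] {φ : W → Γ}

namespace HeckeDatum

variable (hD : HeckeDatum S φ)
include hD

/-- Bar-invariant elements with leading term `T_w` can be corrected to be congruent to `T_w`
modulo `H_{<0}`. -/
theorem exists_correction (w : W) (hlow : ∀ y, len S y < len S w →
      ∃ c, bar S φ c = c ∧ c - T S φ y ∈ heckeNeg S φ ∧ c - T S φ y ∈ low S φ (len S y))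
    (k : ℕ) (b : Hecke S φ) (hb : bar S φ b = b) (hbw : b - T S φ w ∈ low S φ (len S w))
    (hk : ∀ y, k ≤ len S y → hD.basis.repr (b - T S φ w) y ∈ negPart Γ) :
    ∃ c, bar S φ c = c ∧ c - T S φ w ∈ heckeNeg S φ ∧ c - T S φ w ∈ low S φ (len S w) := by
  classical
  -- The coordinates of length at least k are already negative. One step treats length k: subtract
  -- α_y C_y, where α_y is bar-invariant and equals the y-coordinate up to negative exponents. This
  -- leaves longer coordinates untouched.
  induction k generalizing b with
  | zero => exact ⟨b, hb, hD.mem_heckeNeg.2 fun y => hk y (Nat.zero_le _), hbw⟩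
  | succ k ih =>
    rcases le_or_gt (len S w) k with hkw | hkw
    · refine ih b hb hbw fun y hy => ?_
      rw [hD.repr_eq_zero_of_mem_low hbw (by omega)]
      exact zero_mem _
    choose! c hc1 hc2 hc3 using hlow
    choose α hα1 hα2 using fun y => exists_barA_fixed (hD.basis.repr (b - T S φ w) y)
    let Y := (hD.basis.repr (b - T S φ w)).support.filter fun y => len S y = k
    have hY : ∀ y ∈ Y, len S y = k := fun y hy => (Finset.mem_filter.1 hy).2
    have hrepr : ∀ y ∈ Y, ∀ z, k ≤ len S z →
        hD.basis.repr (α y • c y) z = if z = y then α y else 0 := by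
      intro y hy z hz
      have hyk := hY y hy
      have := hD.repr_eq_zero_of_mem_low (hc3 y (by omega)) (y := z) (by omega)
      rw [map_sub, Finsupp.sub_apply, sub_eq_zero, hD.repr_T, Finsupp.single_apply] at this
      rw [map_smul, Finsupp.smul_apply, this, smul_eq_mul, mul_ite, mul_one, mul_zero]
      simp only [eq_comm]
    refine ih (b - ∑ y ∈ Y, α y • c y) ?_ ?_ ?_
    · rw [map_sub, hb, map_sum]
      congr 1
      refine Finset.sum_congr rfl fun y hy => ?_
      rw [hD.bar_smul, hα1, hc1 y (by rw [hY y hy]; exact hkw)]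
    · rw [sub_right_comm]
      refine sub_mem hbw (sum_mem fun y hy => Submodule.smul_mem _ _ ?_)
      have hyk := hY y hy
      rw [← sub_add_cancel (c y) (T S φ y)]
      exact add_mem (low_mono (by omega) (hc3 y (by omega))) (T_mem_low (by omega))
    · intro z hz
      rw [sub_right_comm, map_sub, Finsupp.sub_apply, map_sum, Finsupp.finsetSum_apply,
        Finset.sum_congr rfl fun y hy => hrepr y hy z hz, Finset.sum_ite_eq]
      split_ifs with h
      · exact hα2 z
      · rw [sub_zero]
        by_cases hzk : k + 1 ≤ len S z
        · exact hk z hzk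
        · have h0 : hD.basis.repr (b - T S φ w) z = 0 := by
            by_contra hne
            exact h (Finset.mem_filter.2 ⟨Finsupp.mem_support_iff.2 hne, by omega⟩)
          rw [h0]
          exact zero_mem _

theorem exists_C (w : W) :
    ∃ c, bar S φ c = c ∧ c - T S φ w ∈ heckeNeg S φ ∧ c - T S φ w ∈ low S φ (len S w) := by
  induction h : len S w using Nat.strong_induction_on generalizing w with
  | h n ih =>
    subst h
    by_cases hw : w = 1
    · subst hw
      exact ⟨T S φ 1, by rw [T_one, map_one], by rw [sub_self]; exact zero_mem _,
        by rw [sub_self]; exact zero_mem _⟩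
    obtain ⟨s, hs, hsw⟩ := hD.exch.exists_descent hw
    obtain ⟨c, h1, -, h3⟩ := ih _ hsw (s * w) rfl
    have hlen := hD.exch.len_mul_cases hs w
    have hT := hD.T_simple_mul hs (w := s * w) (by rwa [hD.exch.mul_cancel hs])
    rw [hD.exch.mul_cancel hs] at hT
    have hc : c ∈ low S φ (len S w) := by
      rw [← sub_add_cancel c (T S φ (s * w))]
      exact add_mem (low_mono (by omega) h3) (T_mem_low hsw)
    -- The factor T_s + e^{-φ(s)} is bar-invariant whatever the sign of φ(s), also when it is not
    -- C_s. The correction lemma does the rest.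
    have hb : (T S φ s + algebraMap _ _ (expo (-φ s))) * c - T S φ w ∈ low S φ (len S w) := by
      have e : (T S φ s + algebraMap _ _ (expo (-φ s))) * c - T S φ w =
          T S φ s * (c - T S φ (s * w)) + expo (-φ s) • c := by
        rw [add_mul, mul_sub, hT, Algebra.smul_def]
        abel
      rw [e]
      refine add_mem ?_ (Submodule.smul_mem _ _ hc)
      have := hD.T_simple_mul_mem_low hs h3
      exact low_mono (by omega) this
    refine hD.exists_correction w (fun y hy => ih _ hy y rfl) (len S w) _ ?_ hb fun y hy => ?_
    · rw [map_mul, h1, map_add, hD.bar_T_simple hs, hD.isBar_bar.1, neg_neg, qdiff, map_sub,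
        sub_sub_eq_add_sub, sub_add_cancel]
    · rw [hD.repr_eq_zero_of_mem_low hb hy]
      exact zero_mem _

theorem C_unique {w : W} {c c' : Hecke S φ} (h1 : bar S φ c = c) (h2 : c - T S φ w ∈ heckeNeg S φ)
    (h1' : bar S φ c' = c') (h2' : c' - T S φ w ∈ heckeNeg S φ) : c = c' := by
  have he : c - c' ∈ heckeNeg S φ := by
    have := sub_mem h2 h2'
    rwa [sub_sub_sub_cancel_right] at this
  -- Modulo 0, congruence is equality.
  have := hD.dvd_of_bar_sub_dvd 0 he fun w => by
    rw [map_sub (bar S φ), h1, h1', sub_self, map_zero]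
    exact dvd_zero _
  rw [← sub_eq_zero, ← hD.basis.repr.map_eq_zero_iff]
  ext1 w
  simpa using this w

theorem C_spec (w : W) : bar S φ (C S φ w) = C S φ w ∧ C S φ w - T S φ w ∈ heckeNeg S φ ∧
    C S φ w - T S φ w ∈ low S φ (len S w) := by
  obtain ⟨c, h1, h2, h3⟩ := hD.exists_C w
  have : C S φ w = c := theUnique_eq ⟨h1, h2⟩ fun c' hc' => hD.C_unique hc'.1 hc'.2 h1 h2
  rw [this]
  exact ⟨h1, h2, h3⟩

theorem bar_C (w : W) : bar S φ (C S φ w) = C S φ w := (hD.C_spec w).1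

theorem C_sub_mem (w : W) : C S φ w - T S φ w ∈ heckeNeg S φ := (hD.C_spec w).2.1

theorem repr_C {w y : W} (h : len S w ≤ len S y) :
    hD.basis.repr (C S φ w) y = hD.basis.repr (T S φ w) y := by
  have := hD.repr_eq_zero_of_mem_low (hD.C_spec w).2.2 h
  rwa [map_sub, Finsupp.sub_apply, sub_eq_zero] at this

theorem T_mem_span_C (w : W) : T S φ w ∈ Submodule.span (GrpAlg Γ) (Set.range (C S φ)) := by
  induction h : len S w using Nat.strong_induction_on generalizing w with
  | h n ih =>
    subst h
    have hle : low S φ (len S w) ≤ Submodule.span (GrpAlg Γ) (Set.range (C S φ)) := by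
      refine Submodule.span_le.2 ?_
      rintro _ ⟨y, hy, rfl⟩
      exact ih _ hy y rfl
    rw [← sub_sub_cancel (C S φ w) (T S φ w)]
    exact sub_mem (Submodule.subset_span ⟨w, rfl⟩) (hle (hD.C_spec w).2.2)

theorem exists_sum_C (h : Hecke S φ) : ∃ f : W →₀ GrpAlg Γ, (f.sum fun z a => a • C S φ z) = h := by
  have hh : h ∈ Submodule.span (GrpAlg Γ) (Set.range (C S φ)) := by
    have : h ∈ Submodule.span (GrpAlg Γ) (Set.range (T S φ)) := by
      rw [hD.span_range_T]
      trivial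
    refine Submodule.span_le.2 ?_ this
    rintro _ ⟨w, rfl⟩
    exact hD.T_mem_span_C w
  exact Finsupp.mem_span_range_iff_exists_finsupp.1 hh

/-- If a combination of the `C_z` vanishes modulo `m`, then so do its coefficients. -/
theorem dvd_of_sum_C_dvd (m : ℤ) (f : W →₀ GrpAlg Γ)
    (h : ∀ w, (m : GrpAlg Γ) ∣ hD.basis.repr (f.sum fun z a => a • C S φ z) w) (w : W) :
    (m : GrpAlg Γ) ∣ f w := by
  classical
  by_contra hw
  let X := f.support.filter fun y => ¬ (m : GrpAlg Γ) ∣ f y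
  have hX : ∀ y, y ∈ X ↔ ¬ (m : GrpAlg Γ) ∣ f y := by
    intro y
    simp only [X, Finset.mem_filter, Finsupp.mem_support_iff, and_iff_right_iff_imp]
    intro hy h0
    exact hy (h0 ▸ dvd_zero _)
  obtain ⟨y, hy, hmax⟩ := X.exists_max_image (len S) ⟨w, (hX w).2 hw⟩
  rw [hX] at hy
  refine hy ?_
  have e2 : f y = f.sum fun u a => a * hD.basis.repr (T S φ u) y := by
    rw [Finsupp.sum_eq_single y]
    · rw [hD.repr_T, Finsupp.single_eq_same, mul_one]
    · intro u _ hu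
      rw [hD.repr_T, Finsupp.single_eq_of_ne' hu, mul_zero]
    · simp
  have h1 : (m : GrpAlg Γ) ∣ hD.basis.repr (f.sum fun z a => a • C S φ z) y - f y := by
    conv_rhs => rw [e2]
    rw [Finsupp.sum, map_sum, Finsupp.finsetSum_apply, Finsupp.sum, ← Finset.sum_sub_distrib]
    refine Finset.dvd_sum fun u hu => ?_
    rw [map_smul, Finsupp.smul_apply, smul_eq_mul, ← mul_sub]
    by_cases hm : (m : GrpAlg Γ) ∣ f u
    · exact Dvd.dvd.mul_right hm _
    · rw [hD.repr_C (hmax u ((hX u).2 hm)), sub_self, mul_zero]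
      exact dvd_zero _
  have := dvd_sub (h y) h1
  rwa [sub_sub_cancel] at this

theorem C_mul_C (x y : W) :
    C S φ x * C S φ y = (hcoef S φ x y).sum fun z a => a • C S φ z := by
  obtain ⟨f, hf⟩ := hD.exists_sum_C (C S φ x * C S φ y)
  have : hcoef S φ x y = f := by
    refine theUnique_eq hf.symm fun g hg => ?_
    rw [← sub_eq_zero]
    ext1 w
    have := hD.dvd_of_sum_C_dvd 0 (g - f) (fun w => ?_) w
    · simpa using this
    · rw [Finsupp.sum_sub_index fun _ _ _ => sub_smul _ _ _, ← hg, hf, sub_self, map_zero]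
      exact dvd_zero _
  rw [this, hf]

end HeckeDatum

end KL

/-! ### Reduction modulo `p` to the fixed point datum -/

/-- For a `p`-group `G`, a `G`-invariant finite sum is congruent modulo `p` to its restriction to
the fixed points. -/
theorem dvd_sum_sub_sum_fixed {p : ℕ} [Fact p.Prime] {G : Type*} [Group G] [Finite G]
    (hG : IsPGroup p G) {X R : Type*} [MulAction G X] [CommRing R] (s : Finset X)
    [DecidablePred fun x : X => ∀ g : G, g • x = x] (hs : ∀ (g : G), ∀ x ∈ s, g • x ∈ s) (f : X → R)
    (hf : ∀ (g : G) (x : X), f (g • x) = f x) :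
    (p : R) ∣ ∑ x ∈ s, f x - ∑ x ∈ s.filter (fun x => ∀ g : G, g • x = x), f x := by
  classical
  rw [← Finset.sum_filter_add_sum_filter_not s (fun x => ∀ g : G, g • x = x), add_sub_cancel_left]
  -- The non-fixed points are grouped by orbits; f is constant on each, and their cardinalities are
  -- powers of p other than 1.
  rw [← Finset.sum_fiberwise_of_maps_to (t := (s.filter _).image fun x => MulAction.orbit G x)
    (g := fun x => MulAction.orbit G x) fun x hx => Finset.mem_image_of_mem _ hx]
  refine Finset.dvd_sum fun o ho => ?_
  obtain ⟨x, hx, rfl⟩ := Finset.mem_image.1 ho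
  obtain ⟨hxs, hxf⟩ := Finset.mem_filter.1 hx
  have hset : ∀ y, y ∈ ((s.filter fun x => ¬ ∀ g : G, g • x = x).filter
      fun y => MulAction.orbit G y = MulAction.orbit G x) ↔ y ∈ MulAction.orbit G x := by
    intro y
    rw [Finset.mem_filter, Finset.mem_filter, MulAction.orbit_eq_iff]
    refine ⟨fun h => h.2, fun h => ⟨?_, h⟩⟩
    obtain ⟨g, rfl⟩ := h
    refine ⟨hs g x hxs, fun h => hxf fun g' => ?_⟩
    have := h (g * g' * g⁻¹)
    simpa [mul_smul] using this
  rw [Finset.sum_congr rfl (g := fun _ => f x), Finset.sum_const, nsmul_eq_mul]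
  · refine Dvd.dvd.mul_right ?_ _
    have hcard : ((s.filter fun x => ¬ ∀ g : G, g • x = x).filter
      fun y => MulAction.orbit G y = MulAction.orbit G x).card = Nat.card (MulAction.orbit G x) := by
      rw [Nat.card_coe_set_eq, ← Set.ncard_coe_finset]
      congr 1
      ext y
      rw [Finset.mem_coe, hset]
    rw [hcard]
    have : Finite (MulAction.orbit G x) := Set.finite_range _
    obtain ⟨n, hn⟩ := hG.card_orbit x
    rw [hn]
    rcases Nat.eq_zero_or_pos n with rfl | hpos
    · exfalso
      rw [pow_zero, Nat.card_eq_one_iff_unique] at hn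
      have := hn.1
      apply hxf
      intro g
      exact congrArg Subtype.val
        (Subsingleton.elim (⟨g • x, g, rfl⟩ : MulAction.orbit G x) ⟨x, MulAction.mem_orbit_self x⟩)
    · exact_mod_cast Dvd.dvd.natCast (α := R) (dvd_pow_self p hpos.ne')
  · intro y hy
    obtain ⟨g, rfl⟩ := (hset y).1 hy
    exact hf g x

section Reduction

variable {p : ℕ} {G : Type*} [Group G] {W : Type*} [Group W] [MulDistribMulAction G W] {S : Set W}
  {Γ : Type*} [AddCommGroup Γ] [LinearOrder Γ] {φ : W → Γ}

/-- A weighted exchange system on which a `p`-group acts. -/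
structure FixedDatum (p : ℕ) (G : Type*) [Group G] {W : Type*} [Group W] [MulDistribMulAction G W]
    {Γ : Type*} [AddCommGroup Γ] [LinearOrder Γ] (S : Set W) (φ : W → Γ) : Prop where
  datum : HeckeDatum S φ
  fin : S.Finite
  smul_mem : ∀ (g : G), ∀ s ∈ S, g • s ∈ S
  weight_smul : ∀ (g : G) (w : W), φ (g • w) = φ w
  pgroup : IsPGroup p G

/-- Restriction of a finitely supported function to the fixed points. -/
def res (G : Type*) [Group G] {W : Type*} [Group W] [MulDistribMulAction G W] {R : Type*}
    [AddCommMonoid R] (c : W →₀ R) : FixedPoints.subgroup G W →₀ R :=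
  c.comapDomain Subtype.val Subtype.val_injective.injOn

theorem res_apply {R : Type*} [AddCommMonoid R] (c : W →₀ R) (v : FixedPoints.subgroup G W) :
    res G c v = c v := rfl

theorem dvd_sum_sub_sum_res [Fact p.Prime] [Finite G] (hG : IsPGroup p G) {B R : Type*}
    [AddCommMonoid B] [CommRing R] (c : W →₀ B) (hc : ∀ (g : G) (w : W), c (g • w) = c w)
    (f : W → B → R) (hf : ∀ (g : G) (w : W) (b : B), f (g • w) b = f w b) :
    (p : R) ∣ c.sum f - (res G c).sum fun v => f v := by
  classical
  have h := dvd_sum_sub_sum_fixed hG c.support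
    (fun g w hw => by rw [Finsupp.mem_support_iff] at hw ⊢; rwa [hc]) (fun w => f w (c w))
    fun g w => by rw [hf, hc]
  convert h using 2
  rw [Finsupp.sum]
  refine Finset.sum_bij (fun v _ => (v : W)) (fun v hv => ?_) (fun v _ v' _ h => Subtype.ext h)
    (fun w hw => ?_) (fun v _ => rfl)
  · rw [Finsupp.mem_support_iff, res_apply] at hv
    exact Finset.mem_filter.2 ⟨Finsupp.mem_support_iff.2 hv, v.2⟩
  · obtain ⟨h1, h2⟩ := Finset.mem_filter.1 hw
    exact ⟨⟨w, h2⟩, by rw [Finsupp.mem_support_iff] at h1 ⊢; exact h1, rfl⟩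

namespace HeckeDatum

variable (hD : HeckeDatum S φ)
include hD

omit hD in
theorem intCast_mul_eq_smul (m : ℤ) (x : Hecke S φ) : (m : Hecke S φ) * x = (m : GrpAlg Γ) • x := by
  rw [Algebra.smul_def, map_intCast]

theorem intCast_dvd_iff_repr {m : ℤ} {x : Hecke S φ} :
    (m : Hecke S φ) ∣ x ↔ ∀ w, (m : GrpAlg Γ) ∣ hD.basis.repr x w := by
  classical
  constructor
  · rintro ⟨y, rfl⟩ w
    exact ⟨hD.basis.repr y w, by rw [intCast_mul_eq_smul, map_smul]; rfl⟩
  · intro h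
    choose f hf using h
    refine ⟨hD.basis.repr.symm (Finsupp.onFinset (hD.basis.repr x).support
      -- Forcing 0 off the support of x keeps the quotient finitely supported even when m = 0.
      (fun w => if hD.basis.repr x w = 0 then 0 else f w) fun w hw => ?_), ?_⟩
    · rw [Finsupp.mem_support_iff]
      intro h0
      rw [if_pos h0] at hw
      exact hw rfl
    · apply hD.basis.repr.injective
      ext1 w
      rw [intCast_mul_eq_smul, map_smul, LinearEquiv.apply_symm_apply, Finsupp.smul_apply,
        Finsupp.onFinset_apply, smul_eq_mul]
      split_ifs with h0
      · rw [h0, mul_zero]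
      · exact hf w

omit hD in
theorem intCast_dvd_mul_left {m : ℤ} {x : Hecke S φ} (y : Hecke S φ) (h : (m : Hecke S φ) ∣ x) :
    (m : Hecke S φ) ∣ y * x := by
  obtain ⟨z, rfl⟩ := h
  exact ⟨y * z, by rw [← mul_assoc, ← mul_assoc, Int.cast_comm]⟩

/-- The `T_w` with `w` in a parabolic subgroup span a subalgebra. -/
theorem T_mul_mem_span_closure {I : Set W} (hI : I ⊆ S) {u : W} (hu : u ∈ Subgroup.closure I)
    {h : Hecke S φ}
    (hh : h ∈ Submodule.span (GrpAlg Γ) (T S φ '' (Subgroup.closure I : Set W))) :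
    T S φ u * h ∈ Submodule.span (GrpAlg Γ) (T S φ '' (Subgroup.closure I : Set W)) := by
  obtain ⟨l, h1, h2, rfl⟩ := hD.exch.exists_reduced_of_mem_closure hI hu
  clear hu
  induction l with
  | nil => rwa [List.prod_nil, T_one, one_mul]
  | cons r l ih =>
    have hr : r ∈ I := h2 r (by simp)
    have hl : ∀ r ∈ l, r ∈ I := fun r hr => h2 r (by simp [hr])
    have a1 := len_prod_le (S := S) (l := l) fun s hs => hI (hl s hs)
    rw [List.prod_cons, List.length_cons] at h1
    have a2 := hD.exch.len_mul_cases (hI hr) l.prod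
    rw [List.prod_cons, ← hD.T_simple_mul (hI hr) (by omega), mul_assoc]
    have ih' := ih hl (by omega)
    generalize T S φ l.prod * h = h' at ih' ⊢
    induction ih' using Submodule.span_induction with
    | mem x hx =>
      obtain ⟨y, hy, rfl⟩ := hx
      have hry : r * y ∈ Subgroup.closure I := mul_mem (Subgroup.subset_closure hr) hy
      rcases hD.exch.len_mul_cases (hI hr) y with h | h
      · rw [hD.T_simple_mul (hI hr) (by omega)]
        exact Submodule.subset_span ⟨_, hry, rfl⟩
      · rw [hD.T_simple_mul_of_descent (hI hr) (by omega)]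
        exact add_mem (Submodule.subset_span ⟨_, hry, rfl⟩)
          (Submodule.smul_mem _ _ (Submodule.subset_span ⟨_, hy, rfl⟩))
    | zero => rw [mul_zero]; exact zero_mem _
    | add x y _ _ hx hy => rw [mul_add]; exact add_mem hx hy
    | smul a x _ hx => rw [mul_smul_comm]; exact Submodule.smul_mem _ _ hx

theorem repr_T_mul_T_eq_zero {I : Set W} (hI : I ⊆ S) {u v w : W} (hu : u ∈ Subgroup.closure I)
    (hv : v ∈ Subgroup.closure I) (hw : w ∉ Subgroup.closure I) :
    hD.basis.repr (T S φ u * T S φ v) w = 0 := by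
  have h := hD.T_mul_mem_span_closure hI hu (Submodule.subset_span ⟨v, hv, rfl⟩)
  have e : T S φ '' (Subgroup.closure I : Set W) = hD.basis '' (Subgroup.closure I : Set W) := by
    congr 1
    funext w
    simp
  rw [e, Module.Basis.mem_span_image] at h
  by_contra hne
  exact hw (h (Finsupp.mem_support_iff.2 hne))

theorem indexRep_eq_sum (h : Hecke S φ) :
    hD.indexRep h = (hD.basis.repr h).sum fun w a => a * expo (φ w) := by
  conv_lhs => rw [← hD.sum_repr h]
  rw [map_finsuppSum]
  exact Finsupp.sum_congr fun w _ => by rw [map_smul, hD.indexRep_T, smul_eq_mul]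

end HeckeDatum

namespace FixedDatum

variable (F : FixedDatum p G S φ)
include F

theorem datumG : HeckeDatum (fixedSimple G S) (fixedWeight G φ) where
  exch := exchangeSystem_fixedSimple F.datum.exch F.smul_mem F.fin
  weight u v h := F.datum.weight u v (len_mul_fixed F.datum.exch F.smul_mem F.fin h)

/-- The action of `G` on the Hecke algebra. -/
def act (g : G) : Hecke S φ ≃ₐ[GrpAlg Γ] Hecke S φ :=
  (preserves_of_action F.smul_mem F.weight_smul g).equiv

theorem act_T (g : G) (w : W) : F.act g (T S φ w) = T S φ (g • w) :=
  (preserves_of_action F.smul_mem F.weight_smul g).equiv_T w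

theorem act_T_fixed (g : G) (v : FixedPoints.subgroup G W) :
    F.act g (T S φ v) = T S φ v := by
  rw [act_T, v.2 g]

theorem act_C (g : G) (w : W) : F.act g (C S φ w) = C S φ (g • w) :=
  ((preserves_of_action F.smul_mem F.weight_smul g).C_eq w).symm

theorem act_bar (g : G) (h : Hecke S φ) : F.act g (bar S φ h) = bar S φ (F.act g h) :=
  ((preserves_of_action F.smul_mem F.weight_smul g).bar_equiv h).symm

theorem repr_act (g : G) (h : Hecke S φ) (w : W) :
    F.datum.basis.repr (F.act g h) (g • w) = F.datum.basis.repr h w := by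
  have : (Finsupp.lapply (g • w) ∘ₗ F.datum.basis.repr.toLinearMap ∘ₗ (F.act g).toLinearMap) =
      Finsupp.lapply w ∘ₗ F.datum.basis.repr.toLinearMap := by
    refine F.datum.basis.ext fun u => ?_
    classical
    simp [F.act_T, F.datum.repr_T, Finsupp.single_apply]
  exact LinearMap.congr_fun this h

/-- Restriction of coordinates to the fixed points. -/
def rho : Hecke S φ →ₗ[GrpAlg Γ] Hecke (fixedSimple G S) (fixedWeight G φ) :=
  F.datumG.basis.repr.symm.toLinearMap ∘ₗ
    Finsupp.lcomapDomain Subtype.val Subtype.val_injective ∘ₗ F.datum.basis.repr.toLinearMap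

theorem repr_rho_eq (h : Hecke S φ) : F.datumG.basis.repr (F.rho h) = res G (F.datum.basis.repr h) :=
  F.datumG.basis.repr.apply_symm_apply _

theorem repr_rho (h : Hecke S φ) (v : FixedPoints.subgroup G W) :
    F.datumG.basis.repr (F.rho h) v = F.datum.basis.repr h v := by
  rw [repr_rho_eq, res_apply]

theorem rho_T (v : FixedPoints.subgroup G W) :
    F.rho (T S φ v) = T (fixedSimple G S) (fixedWeight G φ) v := by
  classical
  apply F.datumG.basis.repr.injective
  ext1 u
  rw [repr_rho, F.datum.repr_T, F.datumG.repr_T, Finsupp.single_apply, Finsupp.single_apply]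
  simp only [Subtype.ext_iff]

theorem rho_one : F.rho 1 = 1 := by
  have := F.rho_T 1
  rwa [Subgroup.coe_one, HeckeDatum.T_one, HeckeDatum.T_one] at this

variable [Fact p.Prime] [Finite G]

/-- Restriction of a `G`-invariant sum to the fixed points, modulo `p`. -/
theorem dvd_rho_sum_sub (c : W →₀ GrpAlg Γ) (hc : ∀ (g : G) (w : W), c (g • w) = c w)
    (k : GrpAlg Γ →+* GrpAlg Γ) (L : W → Hecke S φ) (hL : ∀ (g : G) (w : W), F.act g (L w) = L (g • w))
    (L' : FixedPoints.subgroup G W → Hecke (fixedSimple G S) (fixedWeight G φ))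
    (hLL' : ∀ v : FixedPoints.subgroup G W, c v ≠ 0 →
      ((p : ℤ) : Hecke (fixedSimple G S) (fixedWeight G φ)) ∣ F.rho (L v) - L' v) :
    ((p : ℤ) : Hecke (fixedSimple G S) (fixedWeight G φ)) ∣
      F.rho (c.sum fun w a => k a • L w) - (res G c).sum fun v a => k a • L' v := by
  -- The map k is the identity for products and `barA` for the bar involution. Terms at non-fixed w
  -- cancel modulo p by orbits; afterwards `rho (L v)` is replaced by `L' v`.
  have h1 : ((p : ℤ) : Hecke (fixedSimple G S) (fixedWeight G φ)) ∣
      F.rho (c.sum fun w a => k a • L w) - (res G c).sum fun v a => k a • F.rho (L v) := by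
    rw [F.datumG.intCast_dvd_iff_repr]
    intro u
    have h := dvd_sum_sub_sum_res F.pgroup c hc (fun w a => k a * F.datum.basis.repr (L w) u)
      fun g w b => by
        rw [← hL, ← F.repr_act g (L w) u, u.2 g]
    rw [Int.cast_natCast]
    convert h using 1
    rw [map_sub, Finsupp.sub_apply, repr_rho]
    simp only [Finsupp.sum, map_sum, Finsupp.finsetSum_apply, map_smul, Finsupp.smul_apply,
      smul_eq_mul, repr_rho]
  have h2 : ((p : ℤ) : Hecke (fixedSimple G S) (fixedWeight G φ)) ∣
      ((res G c).sum fun v a => k a • F.rho (L v)) - (res G c).sum fun v a => k a • L' v := by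
    rw [Finsupp.sum, Finsupp.sum, ← Finset.sum_sub_distrib]
    refine Finset.dvd_sum fun v hv => ?_
    rw [← smul_sub, Algebra.smul_def]
    exact HeckeDatum.intCast_dvd_mul_left _ (hLL' v (by rwa [Finsupp.mem_support_iff, res_apply] at hv))
  have := dvd_add h1 h2
  rwa [sub_add_sub_cancel] at this

omit [Fact p.Prime] [Finite G] in
theorem repr_smul {h : Hecke S φ} (hh : ∀ g, F.act g h = h) (g : G) (w : W) :
    F.datum.basis.repr h (g • w) = F.datum.basis.repr h w := by
  conv_lhs => rw [← hh g]
  rw [repr_act]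

/-- Passage from the T_v with v fixed to all invariant y: the terms of y at non-fixed w contribute
nothing modulo p. -/
theorem dvd_rho_T_mul (u : FixedPoints.subgroup G W)
    (hu : ∀ v : FixedPoints.subgroup G W,
      ((p : ℤ) : Hecke (fixedSimple G S) (fixedWeight G φ)) ∣ F.rho (T S φ u * T S φ v) -
        T (fixedSimple G S) (fixedWeight G φ) u * T (fixedSimple G S) (fixedWeight G φ) v)
    {y : Hecke S φ} (hy : ∀ g, F.act g y = y) :
    ((p : ℤ) : Hecke (fixedSimple G S) (fixedWeight G φ)) ∣ F.rho (T S φ u * y) -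
        T (fixedSimple G S) (fixedWeight G φ) u * F.rho y := by
  have := F.dvd_rho_sum_sub (F.datum.basis.repr y) (F.repr_smul hy) (RingHom.id _)
    (fun w => T S φ u * T S φ w) (fun g w => by rw [map_mul, act_T_fixed, act_T])
    (fun v => T (fixedSimple G S) (fixedWeight G φ) u * T (fixedSimple G S) (fixedWeight G φ) v)
    fun v _ => hu v
  rw [← F.repr_rho_eq] at this
  simp only [RingHom.id_apply, ← mul_smul_comm] at this
  rw [Finsupp.sum, ← Finset.mul_sum, Finsupp.sum, ← Finset.mul_sum] at this
  have e1 := F.datum.sum_repr y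
  have e2 := F.datumG.sum_repr (F.rho y)
  rw [Finsupp.sum] at e1 e2
  rwa [e1, e2] at this

/-- T_x² is supported in W_ω, whose only fixed points are 1 and x. The coefficient at 1 is τ(T_x²) =
1. The index representation, restricted to fixed points modulo p, gives e^{2φ(x)} ≡ 1 + c e^{φ(x)},
which determines c. -/
theorem rho_T_sq {x : FixedPoints.subgroup G W} (hx : x ∈ fixedSimple G S) :
    ∃ c : GrpAlg Γ, F.rho (T S φ x * T S φ x) = 1 + c • T (fixedSimple G S) (fixedWeight G φ) x ∧
      ((p : ℤ) : GrpAlg Γ) ∣ c - qdiff (fixedWeight G φ) x := by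
  classical
  have hxx : (x : W) * x = 1 := congrArg Subtype.val (F.datumG.exch.sq x hx)
  have hx1 : x ≠ 1 := by
    rintro rfl
    have := F.datumG.exch.len_simple hx
    rw [F.datumG.exch.len_one] at this
    omega
  obtain ⟨s, hs, -, hl⟩ := mem_fixedSimple.1 hx
  have hI := orbit_subset F.smul_mem hs
  have hrepr : res G (F.datum.basis.repr (T S φ (x : W) * T S φ x)) =
      Finsupp.single 1 1 + Finsupp.single x (F.datum.basis.repr (T S φ (x : W) * T S φ x) x) := by
    ext1 v
    rw [res_apply, Finsupp.add_apply]
    by_cases h1 : v = 1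
    · subst h1
      rw [Finsupp.single_eq_same, Finsupp.single_eq_of_ne hx1.symm, add_zero, Subgroup.coe_one,
        ← F.datum.tau_apply, F.datum.tau_T_mul_T, if_pos hxx]
    · by_cases h2 : v = x
      · subst h2
        rw [Finsupp.single_eq_same, Finsupp.single_eq_of_ne h1, zero_add]
      · rw [Finsupp.single_eq_of_ne h1, Finsupp.single_eq_of_ne h2, add_zero]
        refine F.datum.repr_T_mul_T_eq_zero hI hl.mem hl.mem fun hv => h2 (Subtype.ext ?_)
        exact hl.eq F.datum.exch hI (isLongest_of_fixed F.datum.exch F.smul_mem hs v.2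
          (fun h => h1 (Subtype.ext h)) hv)
  refine ⟨F.datum.basis.repr (T S φ (x : W) * T S φ x) x, ?_, ?_⟩
  · apply F.datumG.basis.repr.injective
    rw [repr_rho_eq, hrepr, map_add, map_smul, F.datumG.repr_T, ← HeckeDatum.T_one,
      F.datumG.repr_T, Finsupp.smul_single, smul_eq_mul, mul_one]
  · have h := dvd_sum_sub_sum_res F.pgroup (F.datum.basis.repr (T S φ (x : W) * T S φ x))
      (F.repr_smul fun g => by rw [map_mul, act_T_fixed]) (fun w a => a * expo (φ w))
      fun g w b => by rw [F.weight_smul]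
    have e : ((F.datum.basis.repr (T S φ (x : W) * T S φ x)).sum fun w a => a * expo (φ w)) =
        expo (φ x) * expo (φ x) := by
      rw [← F.datum.indexRep_T, ← map_mul, F.datum.indexRep_eq_sum]
    rw [e, hrepr, Finsupp.sum_add_index' (fun _ => zero_mul _) fun _ _ _ => add_mul _ _ _,
      Finsupp.sum_single_index (zero_mul _), Finsupp.sum_single_index (zero_mul _),
      Subgroup.coe_one, F.datum.weight_one, expo_zero, mul_one] at h
    -- Dividing by the unit -e^{φ(x)} isolates c.
    have h' := h.mul_right (-expo (-φ x))
    rw [Int.cast_natCast]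
    convert h' using 1
    have e1 := expo_mul_expo_neg (φ (x : W))
    change _ - (expo (φ (x : W)) - expo (-φ (x : W))) = _
    linear_combination (expo (φ (x : W)) - F.datum.basis.repr (T S φ (x : W) * T S φ x) x) * e1

end FixedDatum

end Reduction

/-! ### Multiplicativity of `rho` modulo p and its effect on the Kazhdan-Lusztig basis. -/

section Reduction

variable {p : ℕ} {G : Type*} [Group G] {W : Type*} [Group W] [MulDistribMulAction G W] {S : Set W}
  {Γ : Type*} [AddCommGroup Γ] [LinearOrder Γ] {φ : W → Γ}

namespace FixedDatum

variable (F : FixedDatum p G S φ) [Fact p.Prime] [Finite G]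
include F

omit [Fact p.Prime] [Finite G] in
theorem T_mul_T_fixed {u v : FixedPoints.subgroup G W}
    (h : len (fixedSimple G S) (u * v) = len (fixedSimple G S) u + len (fixedSimple G S) v) :
    T S φ u * T S φ v = T S φ ((u * v : FixedPoints.subgroup G W) : W) :=
  HeckeDatum.T_mul (len_mul_fixed F.datum.exch F.smul_mem F.fin h)

/-- In the descent case v = xv' and T_x T_v = T_x² T_{v'}. Expanding T_x², the terms T_w T_{v'} with
w not fixed are permuted by G and disappear modulo p; those at w = 1 and w = x are given by
`rho_T_sq`. -/
theorem dvd_rho_T_mul_T_simple {x : FixedPoints.subgroup G W} (hx : x ∈ fixedSimple G S)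
    (v : FixedPoints.subgroup G W) :
    ((p : ℤ) : Hecke (fixedSimple G S) (fixedWeight G φ)) ∣ F.rho (T S φ x * T S φ v) -
      T (fixedSimple G S) (fixedWeight G φ) x * T (fixedSimple G S) (fixedWeight G φ) v := by
  have hE := F.datumG.exch
  have hx1 := hE.len_simple hx
  rcases hE.len_mul_cases hx v with h | h
  · rw [F.T_mul_T_fixed (by omega), rho_T, HeckeDatum.T_mul (by omega), sub_self]
    exact dvd_zero _
  · obtain ⟨c, hc1, hc2⟩ := F.rho_T_sq hx
    have hsum : ∀ f : FixedPoints.subgroup G W → Hecke (fixedSimple G S) (fixedWeight G φ),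
        ((Finsupp.single 1 1 + Finsupp.single x c).sum fun v a => a • f v) = f 1 + c • f x := by
      intro f
      rw [Finsupp.sum_add_index' (fun v => zero_smul _ (f v)) fun v a b => add_smul a b (f v),
        Finsupp.sum_single_index (zero_smul _ (f 1)), Finsupp.sum_single_index (zero_smul _ (f x)),
        one_smul]
    have hcan := hE.mul_cancel hx v
    generalize x * v = v' at h hcan
    subst hcan
    have hT : T S φ (x : W) * T S φ ((x * v' : FixedPoints.subgroup G W) : W) =
        (T S φ (x : W) * T S φ x) * T S φ v' := by
      rw [← F.T_mul_T_fixed (by omega), mul_assoc]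
    have hTG : T (fixedSimple G S) (fixedWeight G φ) x *
        T (fixedSimple G S) (fixedWeight G φ) (x * v') =
        (1 + qdiff (fixedWeight G φ) x • T (fixedSimple G S) (fixedWeight G φ) x) *
          T (fixedSimple G S) (fixedWeight G φ) v' := by
      rw [← HeckeDatum.T_mul (by omega), ← mul_assoc, HeckeDatum.T_sq hx]
    rw [hT, hTG]
    have h1 := F.dvd_rho_sum_sub (F.datum.basis.repr (T S φ (x : W) * T S φ x))
      (F.repr_smul fun g => by rw [map_mul, act_T_fixed]) (RingHom.id _)
      (fun w => T S φ w * T S φ v') (fun g w => by rw [map_mul, act_T_fixed, act_T])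
      (fun v => F.rho (T S φ v * T S φ v')) fun v _ => by rw [sub_self]; exact dvd_zero _
    simp only [RingHom.id_apply, ← smul_mul_assoc] at h1
    rw [Finsupp.sum, ← Finset.sum_mul] at h1
    have e1 := F.datum.sum_repr (T S φ (x : W) * T S φ x)
    rw [Finsupp.sum] at e1
    rw [e1, ← F.repr_rho_eq, hc1, map_add, map_smul, F.datumG.repr_T, ← HeckeDatum.T_one,
      F.datumG.repr_T, Finsupp.smul_single, smul_eq_mul, mul_one,
      hsum, Subgroup.coe_one, HeckeDatum.T_one, one_mul, rho_T,
      F.T_mul_T_fixed (u := x) (v := v') (by omega),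
      rho_T] at h1
    rw [add_mul, one_mul, smul_mul_assoc, HeckeDatum.T_mul (w := x) (w' := v') (by omega)]
    have h2 : ((p : ℤ) : Hecke (fixedSimple G S) (fixedWeight G φ)) ∣
        (c - qdiff (fixedWeight G φ) x) • T (fixedSimple G S) (fixedWeight G φ) (x * v') := by
      obtain ⟨d, hd⟩ := hc2
      rw [hd, mul_smul]
      exact ⟨_, (HeckeDatum.intCast_mul_eq_smul _ _).symm⟩
    have := dvd_add h1 h2
    rw [sub_smul] at this
    convert this using 1
    abel

theorem dvd_rho_T_mul_T (u v : FixedPoints.subgroup G W) :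
    ((p : ℤ) : Hecke (fixedSimple G S) (fixedWeight G φ)) ∣ F.rho (T S φ u * T S φ v) -
      T (fixedSimple G S) (fixedWeight G φ) u * T (fixedSimple G S) (fixedWeight G φ) v := by
  have hE := F.datumG.exch
  induction u using hE.induction_left with
  | one => rw [Subgroup.coe_one, HeckeDatum.T_one, HeckeDatum.T_one, one_mul, one_mul, rho_T,
      sub_self]; exact dvd_zero _
  | mul x hx u hu ih =>
    have hx1 := hE.len_simple hx
    rw [← F.T_mul_T_fixed (by omega), ← HeckeDatum.T_mul (by omega), mul_assoc, mul_assoc]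
    have h1 := F.dvd_rho_T_mul x (F.dvd_rho_T_mul_T_simple hx)
      (y := T S φ u * T S φ v) fun g => by rw [map_mul, act_T_fixed, act_T_fixed]
    have h2 := HeckeDatum.intCast_dvd_mul_left (T (fixedSimple G S) (fixedWeight G φ) x) ih
    rw [mul_sub] at h2
    have := dvd_add h1 h2
    rwa [sub_add_sub_cancel] at this

/-- Modulo `p`, restriction to the fixed points is multiplicative on `G`-invariants. -/
theorem dvd_rho_mul {x y : Hecke S φ} (hx : ∀ g, F.act g x = x) (hy : ∀ g, F.act g y = y) :
    ((p : ℤ) : Hecke (fixedSimple G S) (fixedWeight G φ)) ∣ F.rho (x * y) - F.rho x * F.rho y := by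
  have := F.dvd_rho_sum_sub (F.datum.basis.repr x) (F.repr_smul hx) (RingHom.id _)
    (fun w => T S φ w * y) (fun g w => by rw [map_mul, hy, act_T])
    (fun v => T (fixedSimple G S) (fixedWeight G φ) v * F.rho y)
    fun v _ => F.dvd_rho_T_mul v (F.dvd_rho_T_mul_T v) hy
  rw [← F.repr_rho_eq] at this
  simp only [RingHom.id_apply, ← smul_mul_assoc] at this
  rw [Finsupp.sum, ← Finset.sum_mul, Finsupp.sum, ← Finset.sum_mul] at this
  have e1 := F.datum.sum_repr x
  have e2 := F.datumG.sum_repr (F.rho x)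
  rw [Finsupp.sum] at e1 e2
  rwa [e1, e2] at this

/-- As `rho` is multiplicative modulo p, it carries the inverse of T_{u⁻¹} to an inverse modulo p.
-/
theorem dvd_rho_bar_T (u : FixedPoints.subgroup G W) :
    ((p : ℤ) : Hecke (fixedSimple G S) (fixedWeight G φ)) ∣ F.rho (bar S φ (T S φ u)) -
      bar (fixedSimple G S) (fixedWeight G φ) (T (fixedSimple G S) (fixedWeight G φ) u) := by
  have h1 := F.dvd_rho_mul (x := bar S φ (T S φ u)) (y := T S φ ((u⁻¹ : FixedPoints.subgroup G W) : W))
    (fun g => by rw [act_bar, act_T_fixed]) (fun g => by rw [act_T_fixed])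
  rw [rho_T, Subgroup.coe_inv, (F.datum.isBar_bar.2 u).1, rho_one] at h1
  have h2 := h1.mul_right (-bar (fixedSimple G S) (fixedWeight G φ) (T _ _ u))
  rw [sub_mul, mul_assoc, mul_neg, mul_neg, mul_neg, (F.datumG.isBar_bar.2 u).2, one_mul, mul_one,
    sub_neg_eq_add, neg_add_eq_sub] at h2
  exact h2

theorem dvd_rho_bar {x : Hecke S φ} (hx : ∀ g, F.act g x = x) :
    ((p : ℤ) : Hecke (fixedSimple G S) (fixedWeight G φ)) ∣ F.rho (bar S φ x) -
      bar (fixedSimple G S) (fixedWeight G φ) (F.rho x) := by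
  have := F.dvd_rho_sum_sub (F.datum.basis.repr x) (F.repr_smul hx) barA
    (fun w => bar S φ (T S φ w)) (fun g w => by rw [act_bar, act_T])
    (fun v => bar (fixedSimple G S) (fixedWeight G φ) (T (fixedSimple G S) (fixedWeight G φ) v))
    fun v _ => F.dvd_rho_bar_T v
  rw [← F.repr_rho_eq] at this
  simp only [← F.datum.bar_smul, ← F.datumG.bar_smul] at this
  rw [← map_finsuppSum, ← map_finsuppSum] at this
  rwa [F.datum.sum_repr, F.datumG.sum_repr] at this

variable [IsOrderedAddMonoid Γ]

/-- Modulo `p`, the Kazhdan-Lusztig elements of fixed points restrict to those of the fixed point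
system. -/
theorem dvd_rho_C (w : FixedPoints.subgroup G W) :
    ((p : ℤ) : Hecke (fixedSimple G S) (fixedWeight G φ)) ∣
      F.rho (C S φ w) - C (fixedSimple G S) (fixedWeight G φ) w := by
  rw [F.datumG.intCast_dvd_iff_repr]
  refine F.datumG.dvd_of_bar_sub_dvd p ?_ ?_
  · rw [← sub_sub_sub_cancel_right _ _ (T (fixedSimple G S) (fixedWeight G φ) w)]
    refine sub_mem ?_ (F.datumG.C_sub_mem w)
    rw [← F.rho_T, ← map_sub, F.datumG.mem_heckeNeg]
    intro v
    rw [repr_rho]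
    exact F.datum.mem_heckeNeg.1 (F.datum.C_sub_mem w) v
  -- Only the bar-invariance of `rho (C_w)` modulo p remains, and C_w is itself bar-invariant and
  -- fixed by G.
  · rw [← F.datumG.intCast_dvd_iff_repr, map_sub, F.datumG.bar_C, sub_sub_sub_cancel_right]
    have := F.dvd_rho_bar (x := C S φ w) fun g => by rw [act_C, w.2 g]
    rw [F.datum.bar_C] at this
    rw [← neg_sub]
    exact this.neg_right

theorem dvd_tau_C (w : FixedPoints.subgroup G W) :
    ((p : ℤ) : GrpAlg Γ) ∣ tau S φ (C S φ w) -
      tau (fixedSimple G S) (fixedWeight G φ) (C (fixedSimple G S) (fixedWeight G φ) w) := by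
  have := F.datumG.intCast_dvd_iff_repr.1 (F.dvd_rho_C w) 1
  rwa [map_sub, Finsupp.sub_apply, repr_rho, Subgroup.coe_one, ← F.datum.tau_apply,
    ← F.datumG.tau_apply] at this

theorem dvd_hcoef (x y z : FixedPoints.subgroup G W) :
    ((p : ℤ) : GrpAlg Γ) ∣ hcoef S φ x y z - hcoef (fixedSimple G S) (fixedWeight G φ) x y z := by
  have hC : ∀ (w : FixedPoints.subgroup G W) (g : G), F.act g (C S φ w) = C S φ w :=
    fun w g => by rw [act_C, w.2 g]
  have h1 := F.dvd_rho_sum_sub (hcoef S φ x y)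
    (fun g w => by
      have := (preserves_of_action F.smul_mem F.weight_smul g).hcoef_eq x y w
      change hcoef S φ (g • (x : W)) (g • (y : W)) (g • w) = _ at this
      rwa [x.2 g, y.2 g] at this)
    (RingHom.id _) (C S φ) (fun g w => F.act_C g w) (C (fixedSimple G S) (fixedWeight G φ))
    fun v _ => F.dvd_rho_C v
  simp only [RingHom.id_apply] at h1
  rw [← F.datum.C_mul_C] at h1
  have h2 := F.dvd_rho_mul (hC x) (hC y)
  have h3 := (F.dvd_rho_C x).mul_right (F.rho (C S φ y))
  have h4 := HeckeDatum.intCast_dvd_mul_left (C (fixedSimple G S) (fixedWeight G φ) x) (F.dvd_rho_C y)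
  rw [sub_mul] at h3
  rw [mul_sub, F.datumG.C_mul_C] at h4
  -- Telescoping compares the two expansions of the product in the C-basis of H_G; triangularity of
  -- that basis yields the congruence of each coefficient.
  have h5 := dvd_sub (dvd_add (dvd_add h2 h3) h4) h1
  have h6 := F.datumG.dvd_of_sum_C_dvd p
    (res G (hcoef S φ x y) - hcoef (fixedSimple G S) (fixedWeight G φ) x y) (fun w => ?_) z
  · exact h6
  · refine F.datumG.intCast_dvd_iff_repr.1 ?_ w
    rw [Finsupp.sum_sub_index fun _ _ _ => sub_smul _ _ _]
    convert h5 using 1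
    abel

end FixedDatum

end Reduction

/-! ### Comparison of the functions `a` and of the integers `γ` -/

section Degrees

theorem isGreatest_of_maxDegree_eq {Γ : Type*} [LinearOrder Γ] {X : Set (WithBot Γ)} {g : Γ}
    (h : maxDegree X = (g : WithTop Γ)) : IsGreatest X (g : WithBot Γ) := by
  unfold maxDegree at h
  split_ifs at h with h'
  · rw [← WithTop.coe_injective h]
    exact h'.choose_spec
  · exact absurd h WithTop.top_ne_coe

theorem le_deg {Γ : Type*} [LinearOrder Γ] {a : GrpAlg Γ} {g : Γ} (h : a.coeff g ≠ 0) :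
    (g : WithBot Γ) ≤ deg a :=
  Finset.le_max (Finsupp.mem_support_iff.2 h)

variable {W : Type*} [Group W] {S : Set W} {Γ : Type*} [AddCommGroup Γ] [LinearOrder Γ] {φ : W → Γ}

theorem gam_of_aFun_eq {x y z : W} {g : Γ} (h : aFun S φ z⁻¹ = (g : WithTop Γ)) :
    gam S φ x y z = (hcoef S φ x y z⁻¹).coeff g := by
  unfold gam
  rw [h]
  rfl

theorem exists_aFun_eq_of_gam_ne_zero {x y z : W} (h : gam S φ x y z ≠ 0) :
    ∃ g : Γ, aFun S φ z⁻¹ = (g : WithTop Γ) := by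
  unfold gam at h
  induction h' : aFun S φ z⁻¹ using WithTop.recTopCoe with
  | top => rw [h'] at h; exact absurd rfl h
  | coe g => exact ⟨g, rfl⟩

/-- The convention that a = +∞ when the maximum does not exist makes this bound unconditional. -/
theorem le_aFun_of_coeff_ne_zero {x y z : W} {g : Γ} (h : (hcoef S φ x y z).coeff g ≠ 0) :
    (g : WithTop Γ) ≤ aFun S φ z := by
  induction h' : aFun S φ z using WithTop.recTopCoe with
  | top => exact le_top
  | coe g' =>
    have := (isGreatest_of_maxDegree_eq h').2 ⟨x, trivial, y, trivial, rfl⟩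
    exact WithTop.coe_le_coe.2 (WithBot.coe_le_coe.1 ((le_deg h).trans this))

theorem coeff_tau_C_of_Delta_eq {w : W} {g : Γ} (h : Delta S φ w = (g : WithTop Γ)) :
    (tau S φ (C S φ w)).coeff (-g) = ncoef S φ w := by
  unfold Delta at h
  unfold ncoef
  generalize deg (tau S φ (C S φ w)) = δ at h ⊢
  induction δ using WithBot.recBotCoe with
  | bot => exact absurd h WithTop.top_ne_coe
  | coe g' =>
    have : -g' = g := WithTop.coe_injective h
    rw [← this, neg_neg]
    rfl

theorem Delta_le_of_coeff_ne_zero [IsOrderedAddMonoid Γ] {w : W} {g : Γ}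
    (h : (tau S φ (C S φ w)).coeff (-g) ≠ 0) : Delta S φ w ≤ (g : WithTop Γ) := by
  have h' := le_deg h
  unfold Delta
  generalize deg (tau S φ (C S φ w)) = δ at h' ⊢
  induction δ using WithBot.recBotCoe with
  | bot => exact absurd h' (by simp)
  | coe g' =>
    have := WithBot.coe_le_coe.1 h'
    exact WithTop.coe_le_coe.2 (neg_le.1 this)

theorem leL.leLR {x y : W} (h : leL S φ x y) : leLR S φ x y := 
  Relation.ReflTransGen.mono (fun _ _ h => Or.inl h) _ _ h

theorem LusztigConjectures.aFun_eq_of_simL (hP : LusztigConjectures S φ) {x y : W}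
    (h : simL S φ x y) : aFun S φ x = aFun S φ y :=
  le_antisymm (hP.P4 _ _ (leL.leLR h.2)) (hP.P4 _ _ (leL.leLR h.1))

end Degrees

/-! ### Agreement of the functions a, and congruence of the γ, on W^G. -/

section Comparison

variable {p : ℕ} {G : Type*} [Group G] {W : Type*} [Group W] [MulDistribMulAction G W] {S : Set W}
  {Γ : Type*} [AddCommGroup Γ] [LinearOrder Γ] {φ : W → Γ}

namespace FixedDatum

variable (F : FixedDatum p G S φ)
include F

theorem Delta_smul (g : G) (w : W) : Delta S φ (g • w) = Delta S φ w := by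
  unfold Delta
  rw [← F.act_C, F.datum.tau_apply, F.datum.tau_apply, ← F.repr_act g (C S φ w) 1, smul_one]

theorem smul_mem_DSet (g : G) {d : W} (hd : d ∈ DSet S φ) : g • d ∈ DSet S φ := by
  change aFun S φ (g • d) = Delta S φ (g • d)
  rw [F.Delta_smul]
  exact ((preserves_of_action F.smul_mem F.weight_smul g).aFun_eq d).trans hd

variable [Fact p.Prime] [Finite G] [IsOrderedAddMonoid Γ]

theorem intCast_dvd_coeff_hcoef (x y z : FixedPoints.subgroup G W) (g : Γ) :
    (p : ℤ) ∣ (hcoef S φ x y z).coeff g -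
      (hcoef (fixedSimple G S) (fixedWeight G φ) x y z).coeff g := by
  simpa using intCast_dvd_iff.1 (F.dvd_hcoef x y z) g

omit F [Finite G] [IsOrderedAddMonoid Γ] in
theorem ne_zero_of_dvd_sub {m n : ℤ} (hm : m = 1 ∨ m = -1) (h : (p : ℤ) ∣ m - n) : n ≠ 0 := by
  rintro rfl
  rw [sub_zero] at h
  have hp := (Nat.prime_iff_prime_int.1 (Fact.out : p.Prime)).not_isUnit
  refine hp (isUnit_of_dvd_unit h ?_)
  rcases hm with rfl | rfl
  · exact isUnit_one
  · exact isUnit_one.neg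

/-- Let d be the element attached to y by P3 for W, and g = a(d) = Δ(d). By P5 both γ_{y⁻¹,y,d} and
n_d are ±1, hence non-zero modulo p. So in W^G the exponent g still occurs in h_{y⁻¹,y,d} and -g
still occurs in τ(C_d), which gives g ≤ a_G(d) ≤ Δ_G(d) ≤ g, the middle inequality being P1. Both
functions a are constant on left cells, so the equality passes from d to y. -/
theorem exists_aFun_eq (hP : LusztigConjectures S φ)
    (hPG : LusztigConjectures (fixedSimple G S) (fixedWeight G φ)) (y : FixedPoints.subgroup G W) :
    ∃ g : Γ, aFun S φ (y : W) = (g : WithTop Γ) ∧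
      aFun (fixedSimple G S) (fixedWeight G φ) y = (g : WithTop Γ) := by
  obtain ⟨d, ⟨hd, hγ⟩, hu⟩ := hP.P3 (y : W)
  -- The element σ(d) has the property that characterizes d, because y is fixed.
  have hdfix : ∀ σ : G, σ • d = d := by
    intro σ
    refine hu _ ⟨F.smul_mem_DSet σ hd, ?_⟩
    have h := (preserves_of_action F.smul_mem F.weight_smul σ).gam_eq (y : W)⁻¹ y d
    change gam S φ (σ • (y : W)⁻¹) (σ • (y : W)) (σ • d) = _ at h
    rw [smul_inv', y.2 σ] at h
    rwa [h]
  lift d to FixedPoints.subgroup G W using hdfix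
  -- By P6, d is its own inverse, so the index z⁻¹ in the definition of γ_{x,y,z} is d itself.
  have hdd : d⁻¹ = d := by
    have := hP.P6 _ hd
    rw [pow_two] at this
    exact Subtype.ext (inv_eq_of_mul_eq_one_left this)
  have hdd' : (d : W)⁻¹ = d := congrArg Subtype.val hdd
  obtain ⟨h5, h5'⟩ := hP.P5 _ hd _ hγ
  obtain ⟨g, hg⟩ := exists_aFun_eq_of_gam_ne_zero hγ
  have hcoe := h5
  rw [gam_of_aFun_eq hg, hdd'] at hcoe
  rw [hdd'] at hg
  have hG0 : (hcoef (fixedSimple G S) (fixedWeight G φ) y⁻¹ y d).coeff g ≠ 0 := by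
    refine ne_zero_of_dvd_sub (p := p) h5' ?_
    rw [← hcoe]
    exact F.intCast_dvd_coeff_hcoef y⁻¹ y d g
  have hΔ : Delta S φ (d : W) = (g : WithTop Γ) := Eq.trans (Eq.symm hd) hg
  have hΔG : Delta (fixedSimple G S) (fixedWeight G φ) d ≤ (g : WithTop Γ) := by
    refine Delta_le_of_coeff_ne_zero (ne_zero_of_dvd_sub (p := p) h5' ?_)
    rw [← coeff_tau_C_of_Delta_eq hΔ]
    simpa using intCast_dvd_iff.1 (F.dvd_tau_C d) (-g)
  have haG : aFun (fixedSimple G S) (fixedWeight G φ) d = (g : WithTop Γ) :=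
    le_antisymm ((hPG.P1 d).trans hΔG) (le_aFun_of_coeff_ne_zero hG0)
  have hγG : gam (fixedSimple G S) (fixedWeight G φ) y⁻¹ y d ≠ 0 := by
    rwa [gam_of_aFun_eq (g := g) (by rwa [hdd]), hdd]
  -- P8 puts y and d⁻¹ = d in the same left cell, in W and in W^G alike; P4 makes a constant there.
  have h8 := (hP.P8 _ _ _ hγ).2.1
  have h8G := (hPG.P8 _ _ _ hγG).2.1
  rw [hdd'] at h8
  rw [hdd] at h8G
  exact ⟨g, by rw [hP.aFun_eq_of_simL h8, hg], by rw [hPG.aFun_eq_of_simL h8G, haG]⟩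

/-- For fixed points, the integers `γ_{x,y,z}` of the two systems are congruent modulo `p`. -/
theorem dvd_gam_sub (hP : LusztigConjectures S φ)
    (hPG : LusztigConjectures (fixedSimple G S) (fixedWeight G φ))
    (x y z : FixedPoints.subgroup G W) :
    (p : ℤ) ∣ gam S φ x y z - gam (fixedSimple G S) (fixedWeight G φ) x y z := by
  obtain ⟨g, h1, h2⟩ := F.exists_aFun_eq hP hPG z⁻¹
  rw [gam_of_aFun_eq h1, gam_of_aFun_eq h2]
  exact F.intCast_dvd_coeff_hcoef x y z⁻¹ g

end FixedDatum

end Comparison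

/-! ### The Brauer quotient of the asymptotic ring -/

section Traces

variable {p : ℕ} [Fact p.Prime] {G : Type*} [Group G] [Finite G] {W : Type*} [Group W]
  [MulDistribMulAction G W] {S : Set W} {Γ : Type*} [AddCommGroup Γ] [LinearOrder Γ] {φ : W → Γ}

/-- The coordinates of an element of `J`. -/
def asympEquiv {W Γ : Type*} (S : Set W) (φ : W → Γ) : AsympRing S φ ≃+ (W →₀ ℤ) := AddEquiv.refl _

theorem asympEquiv_t (w : W) : asympEquiv S φ (t S φ w) = Finsupp.single w 1 := rfl

omit [Finite G] in
theorem asympEquiv_smul (g : G) (f : AsympRing S φ) (w : W) :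
    asympEquiv S φ (g • f) (g • w) = asympEquiv S φ f w :=
  Finsupp.mapDomain_apply (MulAction.injective g) (asympEquiv S φ f) w

omit [Finite G] in
theorem smul_eq_self_iff {f : AsympRing S φ} :
    (∀ g : G, g • f = f) ↔ ∀ (g : G) (w : W), asympEquiv S φ f (g • w) = asympEquiv S φ f w := by
  constructor
  · intro h g w
    conv_lhs => rw [← h g]
    rw [asympEquiv_smul]
  · intro h g
    apply (asympEquiv S φ).injective
    ext1 w
    have := asympEquiv_smul g f (g⁻¹ • w)
    rwa [← h g (g⁻¹ • w), smul_inv_smul] at this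

theorem prime_dvd_index (hG : IsPGroup p G) {H : Subgroup G} (hH : H < ⊤) : p ∣ H.index := by
  obtain ⟨n, hn⟩ := hG.index H
  rw [hn]
  refine dvd_pow_self p fun h0 => hH.ne ?_
  rw [h0, pow_zero] at hn
  exact Subgroup.index_eq_one.1 hn

theorem exists_index_eq_prime [Nontrivial G] (hG : IsPGroup p G) :
    ∃ H : Subgroup G, H < ⊤ ∧ H.index = p := by
  obtain ⟨n, hn⟩ := hG.exists_card_eq
  have hn0 : n ≠ 0 := by
    rintro rfl
    have := Finite.one_lt_card (α := G)
    rw [hn, pow_zero] at this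
    omega
  obtain ⟨m, rfl⟩ := Nat.exists_eq_succ_of_ne_zero hn0
  obtain ⟨H, hH⟩ := Sylow.exists_subgroup_card_pow_prime p (n := m) (G := G)
    (by rw [hn]; exact pow_dvd_pow p (Nat.le_succ m))
  have hp : p.Prime := Fact.out
  have hidx : H.index = p := by
    have := H.card_mul_index
    rw [hH, hn, pow_succ] at this
    exact Nat.eq_of_mul_eq_mul_left (pow_pos hp.pos m) this
  refine ⟨H, lt_top_iff_ne_top.2 ?_, hidx⟩
  rintro rfl
  rw [Subgroup.index_top] at hidx
  exact hp.one_lt.ne hidx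

theorem asympEquiv_relTrace (H : Subgroup G) (m : AsympRing S φ) (w : W) :
    asympEquiv S φ (relTrace H m) w = ∑ᶠ q : G ⧸ H, asympEquiv S φ (q.out • m) w := by
  let L : AsympRing S φ →+ ℤ := (Finsupp.applyAddHom w).comp (asympEquiv S φ).toAddMonoidHom
  exact AddMonoidHom.map_finsum L (Set.toFinite _)

/-- At a fixed w, the trace from H multiplies the coefficient by the index of H, a multiple of p. -/
theorem dvd_of_mem_traceSum (hG : IsPGroup p G) {f : AsympRing S φ} (hf : f ∈ traceSum G (AsympRing S φ))
    {w : W} (hw : ∀ g : G, g • w = w) : (p : ℤ) ∣ asympEquiv S φ f w := by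
  induction hf using AddSubgroup.closure_induction with
  | mem f hf =>
    obtain ⟨H, hH, m, -, rfl⟩ := hf
    rw [asympEquiv_relTrace]
    have : ∀ q : G ⧸ H, asympEquiv S φ (q.out • m) w = asympEquiv S φ m w := by
      intro q
      conv_lhs => rw [← hw q.out]
      rw [asympEquiv_smul]
    simp only [this]
    have := Fintype.ofFinite (G ⧸ H)
    rw [finsum_eq_sum_of_fintype, Finset.sum_const, Finset.card_univ, ← Nat.card_eq_fintype_card,
      nsmul_eq_mul]
    exact Dvd.dvd.mul_right (Int.natCast_dvd_natCast.2 (prime_dvd_index hG hH)) _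
  | zero => rw [map_zero]; exact dvd_zero _
  | add f g _ _ hf hg => rw [map_add]; exact dvd_add hf hg
  | neg f _ hf => rw [map_neg]; exact (dvd_neg).2 hf

/-- An invariant element is multiplied by p under the trace from a subgroup of index p. Such a
subgroup exists because G is non-trivial. -/
theorem nsmul_mem_traceSum [Nontrivial G] (hG : IsPGroup p G) {m : AsympRing S φ}
    (hm : ∀ g : G, g • m = m) : p • m ∈ traceSum G (AsympRing S φ) := by
  obtain ⟨H, hH, hidx⟩ := exists_index_eq_prime hG
  refine AddSubgroup.subset_closure ⟨H, hH, m, fun g _ => hm g, ?_⟩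
  have := Fintype.ofFinite (G ⧸ H)
  unfold relTrace
  simp only [hm]
  rw [finsum_eq_sum_of_fintype, Finset.sum_const, Finset.card_univ, ← Nat.card_eq_fintype_card]
  congr 1
  exact hidx.symm

open Classical in
theorem asympEquiv_relTrace_stabilizer (w x : W) :
    asympEquiv S φ (relTrace (MulAction.stabilizer G w) (t S φ w)) x =
      if x ∈ MulAction.orbit G w then 1 else 0 := by
  rw [asympEquiv_relTrace]
  simp only [smul_t, asympEquiv_t, Finsupp.single_apply]
  split_ifs with h
  · obtain ⟨g, rfl⟩ := h
    rw [finsum_eq_single _ (g : G ⧸ MulAction.stabilizer G w)]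
    · rw [if_pos]
      have h := QuotientGroup.mk_out_eq_mul (MulAction.stabilizer G w) g
      obtain ⟨k, hk⟩ := h
      rw [hk, mul_smul, k.2]
    · intro q hq
      rw [if_neg]
      intro h
      apply hq
      rw [← QuotientGroup.out_eq' q, eq_comm, QuotientGroup.eq]
      change (g⁻¹ * q.out) • w = w
      rw [mul_smul, h, inv_smul_smul]
  · refine finsum_eq_zero_of_forall_eq_zero fun q => ?_
    rw [if_neg]
    rintro rfl
    exact h ⟨_, rfl⟩

/-- Two kinds of traces suffice: multiples of p t_w for w fixed, and otherwise the orbit sum of w,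
which is a trace from the proper stabilizer of w. -/
theorem exists_mem_traceSum [Nontrivial G] (hG : IsPGroup p G) (w : W) (n : ℤ)
    (hw : (∀ g : G, g • w = w) → (p : ℤ) ∣ n) :
    ∃ z ∈ traceSum G (AsympRing S φ), (∀ g : G, g • z = z) ∧ asympEquiv S φ z w = n ∧
      ∀ x ∉ MulAction.orbit G w, asympEquiv S φ z x = 0 := by
  classical
  by_cases hfix : ∀ g : G, g • w = w
  · obtain ⟨c, rfl⟩ := hw hfix
    have ht : ∀ g : G, g • t S φ w = t S φ w := fun g => by rw [smul_t, hfix]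
    refine ⟨c • p • t S φ w, zsmul_mem (nsmul_mem_traceSum hG ht) c, fun g => ?_, ?_, ?_⟩
    · rw [smul_comm, smul_comm g p, ht]
    · rw [map_zsmul, map_nsmul, asympEquiv_t]
      simp [mul_comm]
    · intro x hx
      have : x ≠ w := by
        rintro rfl
        exact hx (MulAction.mem_orbit_self _)
      rw [map_zsmul, map_nsmul, asympEquiv_t]
      simp [this]
  · have hlt : MulAction.stabilizer G w < ⊤ := by
      refine lt_top_iff_ne_top.2 fun h => hfix fun g => ?_
      have : g ∈ MulAction.stabilizer G w := h ▸ Subgroup.mem_top g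
      exact this
    have hmem : relTrace (MulAction.stabilizer G w) (t S φ w) ∈ traceSum G (AsympRing S φ) :=
      AddSubgroup.subset_closure
        ⟨_, hlt, _, fun g hg => by rw [smul_t, MulAction.mem_stabilizer_iff.1 hg], rfl⟩
    refine ⟨n • relTrace (MulAction.stabilizer G w) (t S φ w), zsmul_mem hmem n, ?_, ?_,
      fun x hx => ?_⟩
    · rw [smul_eq_self_iff]
      intro g x
      rw [map_zsmul, Finsupp.smul_apply, Finsupp.smul_apply, asympEquiv_relTrace_stabilizer,
        asympEquiv_relTrace_stabilizer]
      congr 1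
      have : g • x ∈ MulAction.orbit G w ↔ x ∈ MulAction.orbit G w := by
        rw [← MulAction.orbit_eq_iff, ← MulAction.orbit_eq_iff, MulAction.orbit_smul]
      simp only [this]
    · rw [map_zsmul, Finsupp.smul_apply, asympEquiv_relTrace_stabilizer,
        if_pos (MulAction.mem_orbit_self w), smul_eq_mul, mul_one]
    · rw [map_zsmul, Finsupp.smul_apply, asympEquiv_relTrace_stabilizer, if_neg hx, smul_zero]

/-- Subtracting a suitable trace removes the whole orbit of w from the support, because the
difference stays invariant. The size of the support decreases. -/
theorem mem_traceSum_of_dvd [Nontrivial G] (hG : IsPGroup p G) {f : AsympRing S φ}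
    (hf : ∀ g : G, g • f = f)
    (hp : ∀ w : W, (∀ g : G, g • w = w) → (p : ℤ) ∣ asympEquiv S φ f w) :
    f ∈ traceSum G (AsympRing S φ) := by
  induction h : (asympEquiv S φ f).support.card using Nat.strong_induction_on generalizing f with
  | h n ih =>
    subst h
    by_cases h0 : f = 0
    · rw [h0]
      exact zero_mem _
    obtain ⟨w, hw⟩ : ∃ w, asympEquiv S φ f w ≠ 0 := by
      by_contra hne
      push Not at hne
      exact h0 ((asympEquiv S φ).map_eq_zero_iff.1 (Finsupp.ext hne))
    obtain ⟨z, hz, hzf, hzw, hzx⟩ := exists_mem_traceSum (S := S) (φ := φ) hG w _ (hp w)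
    have hfz : ∀ g : G, g • (f - z) = f - z := fun g => by rw [smul_sub, hf, hzf]
    have hw0 : asympEquiv S φ (f - z) w = 0 := by
      rw [map_sub, Finsupp.sub_apply, hzw, sub_self]
    have hlt : (asympEquiv S φ (f - z)).support.card < (asympEquiv S φ f).support.card := by
      refine Finset.card_lt_card ⟨fun x hx => ?_, fun hsub => ?_⟩
      · rw [Finsupp.mem_support_iff] at hx ⊢
        by_cases hxw : x ∈ MulAction.orbit G w
        · obtain ⟨g, rfl⟩ := hxw
          exact absurd ((smul_eq_self_iff.1 hfz g w).trans hw0) hx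
        · rwa [map_sub, Finsupp.sub_apply, hzx x hxw, sub_zero] at hx
      · exact Finsupp.mem_support_iff.1 (hsub (Finsupp.mem_support_iff.2 hw)) hw0
    have := ih _ hlt hfz (fun x hx => ?_) rfl
    · rw [← sub_add_cancel f z]
      exact add_mem this hz
    · rw [map_sub, Finsupp.sub_apply]
      exact dvd_sub (hp x hx) (dvd_of_mem_traceSum hG hz hx)

end Traces

/-! ### The quotient ring Br_G(M). -/

section BrauerRing

variable {G : Type*} [Group G] {M : Type*} [NonUnitalNonAssocRing M] [DistribMulAction G M] [Finite G]
  (hmul : ∀ (g : G) (a b : M), g • (a * b) = (g • a) * (g • b))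

theorem br_surjective : Function.Surjective (br hmul) := Quotient.mk_surjective

theorem br_add (x y : fixedRing hmul) : br hmul (x + y) = br hmul x + br hmul y := rfl

theorem br_mul (x y : fixedRing hmul) : br hmul (x * y) = br hmul x * br hmul y := rfl

theorem br_eq_iff {x y : fixedRing hmul} :
    br hmul x = br hmul y ↔ (x : M) - y ∈ traceSum G M := by
  refine (RingCon.eq _).trans ?_
  rw [TwoSidedIdeal.rel_iff, traceIdeal, TwoSidedIdeal.mem_mk']
  rfl

end BrauerRing

/-- Two surjections with the same fibres, compatible with sums and products, identify their
targets. -/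
theorem exists_ringEquiv_of_fibres {X Y Z : Type*} [Add X] [Mul X] [Add Y] [Mul Y] [Add Z] [Mul Z]
    (q : X → Y) (r : X → Z) (hq : Function.Surjective q) (hr : Function.Surjective r)
    (hqr : ∀ x y, q x = q y ↔ r x = r y)
    (hqa : ∀ x y, q (x + y) = q x + q y) (hqm : ∀ x y, q (x * y) = q x * q y)
    (hra : ∀ x y, r (x + y) = r x + r y) (hrm : ∀ x y, r (x * y) = r x * r y) :
    ∃ e : Y ≃+* Z, ∀ x, e (q x) = r x := by
  have key : ∀ x, r (Function.surjInv hq (q x)) = r x :=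
    fun x => (hqr _ _).1 (Function.surjInv_eq hq (q x))
  have key' : ∀ x, q (Function.surjInv hr (r x)) = q x :=
    fun x => (hqr _ _).2 (Function.surjInv_eq hr (r x))
  refine ⟨{ toFun := fun y => r (Function.surjInv hq y)
            invFun := fun z => q (Function.surjInv hr z)
            left_inv := ?_
            right_inv := ?_
            map_mul' := ?_
            map_add' := ?_ }, key⟩
  · intro y
    obtain ⟨x, rfl⟩ := hq y
    beta_reduce
    rw [key, key']
  · intro z
    obtain ⟨x, rfl⟩ := hr z
    beta_reduce
    rw [key', key]
  · intro y y'
    obtain ⟨x, rfl⟩ := hq y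
    obtain ⟨x', rfl⟩ := hq y'
    rw [← hqm, key, key, key, hrm]
  · intro y y'
    obtain ⟨x, rfl⟩ := hq y
    obtain ⟨x', rfl⟩ := hq y'
    rw [← hqa, key, key, key, hra]

/-! ### Coordinates modulo p in F_p ⊗ J. -/

section Tensor

variable {p : ℕ} {W : Type*} {S : Set W} {Γ : Type*} {φ : W → Γ}

theorem one_tmul_surjective (A : Type*) [AddCommGroup A] :
    Function.Surjective fun f : A => (1 : ZMod p) ⊗ₜ[ℤ] f := by
  intro x
  induction x using TensorProduct.induction_on with
  | zero => exact ⟨0, TensorProduct.tmul_zero _ _⟩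
  | tmul a f =>
    obtain ⟨n, rfl⟩ := ZMod.intCast_surjective a
    refine ⟨n • f, ?_⟩
    beta_reduce
    rw [TensorProduct.tmul_smul, TensorProduct.smul_tmul', zsmul_one]
  | add x y hx hy =>
    obtain ⟨f, rfl⟩ := hx
    obtain ⟨g, rfl⟩ := hy
    exact ⟨f + g, TensorProduct.tmul_add _ _ _⟩

theorem one_tmul_eq_iff {f g : AsympRing S φ} :
    (1 : ZMod p) ⊗ₜ[ℤ] f = 1 ⊗ₜ[ℤ] g ↔
      ∀ w, (p : ℤ) ∣ asympEquiv S φ f w - asympEquiv S φ g w := by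
  constructor
  · intro h w
    let c : AsympRing S φ →ₗ[ℤ] ℤ :=
      ((Finsupp.applyAddHom w).comp (asympEquiv S φ).toAddMonoidHom).toIntLinearMap
    have h' := congrArg (fun x => TensorProduct.rid ℤ (ZMod p) (LinearMap.lTensor (ZMod p) c x)) h
    simp only [LinearMap.lTensor_tmul, TensorProduct.rid_tmul, zsmul_one] at h'
    rw [← ZMod.intCast_zmod_eq_zero_iff_dvd]
    push_cast
    rw [sub_eq_zero]
    exact h'
  · intro h
    have hd : ∃ k : AsympRing S φ, f - g = (p : ℤ) • k := by
      refine ⟨(asympEquiv S φ).symm ((asympEquiv S φ (f - g)).mapRange (· / (p : ℤ))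
        (Int.zero_ediv _)), ?_⟩
      apply (asympEquiv S φ).injective
      ext1 w
      rw [map_zsmul, AddEquiv.apply_symm_apply, Finsupp.smul_apply, Finsupp.mapRange_apply, map_sub,
        Finsupp.sub_apply, smul_eq_mul, Int.mul_ediv_cancel' (h w)]
    obtain ⟨k, hk⟩ := hd
    rw [← sub_eq_zero, ← TensorProduct.tmul_sub, hk, TensorProduct.tmul_smul,
      TensorProduct.smul_tmul', zsmul_one]
    simp

end Tensor

/-! ### Comparison of J_G with the invariants of J. -/

section Main

variable {p : ℕ} {G : Type*} [Group G] {W : Type*} [Group W] [MulDistribMulAction G W] {S : Set W}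
  {Γ : Type*} [AddCommGroup Γ] [LinearOrder Γ] {φ : W → Γ}

/-- The additive map `J_G → J` with `t_w ↦ t_w`. -/
def asympIncl (G : Type*) [Group G] {W : Type*} [Group W] [MulDistribMulAction G W] {Γ : Type*}
    (S : Set W) (φ : W → Γ) :
    AsympRing (fixedSimple G S) (fixedWeight G φ) →+ AsympRing S φ :=
  (asympEquiv S φ).symm.toAddMonoidHom.comp
    ((Finsupp.mapDomain.addMonoidHom (Subtype.val : FixedPoints.subgroup G W → W)).comp
      (asympEquiv (fixedSimple G S) (fixedWeight G φ)).toAddMonoidHom)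

theorem asympIncl_t (v : FixedPoints.subgroup G W) :
    asympIncl G S φ (t (fixedSimple G S) (fixedWeight G φ) v) = t S φ v :=
  Finsupp.mapDomain_single

theorem asympEquiv_asympIncl (f : AsympRing (fixedSimple G S) (fixedWeight G φ))
    (v : FixedPoints.subgroup G W) :
    asympEquiv S φ (asympIncl G S φ f) v = asympEquiv (fixedSimple G S) (fixedWeight G φ) f v :=
  Finsupp.mapDomain_apply Subtype.val_injective _ v

theorem asympRing_induction {P : AsympRing S φ → Prop} (f : AsympRing S φ) (zero : P 0)
    (add : ∀ f g, P f → P g → P (f + g)) (smul_t : ∀ (n : ℤ) (w : W), P (n • t S φ w)) : P f := by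
  refine Finsupp.induction_linear (motive := fun f => P ((asympEquiv S φ).symm f)) f zero
    (fun f g hf hg => add _ _ hf hg) fun w n => ?_
  convert smul_t n w
  apply (asympEquiv S φ).injective
  rw [AddEquiv.apply_symm_apply, map_zsmul, asympEquiv_t, Finsupp.smul_single, smul_eq_mul, mul_one]

theorem smul_asympIncl (g : G) (f : AsympRing (fixedSimple G S) (fixedWeight G φ)) :
    g • asympIncl G S φ f = asympIncl G S φ f := by
  induction f using asympRing_induction with
  | zero => rw [map_zero, smul_zero]
  | add f f' hf hf' => rw [map_add, smul_add, hf, hf']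
  | smul_t n v => rw [map_zsmul, asympIncl_t, smul_comm, smul_t, v.2 g]

theorem asympEquiv_t_mul_t (x y z : W) :
    asympEquiv S φ (t S φ x * t S φ y) z = gam S φ x y z⁻¹ := by
  rw [t_mul_t]
  rfl

/-- The inclusion J_G → J need not be multiplicative. By bilinearity, the congruence of the γ says
that it is so modulo p at the coordinates in W^G, the only ones seen by the Brauer quotient. -/
theorem FixedDatum.dvd_asympIncl_mul [IsOrderedAddMonoid Γ] [Fact p.Prime] [Finite G]
    (F : FixedDatum p G S φ) (hP : LusztigConjectures S φ)
    (hPG : LusztigConjectures (fixedSimple G S) (fixedWeight G φ))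
    (f f' : AsympRing (fixedSimple G S) (fixedWeight G φ)) (v : FixedPoints.subgroup G W) :
    (p : ℤ) ∣ asympEquiv S φ (asympIncl G S φ f * asympIncl G S φ f') v -
      asympEquiv (fixedSimple G S) (fixedWeight G φ) (f * f') v := by
  induction f using asympRing_induction with
  | zero => simp
  | add f₁ f₂ h₁ h₂ =>
    have := dvd_add h₁ h₂
    rwa [← add_sub_add_comm, ← Finsupp.add_apply, ← Finsupp.add_apply, ← map_add, ← map_add,
      ← add_mul, ← add_mul, ← map_add] at this
  | smul_t n x =>
    induction f' using asympRing_induction with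
    | zero => simp
    | add f₁ f₂ h₁ h₂ =>
      have := dvd_add h₁ h₂
      rwa [← add_sub_add_comm, ← Finsupp.add_apply, ← Finsupp.add_apply, ← map_add, ← map_add,
        ← mul_add, ← mul_add, ← map_add] at this
    | smul_t m y =>
      rw [map_zsmul, map_zsmul, asympIncl_t, asympIncl_t, smul_mul_assoc, smul_mul_assoc,
        mul_smul_comm, mul_smul_comm, map_zsmul, map_zsmul, map_zsmul, map_zsmul,
        Finsupp.smul_apply, Finsupp.smul_apply, Finsupp.smul_apply, Finsupp.smul_apply,
        asympEquiv_t_mul_t, asympEquiv_t_mul_t, ← smul_sub, ← smul_sub]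
      exact Dvd.dvd.mul_left (Dvd.dvd.mul_left (F.dvd_gam_sub hP hPG x y v⁻¹) m) n

end Main

end

end UnequalHecke

/-! ### The isomorphism. -/

theorem mainTheorem5
    {B W Γ G : Type*} [Finite B] [Group W] (M : CoxeterMatrix B) (cs : CoxeterSystem M W)
    [AddCommGroup Γ] [LinearOrder Γ] [IsOrderedAddMonoid Γ]
    (S : Set W) (hcs : S = Set.range cs.simple)
    (φ : W → Γ) (hφ : UnequalHecke.IsWeight S φ)
    (p : ℕ) [Fact p.Prime]
    [Group G] [Finite G] [Nontrivial G] (hG : IsPGroup p G) [MulDistribMulAction G W]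
    (hGS : ∀ (g : G), ∀ s ∈ S, g • s ∈ S)
    (hGφ : ∀ (g : G) (w : W), φ (g • w) = φ w)
    (hb : UnequalHecke.IsBounded S φ)
    (hbG : UnequalHecke.IsBounded (UnequalHecke.fixedSimple G S) (UnequalHecke.fixedWeight G φ))
    (hP : UnequalHecke.LusztigConjectures S φ)
    (hPG : UnequalHecke.LusztigConjectures
      (UnequalHecke.fixedSimple G S) (UnequalHecke.fixedWeight G φ)) :
    ∃ e : ZMod p ⊗[ℤ] UnequalHecke.AsympRing
          (UnequalHecke.fixedSimple G S) (UnequalHecke.fixedWeight G φ) ≃+*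
        UnequalHecke.BrauerQuotient (UnequalHecke.smul_mul_asymp hGS hGφ),
      ∀ (w : FixedPoints.subgroup G W)
        (m : UnequalHecke.fixedRing (UnequalHecke.smul_mul_asymp hGS hGφ)),
        (m : UnequalHecke.AsympRing S φ) = UnequalHecke.t S φ w →
        e (1 ⊗ₜ[ℤ] UnequalHecke.t
          (UnequalHecke.fixedSimple G S) (UnequalHecke.fixedWeight G φ) w) =
        UnequalHecke.br (UnequalHecke.smul_mul_asymp hGS hGφ) m := by
  have hS : UnequalHecke.ExchangeSystem S := hcs ▸ UnequalHecke.exchangeSystem_range_simple cs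
  have hfin : S.Finite := hcs ▸ Set.finite_range cs.simple
  have F : UnequalHecke.FixedDatum p G S φ := ⟨⟨hS, hφ⟩, hfin, hGS, hGφ, hG⟩
  let ι : UnequalHecke.AsympRing (UnequalHecke.fixedSimple G S) (UnequalHecke.fixedWeight G φ) →
      UnequalHecke.fixedRing (UnequalHecke.smul_mul_asymp hGS hGφ) :=
    fun f => ⟨UnequalHecke.asympIncl G S φ f, fun g => UnequalHecke.smul_asympIncl g f⟩
  -- The trace ideal is described by coordinates: equality in Br_G(J) is congruence modulo p at the
  -- fixed points.
  have hbr : ∀ m m' : UnequalHecke.fixedRing (UnequalHecke.smul_mul_asymp hGS hGφ),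
      UnequalHecke.br (UnequalHecke.smul_mul_asymp hGS hGφ) m =
        UnequalHecke.br (UnequalHecke.smul_mul_asymp hGS hGφ) m' ↔
      ∀ v : FixedPoints.subgroup G W, (p : ℤ) ∣
        UnequalHecke.asympEquiv S φ (m : UnequalHecke.AsympRing S φ) v -
          UnequalHecke.asympEquiv S φ (m' : UnequalHecke.AsympRing S φ) v := by
    intro m m'
    rw [UnequalHecke.br_eq_iff]
    constructor
    · intro h v
      have := UnequalHecke.dvd_of_mem_traceSum hG h v.2
      rwa [map_sub, Finsupp.sub_apply] at this
    · intro h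
      refine UnequalHecke.mem_traceSum_of_dvd hG (fun g => by rw [smul_sub, m.2 g, m'.2 g]) ?_
      intro w hw
      rw [map_sub, Finsupp.sub_apply]
      exact h ⟨w, hw⟩
  have hsurj : Function.Surjective
      fun f => UnequalHecke.br (UnequalHecke.smul_mul_asymp hGS hGφ) (ι f) := by
    intro b
    obtain ⟨m, rfl⟩ := UnequalHecke.br_surjective _ b
    -- The preimage keeps the coordinates of m at fixed points; the rest of m is a trace.
    refine ⟨(UnequalHecke.asympEquiv _ _).symm (UnequalHecke.res G (UnequalHecke.asympEquiv S φ m)),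
      (hbr _ _).2 fun v => ?_⟩
    change (p : ℤ) ∣ UnequalHecke.asympEquiv S φ (UnequalHecke.asympIncl G S φ _) v - _
    rw [UnequalHecke.asympEquiv_asympIncl, AddEquiv.apply_symm_apply, UnequalHecke.res_apply,
      sub_self]
    exact dvd_zero _
  have hiff : ∀ f f', (1 : ZMod p) ⊗ₜ[ℤ] f = 1 ⊗ₜ[ℤ] f' ↔
      UnequalHecke.br (UnequalHecke.smul_mul_asymp hGS hGφ) (ι f) =
        UnequalHecke.br (UnequalHecke.smul_mul_asymp hGS hGφ) (ι f') := by
    intro f f'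
    rw [UnequalHecke.one_tmul_eq_iff, hbr]
    refine forall_congr' fun v => ?_
    rw [← UnequalHecke.asympEquiv_asympIncl, ← UnequalHecke.asympEquiv_asympIncl]
  have hadd : ∀ f f', UnequalHecke.br (UnequalHecke.smul_mul_asymp hGS hGφ) (ι (f + f')) =
      UnequalHecke.br (UnequalHecke.smul_mul_asymp hGS hGφ) (ι f) +
        UnequalHecke.br (UnequalHecke.smul_mul_asymp hGS hGφ) (ι f') := by
    intro f f'
    rw [← UnequalHecke.br_add]
    congr 1
    exact Subtype.ext (map_add (UnequalHecke.asympIncl G S φ) f f')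
  have hmul : ∀ f f', UnequalHecke.br (UnequalHecke.smul_mul_asymp hGS hGφ) (ι (f * f')) =
      UnequalHecke.br (UnequalHecke.smul_mul_asymp hGS hGφ) (ι f) *
        UnequalHecke.br (UnequalHecke.smul_mul_asymp hGS hGφ) (ι f') := by
    intro f f'
    rw [← UnequalHecke.br_mul, hbr]
    intro v
    rw [dvd_sub_comm]
    have := F.dvd_asympIncl_mul hP hPG f f' v
    rwa [← UnequalHecke.asympEquiv_asympIncl] at this
  -- Both rings are quotients of J_G by the same relation, congruence of all coordinates modulo p,
  -- with compatible sums and products.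
  obtain ⟨e, he⟩ := UnequalHecke.exists_ringEquiv_of_fibres (fun f => (1 : ZMod p) ⊗ₜ[ℤ] f) _
    (UnequalHecke.one_tmul_surjective _) hsurj hiff (fun f f' => TensorProduct.tmul_add _ _ _)
    (fun f f' => by rw [Algebra.TensorProduct.tmul_mul_tmul, one_mul]) hadd hmul
  refine ⟨e, fun w m hm => (he _).trans ?_⟩
  congr 1
  exact Subtype.ext ((UnequalHecke.asympIncl_t w).trans hm.symm)
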